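/- **Second convolution identity.** Write $(a)_n=a(a+1)\cdots(a+n-1)$, and for a non-negative integer $n$ write $n=2n_e+n_p$ with $n_p\in\{0,1\}$. *Big $-1$ Jacobi polynomials.* For $n$ even $$J_n(x;a,b,c)={}_2F_1\!\left(-\tfrac n2,\tfrac{n+a+b+2}{2};\tfrac{a+1}{2};\tfrac{1-x^2}{1-c^2}\right)+\tfrac{n(1-x)}{(1+c)(a+1)}\,{}_2F_1\!\left(1-\tfrac n2,\tfrac{n+a+b+2}{2};\tfrac{a+3}{2};\tfrac{1-x^2}{1-c^2}\right),$$ (the second term being $0$ for $n=0$), and for $n$ odd $$J_n(x;a,b,c)={}_2F_1\!\left(-\tfrac{n-1}2,\tfrac{n+a+b+1}{2};\tfrac{a+1}{2};\tfrac{1-x^2}{1-c^2}\right)-\tfrac{(n+a+b+1)(1-x)}{(1+c)(a+1)}\,{}_2F_1\!\left(-\tfrac{n-1}2,\tfrac{n+a+b+3}{2};\tfrac{a+3}{2};\tfrac{1-x^2}{1-c^2}\right).$$ Put $$h^{J}_n(a,b)=\begin{cases}\dfrac{2\,\Gamma(\frac{n+b+1}{2})\,\Gamma(\frac{n+a+3}{2})\,(\frac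 n2)!}{(n+a+1)\,\Gamma(\frac{n+a+b+2}{2})\,(\frac{a+1}{2})_{n/2}^2},& n\text{ even},\\[3mm]\dfrac{(n+a+b+1)\,\Gamma(\frac{n+b+2}{2})\,\Gamma(\frac{n+a+2}{2})\,(\frac{n-1}{2})!}{2\,\Gamma(\frac{n+a+b+3}{2})\,(\frac{a+1}{2})_{(n+1)/2}^2},& n\text{ odd}.\end{cases}$$ *Bannai–Ito polynomials.* For parameters $\rho_1,\rho_2,r_1,r_2$ let $g=\rho_1+\rho_2-r_1-r_2$ and $$\eta_n=(-1)^n\frac{(\rho_1-r_1+\frac12)_{n_e+n_p}(\rho_2-r_1+\frac12)_{n_e+n_p}(1-r_1-r_2)_{n_e}}{(n_e+g+1)_{n_e+n_p}},$$ $$\begin{aligned}\tfrac1{\eta_n}B_n(x;\rho_1,\rho_2,r_1,r_2)=&\;{}_4F_3\!\left({-n_e,\;n_e+g+1,\;x-r_1+\frac12,\;-x-r_1+\frac12\atop 1-r_1-r_2,\;\rho_1-r_1+\frac12,\;\rho_2-r_1+\frac12};1\right)\\&+\tfrac{(-1)^n(n_e+n_p+gn_p)(x-r_1+\frac12)}{(\rho_1-r_1+\frac12)(\rho_2-r_1+\frac12)}\,{}_4F_3\!\left({-n_e-n_p+1,\;n_e+n_p+g+1,\;x-r_1+\frac32,\;-x-r_1+\frac12\atop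 1-r_1-r_2,\;\rho_1-r_1+\frac32,\;\rho_2-r_1+\frac32};1\right)\end{aligned}$$ (the second term being $0$ for $n=0$). Let $x_k=(-1)^k(\frac k2+\rho_1+\frac14)-\frac14$, $$w_k=\frac{(-1)^k}{k_e!}\,\frac{(\rho_1-r_1+\frac12)_{k_e+k_p}(\rho_1-r_2+\frac12)_{k_e+k_p}(\rho_1+\rho_2+1)_{k_e}(2\rho_1+1)_{k_e}}{(\rho_1+r_1+\frac12)_{k_e+k_p}(\rho_1+r_2+\frac12)_{k_e+k_p}(\rho_1-\rho_2+1)_{k_e}},$$ and, for $0\le n\le N$, if $N$ is even $$h_n=\frac{n_e!\,N_e!\,(1+2\rho_1)_{N_e}(1+\rho_1+\rho_2)_{n_e}(1+n_e+g)_{N_e-n_e}(\frac12+\rho_1-r_1)_{n_e+n_p}(\frac12+\rho_2-r_1)_{n_e+n_p}}{(N_e-n_e-n_p)!\,(\frac12+\rho_1+r_1)_{N_e-n_e}(\frac12+n_e+n_p+\rho_2-r_2)_{N_e-n_e-n_p}(1+n_e+g)_{n_e+n_p}^2},$$ and if $N$ is odd $$h_n=\frac{n_e!\,N_e!\,(1+2\rho_1)_{N_e+1}(1-r_1-r_2)_{n_e}(1+n_e+g)_{N_e+1-n_e}(\frac12+\rho_1-r_1)_{n_e+n_p}(\frac12+\rho_1-r_2)_{n_e+n_p}}{(N_e-n_e)!\,(\frac12+\rho_1+r_1)_{N_e+1-n_e-n_p}(\frac12+n_e+n_p+\rho_2-r_2)_{N_e+1-n_e-n_p}(1+n_e+g)_{n_e+n_p}^2}.$$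 *Coupling.* Let $\mu_1,\mu_2,\mu_3>0$, $\epsilon_1,\epsilon_2,\epsilon_3\in\{1,-1\}$, let $c,\lambda_1,\lambda_2,\lambda_3$ be real with $|c|<|\lambda_1|<|\lambda_2|<|\lambda_3|$, and let $j_{12},j_{23},j_{(12)3},j_{1(23)},j_{123}$ be non-negative integers related by $$j_{123}=j_{(12)3}+j_{12}=j_{1(23)}+j_{23}.$$ Put $\mu_{12}=\mu_1+\mu_2+j_{12}+\frac12$, $\epsilon_{12}=\epsilon_1\epsilon_2(-1)^{j_{12}}$, $\mu_{23}=\mu_2+\mu_3+j_{23}+\frac12$, $\epsilon_{23}=\epsilon_2\epsilon_3(-1)^{j_{23}}$, $\mu_{123}=\mu_1+\mu_2+\mu_3+1+j_{123}$. For the coupling of $(\mu_a,\epsilon_a)$ with $(\mu_b,\epsilon_b)$ (where $a,b$ may be any of the labels $1,2,3,12,23$) set $$K_j(\lambda;\mu_b,\mu_a;c)=\sqrt{\left(\frac{\lambda^2-c^2}{2}\right)^{j}\left(\frac{\lambda-c\,\epsilon_a\epsilon_b}{\lambda-(-1)^jc\,\epsilon_a\epsilon_b}\right)\frac{\Gamma(\mu_a+\frac12)\Gamma(\mu_b+\frac12)}{\Gamma(\mu_a+\mu_b+j+1)\,h^J_j(2\mu_b,2\mu_a)}},$$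 the square root being non-negative. Let $\varphi=j_{123}\frac{(j_{12}-1)j_{12}}2+(j_{123}+1)\left(j_{23}+\frac{(j_{12}+1)j_{12}}2\right)$. Then $$\begin{aligned}&K_{j_{12}}(\lambda_2;\mu_2,\mu_1;c)\,J_{j_{12}}\!\left(\tfrac{\epsilon_2\lambda_1}{\lambda_2};2\mu_2,2\mu_1,-\tfrac{c\epsilon_1\epsilon_2}{\lambda_2}\right)K_{j_{(12)3}}(\lambda_3;\mu_3,\mu_{12};c)\,J_{j_{(12)3}}\!\left(\tfrac{\epsilon_3\lambda_2}{\lambda_3};2\mu_3,2\mu_{12},-\tfrac{c\epsilon_{12}\epsilon_3}{\lambda_3}\right)\\&=\operatorname{sign}(\lambda_2\lambda_3)^{j_{12}}\sum_{j_{23}=0}^{j_{123}}(-1)^{\varphi}\epsilon_3^{j_{12}}\sqrt{\frac{w_{j_{23}}}{h_{j_{12}}}}\;B_{j_{12}}\!\left(x_{j_{23}};\tfrac{\mu_2+\mu_3}2,\tfrac{\mu_1+(-1)^{j_{123}}\mu_{123}}2,\tfrac{\mu_3-\mu_2}2,\tfrac{(-1)^{j_{123}}\mu_{123}-\mu_1}2\right)\\&\quad\times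 K_{j_{23}}(\lambda_3;\mu_3,\mu_2;\lambda_1)\,J_{j_{23}}\!\left(\tfrac{\epsilon_3\lambda_2}{\lambda_3};2\mu_3,2\mu_2,-\tfrac{\lambda_1\epsilon_2\epsilon_3}{\lambda_3}\right)K_{j_{1(23)}}(\lambda_3;\mu_{23},\mu_1;c)\,J_{j_{1(23)}}\!\left(\tfrac{\epsilon_{23}\lambda_1}{\lambda_3};2\mu_{23},2\mu_1,-\tfrac{c\epsilon_1\epsilon_{23}}{\lambda_3}\right),\end{aligned}$$ where $x_k,w_k,h_n$ are taken with $N=j_{123}$ and with the parameters $\rho_1,\rho_2,r_1,r_2$ of the Bannai–Ito polynomial shown. In particular, the factor $\operatorname{sign}(\lambda_2\lambda_3)^{j_{12}}$ is $1$ when $\lambda_2$ and $\lambda_3$ have the same sign. -/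

import Mathlib

noncomputable section

/-- The Pochhammer symbol `(a)_n = a (a + 1) ⋯ (a + n - 1)`. -/
def poch (a : ℝ) (n : ℕ) : ℝ := (ascPochhammer ℝ n).eval a

/-- The generalized hypergeometric series `₄F₃(a₁, a₂, a₃, a₄; b₁, b₂, b₃; z)`. -/
def hypergeom43 (a₁ a₂ a₃ a₄ b₁ b₂ b₃ z : ℝ) : ℝ :=
  ∑' k : ℕ, poch a₁ k * poch a₂ k * poch a₃ k * poch a₄ k /
    (poch b₁ k * poch b₂ k * poch b₃ k * (k.factorial : ℝ)) * z ^ k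

/-! ### Big -1 Jacobi polynomials -/

/-- The Big -1 Jacobi polynomial `J_n(x; a, b, c)`. For `n = 0` the second series does not
terminate, but it is multiplied by `n = 0`. -/
def bigJacobi (n : ℕ) (x a b c : ℝ) : ℝ :=
  if Even n then
    ordinaryHypergeometric (-(n : ℝ) / 2) (((n : ℝ) + a + b + 2) / 2) ((a + 1) / 2)
        ((1 - x ^ 2) / (1 - c ^ 2))
      + (n : ℝ) * (1 - x) / ((1 + c) * (a + 1)) *
        ordinaryHypergeometric (1 - (n : ℝ) / 2) (((n : ℝ) + a + b + 2) / 2) ((a + 3) / 2)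
          ((1 - x ^ 2) / (1 - c ^ 2))
  else
    ordinaryHypergeometric (-((n : ℝ) - 1) / 2) (((n : ℝ) + a + b + 1) / 2) ((a + 1) / 2)
        ((1 - x ^ 2) / (1 - c ^ 2))
      - ((n : ℝ) + a + b + 1) * (1 - x) / ((1 + c) * (a + 1)) *
        ordinaryHypergeometric (-((n : ℝ) - 1) / 2) (((n : ℝ) + a + b + 3) / 2) ((a + 3) / 2)
          ((1 - x ^ 2) / (1 - c ^ 2))

/-- The normalization factor `h_n(a, b)` of the Big -1 Jacobi polynomials. -/
def bigJacobiNorm (n : ℕ) (a b : ℝ) : ℝ :=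
  if Even n then
    2 * Real.Gamma (((n : ℝ) + b + 1) / 2) * Real.Gamma (((n : ℝ) + a + 3) / 2) *
        ((n / 2).factorial : ℝ) /
      (((n : ℝ) + a + 1) * Real.Gamma (((n : ℝ) + a + b + 2) / 2) *
        poch ((a + 1) / 2) (n / 2) ^ 2)
  else
    ((n : ℝ) + a + b + 1) * Real.Gamma (((n : ℝ) + b + 2) / 2) *
        Real.Gamma (((n : ℝ) + a + 2) / 2) * (((n - 1) / 2).factorial : ℝ) /
      (2 * Real.Gamma (((n : ℝ) + a + b + 3) / 2) * poch ((a + 1) / 2) ((n + 1) / 2) ^ 2)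

/-! ### Bannai-Ito polynomials

An integer `n` is written `n = 2 n_e + n_p` with `n_p ∈ {0, 1}`: `n_e = n / 2`, `n_p = n % 2`. -/

/-- The four parameters `ρ₁, ρ₂, r₁, r₂` of the Bannai-Ito polynomials. -/
structure BIParams where
  ρ₁ : ℝ
  ρ₂ : ℝ
  r₁ : ℝ
  r₂ : ℝ

/-- The combination `g = ρ₁ + ρ₂ - r₁ - r₂`. -/
def BIParams.g (p : BIParams) : ℝ := p.ρ₁ + p.ρ₂ - p.r₁ - p.r₂

/-- The normalization coefficient `η_n`, which makes the Bannai-Ito polynomials monic. -/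
def bannaiItoEta (n : ℕ) (p : BIParams) : ℝ :=
  (-1) ^ n * (poch (p.ρ₁ - p.r₁ + 1 / 2) (n / 2 + n % 2) *
      poch (p.ρ₂ - p.r₁ + 1 / 2) (n / 2 + n % 2) * poch (1 - p.r₁ - p.r₂) (n / 2)) /
    poch (((n / 2 : ℕ) : ℝ) + p.g + 1) (n / 2 + n % 2)

/-- The monic Bannai-Ito polynomial `B_n(x; ρ₁, ρ₂, r₁, r₂)`. For `n = 0` the second series does
not terminate, but its prefactor is `0`. -/
def bannaiIto (n : ℕ) (x : ℝ) (p : BIParams) : ℝ :=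
  bannaiItoEta n p *
    (hypergeom43 (-((n / 2 : ℕ) : ℝ)) (((n / 2 : ℕ) : ℝ) + p.g + 1)
        (x - p.r₁ + 1 / 2) (-x - p.r₁ + 1 / 2)
        (1 - p.r₁ - p.r₂) (p.ρ₁ - p.r₁ + 1 / 2) (p.ρ₂ - p.r₁ + 1 / 2) 1
      + (-1) ^ n * (((n / 2 : ℕ) : ℝ) + ((n % 2 : ℕ) : ℝ) + p.g * ((n % 2 : ℕ) : ℝ)) *
          (x - p.r₁ + 1 / 2) / ((p.ρ₁ - p.r₁ + 1 / 2) * (p.ρ₂ - p.r₁ + 1 / 2)) *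
        hypergeom43 (-((n / 2 : ℕ) : ℝ) - ((n % 2 : ℕ) : ℝ) + 1)
          (((n / 2 : ℕ) : ℝ) + ((n % 2 : ℕ) : ℝ) + p.g + 1)
          (x - p.r₁ + 3 / 2) (-x - p.r₁ + 1 / 2)
          (1 - p.r₁ - p.r₂) (p.ρ₁ - p.r₁ + 3 / 2) (p.ρ₂ - p.r₁ + 3 / 2) 1)

/-- The grid points `x_k`. -/
def bannaiItoGrid (k : ℕ) (p : BIParams) : ℝ :=
  (-1) ^ k * ((k : ℝ) / 2 + p.ρ₁ + 1 / 4) - 1 / 4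

/-- The weights `w_k`. -/
def bannaiItoWeight (k : ℕ) (p : BIParams) : ℝ :=
  (-1) ^ k / ((k / 2).factorial : ℝ) *
    (poch (p.ρ₁ - p.r₁ + 1 / 2) (k / 2 + k % 2) * poch (p.ρ₁ - p.r₂ + 1 / 2) (k / 2 + k % 2) *
        poch (p.ρ₁ + p.ρ₂ + 1) (k / 2) * poch (2 * p.ρ₁ + 1) (k / 2)) /
    (poch (p.ρ₁ + p.r₁ + 1 / 2) (k / 2 + k % 2) * poch (p.ρ₁ + p.r₂ + 1 / 2) (k / 2 + k % 2) *
        poch (p.ρ₁ - p.ρ₂ + 1) (k / 2))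

/-- The normalization factors `h_n`, `0 ≤ n ≤ N`, for the truncation conditions
`r₂ - ρ₁ = (N + 1) / 2` (`N` even) and `ρ₁ + ρ₂ = -(N + 1) / 2` (`N` odd):
`∑ k ≤ N, w_k B_n(x_k) B_m(x_k) = h_n δ_{nm}`. For `n ≤ N` no subtraction of natural numbers
below is truncated. -/
def bannaiItoNorm (n N : ℕ) (p : BIParams) : ℝ :=
  if Even N then
    ((n / 2).factorial : ℝ) * ((N / 2).factorial : ℝ) * poch (1 + 2 * p.ρ₁) (N / 2) *
        poch (1 + p.ρ₁ + p.ρ₂) (n / 2) * poch (1 + ((n / 2 : ℕ) : ℝ) + p.g) (N / 2 - n / 2) *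
        poch (1 / 2 + p.ρ₁ - p.r₁) (n / 2 + n % 2) * poch (1 / 2 + p.ρ₂ - p.r₁) (n / 2 + n % 2) /
      (((N / 2 - n / 2 - n % 2).factorial : ℝ) * poch (1 / 2 + p.ρ₁ + p.r₁) (N / 2 - n / 2) *
        poch (1 / 2 + ((n / 2 : ℕ) : ℝ) + ((n % 2 : ℕ) : ℝ) + p.ρ₂ - p.r₂)
          (N / 2 - n / 2 - n % 2) *
        poch (1 + ((n / 2 : ℕ) : ℝ) + p.g) (n / 2 + n % 2) ^ 2)
  else
    ((n / 2).factorial : ℝ) * ((N / 2).factorial : ℝ) * poch (1 + 2 * p.ρ₁) (N / 2 + 1) *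
        poch (1 - p.r₁ - p.r₂) (n / 2) * poch (1 + ((n / 2 : ℕ) : ℝ) + p.g) (N / 2 + 1 - n / 2) *
        poch (1 / 2 + p.ρ₁ - p.r₁) (n / 2 + n % 2) * poch (1 / 2 + p.ρ₁ - p.r₂) (n / 2 + n % 2) /
      (((N / 2 - n / 2).factorial : ℝ) *
        poch (1 / 2 + p.ρ₁ + p.r₁) (N / 2 + 1 - n / 2 - n % 2) *
        poch (1 / 2 + ((n / 2 : ℕ) : ℝ) + ((n % 2 : ℕ) : ℝ) + p.ρ₂ - p.r₂)
          (N / 2 + 1 - n / 2 - n % 2) *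
        poch (1 + ((n / 2 : ℕ) : ℝ) + p.g) (n / 2 + n % 2) ^ 2)

/-! ### Coupling of representations of `osp(1|2)` -/

/-- The label `μ` of the `j`-th component of `(μ, ε) ⊗ (μ', ε')`. -/
def coupledMu (μ μ' : ℝ) (j : ℕ) : ℝ := μ + μ' + (j : ℝ) + 1 / 2

/-- The label `ε` of the `j`-th component of `(μ, ε) ⊗ (μ', ε')`. -/
def coupledEps (ε ε' : ℝ) (j : ℕ) : ℝ := ε * ε' * (-1) ^ j

/-- The factor `K_j(t; μ₂, μ₁; c)` for the coupling of `(μ₁, ε₁)` with `(μ₂, ε₂)`, with its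
dependence on `ε₂`, `ε₁` made explicit. -/
def couplingK (j : ℕ) (t μ₂ μ₁ c ε₂ ε₁ : ℝ) : ℝ :=
  Real.sqrt (((t ^ 2 - c ^ 2) / 2) ^ j * ((t - c * ε₁ * ε₂) / (t - (-1) ^ j * c * ε₁ * ε₂)) *
    (Real.Gamma (μ₁ + 1 / 2) * Real.Gamma (μ₂ + 1 / 2) /
      (Real.Gamma (coupledMu μ₁ μ₂ j + 1 / 2) * bigJacobiNorm j (2 * μ₂) (2 * μ₁))))

/-- The label `μ₁₂₃ = μ₁ + μ₂ + μ₃ + 1 + j₁₂₃` of a component of the three-fold product. -/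
def tripleMu (μ₁ μ₂ μ₃ : ℝ) (j₁₂₃ : ℕ) : ℝ := μ₁ + μ₂ + μ₃ + 1 + (j₁₂₃ : ℝ)

/-- The parameters of the Bannai-Ito polynomials in the Racah coefficients. -/
def racahParams (μ₁ μ₂ μ₃ : ℝ) (j₁₂₃ : ℕ) : BIParams where
  ρ₁ := (μ₂ + μ₃) / 2
  ρ₂ := (μ₁ + (-1) ^ j₁₂₃ * tripleMu μ₁ μ₂ μ₃ j₁₂₃) / 2
  r₁ := (μ₃ - μ₂) / 2
  r₂ := ((-1) ^ j₁₂₃ * tripleMu μ₁ μ₂ μ₃ j₁₂₃ - μ₁) / 2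

/-- The exponent `φ` of the phase factor; both divisions are exact. -/
def racahPhase (j₁₂ j₂₃ j₁₂₃ : ℕ) : ℕ :=
  j₁₂₃ * ((j₁₂ - 1) * j₁₂ / 2) + (j₁₂₃ + 1) * (j₂₃ + (j₁₂ + 1) * j₁₂ / 2)

end

/-!
Write `[n]_μ = n / 2` for even `n` and `[n]_μ = n / 2 + μ` for odd `n` (`bracket`). A positive
discrete series module of `osp(1|2)` with label `μ` has a basis on which the odd lowering operator
acts by `[n]_μ`, and the three-fold tensor product of such modules is realised on arrays
`v i j k`, that is on polynomials `∑ v i j k M_i(c, x) M_j(x, y) M_k(y, z)` with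
`M_n(x, y) = ∏_{t < n} (y - (-1)^t x)`. The theorem compares two bases of the space of lowest weight
vectors of degree `N` in this product, one for each order of coupling.

* In a product of two modules the lowest weight vector of degree `n` is explicit (`lowestVec`), and
  its polynomial `coupledPoly` is, up to normalisation, a Big -1 Jacobi polynomial: the expansion of
  `lowestVec` in the vectors obtained by raising the second factor is the defining `₂F₁` sum
  (`sum_jacobiCoeff_mul_signedPow`, `couplingK_mul_bigJacobi`).

* A lowest weight vector in the three-fold product is determined by its entries with middle index
  `0` (`eq_zero_of_tripleLower_eq_zero`). On that slice both coupled bases have product entries, and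
  the identity of polynomials becomes the triangular system of `coupledPoly_mul_eq_sum`.

* The solution of this system is a weight in `k`, times a factor in `n`, times a Bannai-Ito
  polynomial `b_n(x_k)`. Both sides of the system, as functions of `n`, satisfy the same three-term
  recurrence up to a gauge factor. The recurrence for `b_n(x_k)` comes from a Dunkl-type operator
  that acts bidiagonally on a Newton basis with nodes `(-1)^t (t + ν + 1/2) / 2`; the one for the
  known side comes from the same operator on the Newton basis with the nodes in reverse order. Both
  are instances of `bannaiItoOp_newtonBasis`. The case `n = 0` is a summation formula that follows
  from detailed balance of the weight (`sum_couplingWeight`). This yields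
  `coupledPoly_mul_eq_sum_biSum`.

* It remains to match normalisations. The weight and norm of the Bannai-Ito polynomials obey
  first-order recurrences with the same rates as the three-term recurrence, so `w_k` and `h_n` have
  closed forms in bracket factorials (`bannaiItoWeight_closed_form`, `bannaiItoNorm_closed_form`).
  These give the square of the wanted relation, and the sign of `η_n` gives the phase
  (`sqrt_weight_div_norm_mul_eta`).
-/

noncomputable section

/-! ### Arrays, raising and lowering operators -/

/-- The number `[n]_μ`: `n / 2` for even `n` and `n / 2 + μ` for odd `n`. It is the matrix element
of the odd lowering operator in the module with label `μ`. -/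
def bracket (μ : ℝ) (n : ℕ) : ℝ := if Even n then (n : ℝ) / 2 else (n : ℝ) / 2 + μ

/-- The product `[1]_μ [2]_μ ⋯ [n]_μ`. -/
def bracketFactorial (μ : ℝ) (n : ℕ) : ℝ := ∏ t ∈ Finset.range n, bracket μ (t + 1)

/-- The product `M_n(x, y) = ∏_{t < n} (y - (-1)^t x)`. -/
def signedPow (n : ℕ) (x y : ℝ) : ℝ := ∏ t ∈ Finset.range n, (y - (-1) ^ t * x)

/-- The polynomial `∑_{i + j = d} v i j M_i(c, x) M_j(x, y)` of the degree `d` part of an array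
`v`. -/
def pairPoly (v : ℕ → ℕ → ℝ) (d : ℕ) (c x y : ℝ) : ℝ :=
  ∑ p ∈ Finset.HasAntidiagonal.antidiagonal d, v p.1 p.2 * (signedPow p.1 c x * signedPow p.2 x y)

/-- The odd raising operator of a product of two modules:
`(R v) i j = v i (j - 1) + (-1)^j v (i - 1) j`, with entries of negative index read as `0`. -/
def raiseOp (v : ℕ → ℕ → ℝ) : ℕ → ℕ → ℝ
  | 0, 0 => 0
  | 0, j + 1 => v 0 j
  | i + 1, 0 => v i 0
  | i + 1, j + 1 => v (i + 1) j + (-1) ^ (j + 1) * v i (j + 1)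

/-- The odd lowering operator of the product of the modules with labels `μ₁` and `μ₂`. The sign
`(-1)^j` is the grading of the second factor. -/
def lowerOp (μ₁ μ₂ : ℝ) (v : ℕ → ℕ → ℝ) (i j : ℕ) : ℝ :=
  bracket μ₂ (j + 1) * v i (j + 1) + (-1) ^ j * bracket μ₁ (i + 1) * v (i + 1) j

/-- The lowest weight vector of degree `n` in the product of the modules with labels `μ₁` and
`μ₂`. -/
def lowestVec (μ₁ μ₂ : ℝ) (n i j : ℕ) : ℝ :=
  if i + j = n then
    (-1) ^ (j * (j + 1) / 2) / (bracketFactorial μ₁ i * bracketFactorial μ₂ j) else 0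

/-- The polynomial of `lowestVec`; up to normalisation a Big -1 Jacobi polynomial. -/
def coupledPoly (μ₁ μ₂ : ℝ) (n : ℕ) (c x y : ℝ) : ℝ := pairPoly (lowestVec μ₁ μ₂ n) n c x y

lemma bracket_add_bracket_succ (μ : ℝ) (n : ℕ) :
    bracket μ n + bracket μ (n + 1) = n + μ + 1 / 2 := by
  rcases Nat.even_or_odd n with h | h
  · have : ¬ Even (n + 1) := by simpa [Nat.even_add_one] using h
    simp only [bracket, h, this, if_true, if_false]; push_cast; ring
  · have h' : ¬ Even n := by simpa using h
    have : Even (n + 1) := h.add_one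
    simp only [bracket, h', this, if_true, if_false]; push_cast; ring

lemma bracket_zero (μ : ℝ) : bracket μ 0 = 0 := by simp [bracket]

lemma bracket_succ_pos {μ : ℝ} (hμ : 0 < μ + 1 / 2) (n : ℕ) : 0 < bracket μ (n + 1) := by
  have : (0 : ℝ) ≤ n := n.cast_nonneg
  unfold bracket
  split_ifs <;> push_cast <;> linarith

lemma bracketFactorial_zero (μ : ℝ) : bracketFactorial μ 0 = 1 := by simp [bracketFactorial]

lemma bracketFactorial_succ (μ : ℝ) (n : ℕ) :
    bracketFactorial μ (n + 1) = bracketFactorial μ n * bracket μ (n + 1) :=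
  Finset.prod_range_succ _ _

lemma bracketFactorial_pos {μ : ℝ} (hμ : 0 < μ + 1 / 2) (n : ℕ) : 0 < bracketFactorial μ n :=
  Finset.prod_pos fun _ _ => bracket_succ_pos hμ _

lemma signedPow_zero (x y : ℝ) : signedPow 0 x y = 1 := by simp [signedPow]

lemma signedPow_succ (n : ℕ) (x y : ℝ) :
    signedPow (n + 1) x y = signedPow n x y * (y - (-1) ^ n * x) :=
  Finset.prod_range_succ _ _

lemma signedPow_smul {η : ℝ} (n : ℕ) (x y : ℝ) :
    signedPow n (η * x) (η * y) = η ^ n * signedPow n x y := by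
  induction n with
  | zero => simp [signedPow_zero]
  | succ n ih => rw [signedPow_succ, signedPow_succ, ih]; ring

/-- Raising an array of degree `d` multiplies its polynomial by `y - (-1)^d c`. -/
lemma pairPoly_raise (v : ℕ → ℕ → ℝ) (d : ℕ) (c x y : ℝ) :
    pairPoly (raiseOp v) (d + 1) c x y = (y - (-1) ^ d * c) * pairPoly v d c x y := by
  have key : ∀ p ∈ Finset.HasAntidiagonal.antidiagonal d,
      (y - (-1) ^ d * c) * (v p.1 p.2 * (signedPow p.1 c x * signedPow p.2 x y)) =
        v p.1 p.2 * (signedPow p.1 c x * signedPow (p.2 + 1) x y) +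
        (-1) ^ p.2 * v p.1 p.2 * (signedPow (p.1 + 1) c x * signedPow p.2 x y) := by
    rintro ⟨i, j⟩ h
    obtain rfl : i + j = d := by simpa using h
    simp only [signedPow_succ, pow_add]
    have : ((-1 : ℝ) ^ j) * (-1) ^ j = 1 := by rw [← mul_pow]; simp
    ring
  unfold pairPoly
  rw [Finset.mul_sum, Finset.sum_congr rfl key, Finset.sum_add_distrib]
  cases d with
  | zero => simp [Finset.Nat.antidiagonal_succ, raiseOp]
  | succ d =>
    rw [Finset.Nat.sum_antidiagonal_succ, Finset.Nat.sum_antidiagonal_succ']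
    rw [Finset.Nat.sum_antidiagonal_succ (n := d)
        (f := fun p => v p.1 p.2 * (signedPow p.1 c x * signedPow (p.2 + 1) x y)),
      Finset.Nat.sum_antidiagonal_succ' (n := d)
        (f := fun p => (-1) ^ p.2 * v p.1 p.2 * (signedPow (p.1 + 1) c x * signedPow p.2 x y))]
    simp only [raiseOp, add_mul, Finset.sum_add_distrib]
    simp
    ring

/-- The anticommutator of the lowering and the raising operator is diagonal. -/
lemma lower_raise_add (μ₁ μ₂ : ℝ) (v : ℕ → ℕ → ℝ) (i j : ℕ) :
    lowerOp μ₁ μ₂ (raiseOp v) i j + raiseOp (lowerOp μ₁ μ₂ v) i j =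
      (i + j + μ₁ + μ₂ + 1) * v i j := by
  rcases i with _ | i <;> rcases j with _ | j
  · simp only [lowerOp, raiseOp, pow_zero, bracket]; norm_num; ring
  · have h := bracket_add_bracket_succ μ₂ (j + 1)
    simp only [lowerOp, raiseOp, pow_succ]
    have : ((-1 : ℝ) ^ j) * (-1) ^ j = 1 := by rw [← mul_pow]; simp
    have h1 : bracket μ₁ 1 = 1 / 2 + μ₁ := by norm_num [bracket]
    rw [zero_add, h1]
    push_cast at h ⊢
    linear_combination v 0 (j + 1) * h + (1 / 2 + μ₁) * v 0 (j + 1) * this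
  · have h := bracket_add_bracket_succ μ₁ (i + 1)
    simp only [lowerOp, raiseOp, pow_succ, pow_zero]
    have h1 : bracket μ₂ 1 = 1 / 2 + μ₂ := by norm_num [bracket]
    rw [zero_add, h1]
    push_cast at h ⊢
    linear_combination v (i + 1) 0 * h
  · have h := bracket_add_bracket_succ μ₁ (i + 1)
    have h' := bracket_add_bracket_succ μ₂ (j + 1)
    simp only [lowerOp, raiseOp, pow_succ]
    have : ((-1 : ℝ) ^ j) * (-1) ^ j = 1 := by rw [← mul_pow]; simp
    push_cast at h h' ⊢
    linear_combination v (i + 1) (j + 1) * h + v (i + 1) (j + 1) * h' +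
      (bracket μ₁ (i + 1) + bracket μ₁ (i + 1 + 1)) * v (i + 1) (j + 1) * this

/-! ### Iterated raising and lowest weight vectors -/

lemma raise_add (v w : ℕ → ℕ → ℝ) : raiseOp (v + w) = raiseOp v + raiseOp w := by
  funext i j
  rcases i with _ | i <;> rcases j with _ | j <;> (simp [raiseOp]; try ring)

lemma raise_smul (a : ℝ) (v : ℕ → ℕ → ℝ) : raiseOp (a • v) = a • raiseOp v := by
  funext i j
  rcases i with _ | i <;> rcases j with _ | j <;> (simp [raiseOp]; try ring)

lemma raise_zero : raiseOp 0 = 0 := by simpa using raise_smul 0 0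

lemma raise_iterate_zero (m : ℕ) : raiseOp^[m] 0 = 0 := by
  induction m with
  | zero => rfl
  | succ m ih => rw [Function.iterate_succ_apply', ih, raise_zero]

lemma raise_iterate_smul (m : ℕ) (a : ℝ) (v : ℕ → ℕ → ℝ) :
    raiseOp^[m] (a • v) = a • raiseOp^[m] v := by
  induction m with
  | zero => rfl
  | succ m ih => rw [Function.iterate_succ_apply', ih, raise_smul, Function.iterate_succ_apply']

/-- The array `v` is supported on `i + j = d`. -/
def IsHomogeneousOfDegree (d : ℕ) (v : ℕ → ℕ → ℝ) : Prop := ∀ i j, i + j ≠ d → v i j = 0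

lemma IsHomogeneousOfDegree.raise {d : ℕ} {v : ℕ → ℕ → ℝ} (h : IsHomogeneousOfDegree d v) :
    IsHomogeneousOfDegree (d + 1) (raiseOp v) := by
  intro i j hij
  rcases i with _ | i <;> rcases j with _ | j <;> simp only [raiseOp]
  · exact h _ _ (by omega)
  · exact h _ _ (by omega)
  · rw [h _ _ (by omega), h _ _ (by omega)]; simp

lemma IsHomogeneousOfDegree.raise_iterate {d : ℕ} {v : ℕ → ℕ → ℝ}
    (h : IsHomogeneousOfDegree d v) (m : ℕ) : IsHomogeneousOfDegree (d + m) (raiseOp^[m] v) := by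
  induction m with
  | zero => exact h
  | succ m ih => rw [Function.iterate_succ_apply']; exact ih.raise

lemma IsHomogeneousOfDegree.lower_raise {d : ℕ} {v : ℕ → ℕ → ℝ}
    (h : IsHomogeneousOfDegree d v) (μ₁ μ₂ : ℝ) :
    lowerOp μ₁ μ₂ (raiseOp v) =
      ((d : ℝ) + μ₁ + μ₂ + 1) • v + (-1 : ℝ) • raiseOp (lowerOp μ₁ μ₂ v) := by
  funext i j
  have := lower_raise_add μ₁ μ₂ v i j
  simp only [Pi.add_apply, Pi.smul_apply, smul_eq_mul]
  by_cases hij : i + j = d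
  · have hd : (d : ℝ) = i + j := by rw [← hij]; push_cast; ring
    rw [hd]; linarith
  · rw [h i j hij] at this ⊢; linarith

/-- Commuting the lowering operator past a power of the raising operator. On a lowest weight vector
of degree `d` the raised vectors span a module with label `coupledMu μ₁ μ₂ d`. -/
lemma IsHomogeneousOfDegree.lower_raise_iterate {d : ℕ} {v : ℕ → ℕ → ℝ}
    (h : IsHomogeneousOfDegree d v) (μ₁ μ₂ : ℝ) (m : ℕ) :
    lowerOp μ₁ μ₂ (raiseOp^[m + 1] v) =
      bracket (coupledMu μ₁ μ₂ d) (m + 1) • raiseOp^[m] v +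
        ((-1 : ℝ) ^ (m + 1)) • raiseOp^[m + 1] (lowerOp μ₁ μ₂ v) := by
  induction m with
  | zero =>
    have := h.lower_raise μ₁ μ₂
    simp only [Function.iterate_succ_apply', Function.iterate_zero, id]
    rw [this]
    congr 2
    · simp [bracket, coupledMu]; ring
    · norm_num
  | succ m ih =>
    rw [Function.iterate_succ_apply', (h.raise_iterate (m + 1)).lower_raise, ih, raise_add,
      raise_smul, raise_smul, ← Function.iterate_succ_apply' raiseOp (m + 1),
      ← Function.iterate_succ_apply' raiseOp m]
    have hb := bracket_add_bracket_succ (coupledMu μ₁ μ₂ d) (m + 1)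
    funext i j
    simp only [Pi.add_apply, Pi.smul_apply, smul_eq_mul]
    simp only [coupledMu] at hb ⊢
    push_cast at hb ⊢
    rw [show bracket (μ₁ + μ₂ + (d : ℝ) + 1 / 2) (m + 1 + 1) = _ from eq_sub_of_add_eq' hb]
    ring

lemma pairPoly_raise_iterate (v : ℕ → ℕ → ℝ) (d m : ℕ) (c x y : ℝ) :
    pairPoly (raiseOp^[m] v) (d + m) c x y = signedPow m ((-1) ^ d * c) y * pairPoly v d c x y := by
  induction m with
  | zero => simp [signedPow_zero]
  | succ m ih =>
    rw [Function.iterate_succ_apply', ← add_assoc, pairPoly_raise, ih, signedPow_succ, pow_add]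
    ring

lemma raise_iterate_apply_zero_right (v : ℕ → ℕ → ℝ) (m i : ℕ) :
    (raiseOp^[m] v) (i + m) 0 = v i 0 := by
  induction m with
  | zero => rfl
  | succ m ih => rw [Function.iterate_succ_apply', ← ih]; rfl

lemma raise_iterate_apply_zero_left (v : ℕ → ℕ → ℝ) (m j : ℕ) :
    (raiseOp^[m] v) 0 (j + m) = v 0 j := by
  induction m with
  | zero => rfl
  | succ m ih => rw [Function.iterate_succ_apply', ← ih]; rfl

lemma neg_one_pow_triangle_succ (j : ℕ) :
    (-1 : ℝ) ^ ((j + 1) * (j + 1 + 1) / 2) = -(-1) ^ j * (-1) ^ (j * (j + 1) / 2) := by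
  have : (j + 1) * (j + 1 + 1) / 2 = j + 1 + j * (j + 1) / 2 := by
    rw [show (j + 1) * (j + 1 + 1) = j * (j + 1) + (j + 1) * 2 by ring,
      Nat.add_mul_div_right _ _ two_pos, add_comm]
  rw [this]; ring

lemma isHomogeneousOfDegree_lowestVec (μ₁ μ₂ : ℝ) (n : ℕ) :
    IsHomogeneousOfDegree n (lowestVec μ₁ μ₂ n) := fun _ _ h => if_neg h

lemma lower_lowestVec {μ₁ μ₂ : ℝ} (h₁ : 0 < μ₁ + 1 / 2) (h₂ : 0 < μ₂ + 1 / 2) (n : ℕ) :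
    lowerOp μ₁ μ₂ (lowestVec μ₁ μ₂ n) = 0 := by
  funext i j
  have hi := (bracketFactorial_pos h₁ i).ne'
  have hj := (bracketFactorial_pos h₂ j).ne'
  have hi' := (bracket_succ_pos h₁ i).ne'
  have hj' := (bracket_succ_pos h₂ j).ne'
  by_cases h : i + (j + 1) = n
  · have h' : i + 1 + j = n := by omega
    simp only [lowerOp, lowestVec, h, h', if_true, bracketFactorial_succ, neg_one_pow_triangle_succ,
      Pi.zero_apply]
    field_simp
    ring
  · have h' : i + 1 + j ≠ n := by omega
    simp [lowerOp, lowestVec, h, h']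

/-- A vector killed by the lowering operator is determined by its entries with second index `0`. -/
lemma eq_zero_of_lower_eq_zero {μ₁ μ₂ : ℝ} (h₂ : 0 < μ₂ + 1 / 2) {v : ℕ → ℕ → ℝ}
    (hv : lowerOp μ₁ μ₂ v = 0) (h0 : ∀ i, v i 0 = 0) : v = 0 := by
  have : ∀ j i, v i j = 0 := by
    intro j
    induction j with
    | zero => exact h0
    | succ j ih =>
      intro i
      have := congrFun (congrFun hv i) j
      simp only [lowerOp, ih, mul_zero, add_zero, Pi.zero_apply] at this
      exact (mul_eq_zero.1 this).resolve_left (bracket_succ_pos h₂ j).ne'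
  funext i j
  exact this j i

/-! ### The three-fold product -/

/-- The odd lowering operator of the product of the modules with labels `μ₁`, `μ₂`, `μ₃`. -/
def tripleLower (μ₁ μ₂ μ₃ : ℝ) (v : ℕ → ℕ → ℕ → ℝ) (i j k : ℕ) : ℝ :=
  bracket μ₃ (k + 1) * v i j (k + 1) + (-1) ^ k * bracket μ₂ (j + 1) * v i (j + 1) k +
    (-1) ^ (j + k) * bracket μ₁ (i + 1) * v (i + 1) j k

/-- A vector of the three-fold product killed by the lowering operator is determined by its entries
with middle index `0`: the equation at `(i, j, k)` expresses `v i (j + 1) k` through middle index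
`j`. -/
lemma eq_zero_of_tripleLower_eq_zero {μ₁ μ₂ μ₃ : ℝ} (h₂ : 0 < μ₂ + 1 / 2)
    {v : ℕ → ℕ → ℕ → ℝ} (hv : ∀ i j k, tripleLower μ₁ μ₂ μ₃ v i j k = 0)
    (h0 : ∀ i k, v i 0 k = 0) : ∀ j i k, v i j k = 0 := by
  intro j
  induction j with
  | zero => exact h0
  | succ j ih =>
    intro i k
    have := hv i j k
    simp only [tripleLower, ih, mul_zero, add_zero, zero_add] at this
    refine (mul_eq_zero.1 this).resolve_left (mul_ne_zero ?_ (bracket_succ_pos h₂ j).ne')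
    simp

/-- The polynomial `∑_{i + j + k = N} v i j k M_i(c, x) M_j(x, y) M_k(y, z)` of an array in three
indices. -/
def triplePoly (v : ℕ → ℕ → ℕ → ℝ) (N : ℕ) (c x y z : ℝ) : ℝ :=
  ∑ p ∈ Finset.HasAntidiagonal.antidiagonal N, ∑ q ∈ Finset.HasAntidiagonal.antidiagonal p.1,
    v q.1 q.2 p.2 * (signedPow q.1 c x * signedPow q.2 x y * signedPow p.2 y z)

lemma triplePoly_eq_sum_right (v : ℕ → ℕ → ℕ → ℝ) (N : ℕ) (c x y z : ℝ) :
    triplePoly v N c x y z = ∑ p ∈ Finset.HasAntidiagonal.antidiagonal N,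
      ∑ q ∈ Finset.HasAntidiagonal.antidiagonal p.2,
      v p.1 q.1 q.2 * (signedPow p.1 c x * signedPow q.1 x y * signedPow q.2 y z) := by
  unfold triplePoly
  rw [Finset.sum_sigma', Finset.sum_sigma']
  refine Finset.sum_nbij' (fun s => ⟨(s.2.1, s.2.2 + s.1.2), (s.2.2, s.1.2)⟩)
    (fun s => ⟨(s.1.1 + s.2.1, s.2.2), (s.1.1, s.2.1)⟩) ?_ ?_ ?_ ?_ ?_ <;>
  · rintro ⟨⟨a, b⟩, ⟨a', b'⟩⟩
    simp only [Finset.mem_sigma, Finset.HasAntidiagonal.mem_antidiagonal]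
    rintro ⟨h1, h2⟩
    first
      | exact ⟨by omega, trivial⟩
      | rfl
      | (subst h2; rfl)
      | (subst h2; trivial)

/-! ### Coupled polynomials as a single sum -/

lemma lowerOp_add (μ₁ μ₂ : ℝ) (v w : ℕ → ℕ → ℝ) :
    lowerOp μ₁ μ₂ (v + w) = lowerOp μ₁ μ₂ v + lowerOp μ₁ μ₂ w := by
  funext i j
  simp [lowerOp]; ring

lemma lowerOp_smul (μ₁ μ₂ a : ℝ) (v : ℕ → ℕ → ℝ) :
    lowerOp μ₁ μ₂ (a • v) = a • lowerOp μ₁ μ₂ v := by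
  funext i j
  simp [lowerOp]; ring

lemma lowerOp_zero (μ₁ μ₂ : ℝ) : lowerOp μ₁ μ₂ 0 = 0 := by
  simpa using lowerOp_smul μ₁ μ₂ 0 0

lemma lowerOp_sum {ι : Type*} (μ₁ μ₂ : ℝ) (s : Finset ι) (f : ι → ℕ → ℕ → ℝ) :
    lowerOp μ₁ μ₂ (∑ a ∈ s, f a) = ∑ a ∈ s, lowerOp μ₁ μ₂ (f a) := by
  classical
  induction s using Finset.induction_on with
  | empty => simp [lowerOp_zero]
  | insert a s ha ih => rw [Finset.sum_insert ha, Finset.sum_insert ha, lowerOp_add, ih]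

/-- The basis vector of degree `j` that is supported on the second factor. -/
def secondBasisVec (j i j' : ℕ) : ℝ := if i = 0 ∧ j' = j then 1 else 0

lemma isHomogeneousOfDegree_secondBasisVec (j : ℕ) :
    IsHomogeneousOfDegree j (secondBasisVec j) := by
  intro i j' h
  exact if_neg (by rintro ⟨rfl, rfl⟩; simp at h)

lemma pairPoly_secondBasisVec (j : ℕ) (c x y : ℝ) :
    pairPoly (secondBasisVec j) j c x y = signedPow j x y := by
  unfold pairPoly
  rw [Finset.sum_eq_single (0, j)]
  · simp [secondBasisVec, signedPow_zero]
  · rintro ⟨i, j'⟩ _ h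
    have : ¬ (i = 0 ∧ j' = j) := fun ⟨h1, h2⟩ => h (by rw [h1, h2])
    simp [secondBasisVec, this]
  · intro h; simp at h

lemma lowerOp_secondBasisVec_zero (μ₁ μ₂ : ℝ) : lowerOp μ₁ μ₂ (secondBasisVec 0) = 0 := by
  funext i j
  simp [lowerOp, secondBasisVec]

lemma lowerOp_secondBasisVec_succ (μ₁ μ₂ : ℝ) (j : ℕ) :
    lowerOp μ₁ μ₂ (secondBasisVec (j + 1)) = bracket μ₂ (j + 1) • secondBasisVec j := by
  funext i j'
  simp only [lowerOp, secondBasisVec, Pi.smul_apply, smul_eq_mul]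
  by_cases hj : j' = j
  · subst hj; simp
  · simp [hj]

/-- The coefficient of the `j`-th term in the expansion of `[n]_{μ₁}! • lowestVec μ₁ μ₂ n` in the
raised vectors `R^(n - j) e_{0 j}`; also the coefficient of the `j`-th term of the Big -1 Jacobi
polynomial. -/
def jacobiCoeff (μ₁ μ₂ : ℝ) (n j : ℕ) : ℝ :=
  ∏ t ∈ Finset.range j,
    (-1) ^ (n + t) * bracket (coupledMu μ₁ μ₂ t) (n - t) / bracket μ₂ (t + 1)

lemma jacobiCoeff_zero (μ₁ μ₂ : ℝ) (n : ℕ) : jacobiCoeff μ₁ μ₂ n 0 = 1 := by simp [jacobiCoeff]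

lemma jacobiCoeff_succ (μ₁ μ₂ : ℝ) (n j : ℕ) :
    jacobiCoeff μ₁ μ₂ n (j + 1) = jacobiCoeff μ₁ μ₂ n j *
      ((-1) ^ (n + j) * bracket (coupledMu μ₁ μ₂ j) (n - j) / bracket μ₂ (j + 1)) :=
  Finset.prod_range_succ _ _

lemma pairPoly_add (v w : ℕ → ℕ → ℝ) (d : ℕ) (c x y : ℝ) :
    pairPoly (v + w) d c x y = pairPoly v d c x y + pairPoly w d c x y := by
  simp [pairPoly, add_mul, Finset.sum_add_distrib]

lemma pairPoly_smul (a : ℝ) (v : ℕ → ℕ → ℝ) (d : ℕ) (c x y : ℝ) :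
    pairPoly (a • v) d c x y = a * pairPoly v d c x y := by
  simp [pairPoly, Finset.mul_sum, mul_assoc]

lemma pairPoly_sum {ι : Type*} (s : Finset ι) (f : ι → ℕ → ℕ → ℝ) (d : ℕ) (c x y : ℝ) :
    pairPoly (∑ a ∈ s, f a) d c x y = ∑ a ∈ s, pairPoly (f a) d c x y := by
  classical
  induction s using Finset.induction_on with
  | empty => simp [pairPoly]
  | insert a s ha ih => rw [Finset.sum_insert ha, Finset.sum_insert ha, pairPoly_add, ih]

/-- Both sides are killed by the lowering operator and agree where the second index is `0`. -/
lemma sum_jacobiCoeff_smul_raiseOp_iterate {μ₁ μ₂ : ℝ} (h₁ : 0 < μ₁ + 1 / 2)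
    (h₂ : 0 < μ₂ + 1 / 2) (n : ℕ) :
    ∑ j ∈ Finset.range (n + 1), jacobiCoeff μ₁ μ₂ n j • raiseOp^[n - j] (secondBasisVec j) =
      bracketFactorial μ₁ n • lowestVec μ₁ μ₂ n := by
  have step : ∀ m j, lowerOp μ₁ μ₂ (raiseOp^[m] (secondBasisVec j)) =
      bracket (coupledMu μ₁ μ₂ j) m • raiseOp^[m - 1] (secondBasisVec j) +
        ((-1 : ℝ) ^ m) • raiseOp^[m] (lowerOp μ₁ μ₂ (secondBasisVec j)) := by
    rintro (_ | m) j
    · simp [bracket_zero]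
    · exact (isHomogeneousOfDegree_secondBasisVec j).lower_raise_iterate μ₁ μ₂ m
  rw [← sub_eq_zero, sub_eq_add_neg, ← neg_one_smul ℝ]
  apply eq_zero_of_lower_eq_zero h₂ (μ₁ := μ₁)
  · rw [lowerOp_add, lowerOp_smul, lowerOp_smul, lower_lowestVec h₁ h₂, smul_zero, smul_zero,
      add_zero, lowerOp_sum]
    simp only [lowerOp_smul, step, smul_add, Finset.sum_add_distrib]
    rw [Finset.sum_range_succ, Finset.sum_range_succ' (fun j => jacobiCoeff μ₁ μ₂ n j •
      (-1 : ℝ) ^ (n - j) • raiseOp^[n - j] (lowerOp μ₁ μ₂ (secondBasisVec j)))]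
    rw [Nat.sub_self, bracket_zero, lowerOp_secondBasisVec_zero, raise_iterate_zero]
    simp only [zero_smul, smul_zero, add_zero]
    rw [← Finset.sum_add_distrib]
    refine Finset.sum_eq_zero fun j hj => ?_
    have hj := Finset.mem_range.1 hj
    obtain ⟨m, rfl⟩ : ∃ m, n = j + 1 + m := ⟨n - (j + 1), by omega⟩
    rw [lowerOp_secondBasisVec_succ, raise_iterate_smul, jacobiCoeff_succ]
    have e1 : j + 1 + m - j - 1 = m := by omega
    have e2 : j + 1 + m - (j + 1) = m := by omega
    rw [e1, e2, smul_smul, smul_smul, smul_smul, ← add_smul]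
    have hb := (bracket_succ_pos h₂ j).ne'
    have hs : ((-1 : ℝ) ^ (j + 1 + m + j)) * (-1) ^ m = -1 := by
      rw [← pow_add, Odd.neg_one_pow]
      exact ⟨j + m, by ring⟩
    convert zero_smul ℝ _ using 2
    field_simp
    linear_combination jacobiCoeff μ₁ μ₂ (j + 1 + m) j *
      bracket (coupledMu μ₁ μ₂ j) (j + 1 + m - j) * hs
  · intro i
    have hn := (bracketFactorial_pos h₁ n).ne'
    simp only [Pi.add_apply, Finset.sum_apply, Pi.smul_apply, smul_eq_mul]
    by_cases hi : i = n
    · subst hi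
      rw [Finset.sum_eq_single 0]
      · have := raise_iterate_apply_zero_right (secondBasisVec 0) i 0
        rw [zero_add] at this
        rw [Nat.sub_zero, this]
        simp [jacobiCoeff_zero, secondBasisVec, lowestVec, bracketFactorial_zero, hn]
      · intro j hj hj0
        have hj := Finset.mem_range.1 hj
        have := raise_iterate_apply_zero_right (secondBasisVec j) (i - j) j
        rw [show j + (i - j) = i by omega] at this
        simp [this, secondBasisVec, hj0]
      · simp
    · have h0 : ∀ j ∈ Finset.range (n + 1),
          jacobiCoeff μ₁ μ₂ n j * (raiseOp^[n - j] (secondBasisVec j)) i 0 = 0 := by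
        intro j hj
        have hj := Finset.mem_range.1 hj
        rw [(isHomogeneousOfDegree_secondBasisVec j).raise_iterate (n - j) i 0 (by omega),
          mul_zero]
      rw [Finset.sum_eq_zero h0]
      simp [lowestVec, hi]

theorem sum_jacobiCoeff_mul_signedPow {μ₁ μ₂ : ℝ} (h₁ : 0 < μ₁ + 1 / 2)
    (h₂ : 0 < μ₂ + 1 / 2) (n : ℕ) (c x y : ℝ) :
    ∑ j ∈ Finset.range (n + 1), jacobiCoeff μ₁ μ₂ n j *
        (signedPow (n - j) ((-1) ^ j * c) y * signedPow j x y) =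
      bracketFactorial μ₁ n * coupledPoly μ₁ μ₂ n c x y := by
  unfold coupledPoly
  rw [← pairPoly_smul, ← sum_jacobiCoeff_smul_raiseOp_iterate h₁ h₂, pairPoly_sum]
  refine Finset.sum_congr rfl fun j hj => ?_
  have hj := Finset.mem_range.1 hj
  have := pairPoly_raise_iterate (secondBasisVec j) j (n - j) c x y
  rw [show j + (n - j) = n by omega] at this
  rw [pairPoly_smul, this, pairPoly_secondBasisVec]

/-! ### The two orders of coupling -/

/-- The lowest weight vector of degree `N` obtained by coupling the first two factors in degree `n`
and the result with the third in degree `N - n`. It vanishes where `n + k > N`, so that the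
truncated subtractions do not matter. -/
def leftVec (μ₁ μ₂ μ₃ : ℝ) (N n i j k : ℕ) : ℝ :=
  lowestVec (coupledMu μ₁ μ₂ n) μ₃ (N - n) (N - n - k) k *
    (raiseOp^[N - n - k] (lowestVec μ₁ μ₂ n)) i j

/-- The lowest weight vector of degree `N` obtained by coupling the last two factors in degree `k`
and the first with the result in degree `N - k`. The sign `(-1)^(i k)` moves the first factor past
the coupled vector, of parity `k`. -/
def rightVec (μ₁ μ₂ μ₃ : ℝ) (N k i j l : ℕ) : ℝ :=
  (-1) ^ (i * k) * lowestVec μ₁ (coupledMu μ₂ μ₃ k) (N - k) i (N - k - i) *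
    (raiseOp^[N - k - i] (lowestVec μ₂ μ₃ k)) j l

lemma triplePoly_leftVec (μ₁ μ₂ μ₃ : ℝ) {N n : ℕ} (hn : n ≤ N) (c x y z : ℝ) :
    triplePoly (leftVec μ₁ μ₂ μ₃ N n) N c x y z =
      coupledPoly μ₁ μ₂ n c x y *
        coupledPoly (coupledMu μ₁ μ₂ n) μ₃ (N - n) ((-1) ^ n * c) y z := by
  unfold triplePoly
  conv_rhs => unfold coupledPoly
  rw [← Finset.Nat.sum_antidiagonal_swap, Finset.Nat.sum_antidiagonal_eq_sum_range_succ_mk]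
  conv_rhs => rw [pairPoly.eq_def (lowestVec (coupledMu μ₁ μ₂ n) μ₃ (N - n)),
    ← Finset.Nat.sum_antidiagonal_swap, Finset.Nat.sum_antidiagonal_eq_sum_range_succ_mk,
    Finset.mul_sum]
  simp only [Prod.swap]
  symm
  apply Finset.sum_subset_zero_on_sdiff (Finset.range_mono (by omega))
  · intro k hk
    simp only [Finset.mem_sdiff, Finset.mem_range] at hk
    refine Finset.sum_eq_zero fun p _ => ?_
    rw [leftVec, lowestVec, if_neg (by omega)]
    simp
  · intro k hk
    have hk := Finset.mem_range.1 hk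
    have := pairPoly_raise_iterate (lowestVec μ₁ μ₂ n) n (N - n - k) c x y
    rw [show n + (N - n - k) = N - k by omega] at this
    calc _ = lowestVec (coupledMu μ₁ μ₂ n) μ₃ (N - n) (N - n - k) k * signedPow k y z *
          pairPoly (raiseOp^[N - n - k] (lowestVec μ₁ μ₂ n)) (N - k) c x y := by rw [this]; ring
      _ = _ := by
        rw [pairPoly, Finset.mul_sum]
        refine Finset.sum_congr rfl fun p _ => ?_
        rw [leftVec]; ring

lemma triplePoly_rightVec (μ₁ μ₂ μ₃ : ℝ) {N k : ℕ} (hk : k ≤ N) (c x y z : ℝ) :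
    triplePoly (rightVec μ₁ μ₂ μ₃ N k) N c x y z =
      coupledPoly μ₂ μ₃ k x y z *
        coupledPoly μ₁ (coupledMu μ₂ μ₃ k) (N - k) ((-1) ^ k * c) ((-1) ^ k * x) z := by
  rw [triplePoly_eq_sum_right]
  conv_rhs => unfold coupledPoly
  rw [Finset.Nat.sum_antidiagonal_eq_sum_range_succ_mk]
  conv_rhs => rw [pairPoly.eq_def (lowestVec μ₁ (coupledMu μ₂ μ₃ k) (N - k)),
    Finset.Nat.sum_antidiagonal_eq_sum_range_succ_mk, Finset.mul_sum]
  symm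
  apply Finset.sum_subset_zero_on_sdiff (Finset.range_mono (by omega))
  · intro i hi
    simp only [Finset.mem_sdiff, Finset.mem_range] at hi
    refine Finset.sum_eq_zero fun p _ => ?_
    rw [rightVec, lowestVec, if_neg (by omega)]
    simp
  · intro i hi
    have hi := Finset.mem_range.1 hi
    have := pairPoly_raise_iterate (lowestVec μ₂ μ₃ k) k (N - k - i) x y z
    rw [show k + (N - k - i) = N - i by omega] at this
    calc _ = (-1) ^ (i * k) * lowestVec μ₁ (coupledMu μ₂ μ₃ k) (N - k) i (N - k - i) *
          signedPow i c x *
          pairPoly (raiseOp^[N - k - i] (lowestVec μ₂ μ₃ k)) (N - i) x y z := by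
            rw [this, signedPow_smul, ← pow_mul, mul_comm k i]; ring
      _ = _ := by
        rw [pairPoly, Finset.mul_sum]
        refine Finset.sum_congr rfl fun p _ => ?_
        rw [rightVec]; ring

lemma tripleLower_leftVec {μ₁ μ₂ μ₃ : ℝ} (h₁ : 0 < μ₁) (h₂ : 0 < μ₂) (h₃ : 0 < μ₃)
    (N n i j k : ℕ) : tripleLower μ₁ μ₂ μ₃ (leftVec μ₁ μ₂ μ₃ N n) i j k = 0 := by
  have hq := lower_lowestVec (μ₁ := μ₁) (μ₂ := μ₂) (by linarith) (by linarith) n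
  have h12 : 0 < coupledMu μ₁ μ₂ n + 1 / 2 := by unfold coupledMu; positivity
  have e : tripleLower μ₁ μ₂ μ₃ (leftVec μ₁ μ₂ μ₃ N n) i j k =
      bracket μ₃ (k + 1) * leftVec μ₁ μ₂ μ₃ N n i j (k + 1) +
      (-1) ^ k * lowestVec (coupledMu μ₁ μ₂ n) μ₃ (N - n) (N - n - k) k *
      lowerOp μ₁ μ₂ (raiseOp^[N - n - k] (lowestVec μ₁ μ₂ n)) i j := by
    simp only [tripleLower, leftVec, lowerOp, pow_add]; ring
  rw [e]
  by_cases hk : k + 1 ≤ N - n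
  · obtain ⟨m, hm⟩ : ∃ m, N - n - k = m + 1 := ⟨N - n - k - 1, by omega⟩
    have hm' : N - n - (k + 1) = m := by omega
    have := congrFun (congrFun (lower_lowestVec h12 (μ₂ := μ₃) (by linarith) (N - n)) m) k
    simp only [lowerOp, Pi.zero_apply] at this
    rw [leftVec, hm, hm', (isHomogeneousOfDegree_lowestVec μ₁ μ₂ n).lower_raise_iterate, hq,
      raise_iterate_zero]
    simp only [Pi.add_apply, Pi.smul_apply, smul_eq_mul, Pi.zero_apply, mul_zero, add_zero]
    linear_combination (raiseOp^[m] (lowestVec μ₁ μ₂ n)) i j * this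
  · rw [leftVec, lowestVec, if_neg (by omega)]
    by_cases hk' : k = N - n
    · rw [show N - n - k = 0 by omega]
      simp [hq]
    · rw [lowestVec, if_neg (by omega)]
      simp

lemma tripleLower_rightVec {μ₁ μ₂ μ₃ : ℝ} (h₁ : 0 < μ₁) (h₂ : 0 < μ₂) (h₃ : 0 < μ₃)
    (N k i j l : ℕ) : tripleLower μ₁ μ₂ μ₃ (rightVec μ₁ μ₂ μ₃ N k) i j l = 0 := by
  have hq := lower_lowestVec (μ₁ := μ₂) (μ₂ := μ₃) (by linarith) (by linarith) k
  have h23 : 0 < coupledMu μ₂ μ₃ k + 1 / 2 := by unfold coupledMu; positivity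
  have e : tripleLower μ₁ μ₂ μ₃ (rightVec μ₁ μ₂ μ₃ N k) i j l =
      (-1) ^ (i * k) * lowestVec μ₁ (coupledMu μ₂ μ₃ k) (N - k) i (N - k - i) *
      lowerOp μ₂ μ₃ (raiseOp^[N - k - i] (lowestVec μ₂ μ₃ k)) j l +
      (-1) ^ (j + l) * bracket μ₁ (i + 1) * rightVec μ₁ μ₂ μ₃ N k (i + 1) j l := by
    simp only [tripleLower, rightVec, lowerOp]; ring
  rw [e]
  by_cases hi : i + 1 ≤ N - k
  · obtain ⟨m, hm⟩ : ∃ m, N - k - i = m + 1 := ⟨N - k - i - 1, by omega⟩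
    have hm' : N - k - (i + 1) = m := by omega
    have := congrFun (congrFun (lower_lowestVec (μ₁ := μ₁) (by linarith) h23 (N - k)) i) m
    simp only [lowerOp, Pi.zero_apply] at this
    rw [rightVec, hm, hm', (isHomogeneousOfDegree_lowestVec μ₂ μ₃ k).lower_raise_iterate, hq,
      raise_iterate_zero]
    simp only [Pi.add_apply, Pi.smul_apply, smul_eq_mul, Pi.zero_apply, mul_zero, add_zero]
    by_cases hjl : j + l = k + m
    · have hs : ((-1 : ℝ) ^ k) * (-1) ^ k = 1 := by rw [← mul_pow]; simp
      rw [hjl, add_mul, one_mul, pow_add, pow_add]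
      linear_combination (-1) ^ (i * k) * (raiseOp^[m] (lowestVec μ₂ μ₃ k)) j l * this +
        (-1) ^ m * bracket μ₁ (i + 1) * (-1) ^ (i * k) *
        lowestVec μ₁ (coupledMu μ₂ μ₃ k) (N - k) (i + 1) m *
        (raiseOp^[m] (lowestVec μ₂ μ₃ k)) j l * hs
    · rw [(isHomogeneousOfDegree_lowestVec μ₂ μ₃ k).raise_iterate m j l hjl]; simp
  · rw [rightVec, lowestVec.eq_def μ₁ _ (N - k) (i + 1), if_neg (by omega)]
    by_cases hi' : i = N - k
    · rw [show N - k - i = 0 by omega]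
      simp [hq]
    · rw [lowestVec, if_neg (by omega)]
      simp

lemma triplePoly_sum_smul {ι : Type*} (s : Finset ι) (T : ι → ℝ) (f : ι → ℕ → ℕ → ℕ → ℝ)
    (N : ℕ) (c x y z : ℝ) :
    triplePoly (fun i j k => ∑ a ∈ s, T a * f a i j k) N c x y z =
      ∑ a ∈ s, T a * triplePoly (f a) N c x y z := by
  simp only [triplePoly, Finset.mul_sum, Finset.sum_mul]
  conv_rhs => rw [Finset.sum_comm]
  refine Finset.sum_congr rfl fun p _ => ?_
  conv_rhs => rw [Finset.sum_comm]
  exact Finset.sum_congr rfl fun q _ => Finset.sum_congr rfl fun a _ => by ring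

lemma leftVec_zero (μ₁ μ₂ μ₃ : ℝ) {N n s : ℕ} (hn : n ≤ N) (hs : s ≤ N) :
    leftVec μ₁ μ₂ μ₃ N n (N - s) 0 s = if n + s ≤ N then
      (-1) ^ (s * (s + 1) / 2) / (bracketFactorial (coupledMu μ₁ μ₂ n) (N - n - s) *
        bracketFactorial μ₃ s * bracketFactorial μ₁ n) else 0 := by
  unfold leftVec
  split_ifs with h
  · have := raise_iterate_apply_zero_right (lowestVec μ₁ μ₂ n) (N - n - s) n
    rw [show n + (N - n - s) = N - s by omega] at this
    rw [this, lowestVec, if_pos (by omega), lowestVec, if_pos (by omega)]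
    simp [bracketFactorial_zero]
    ring
  · rw [lowestVec, if_neg (by omega), zero_mul]

lemma rightVec_zero (μ₁ μ₂ μ₃ : ℝ) {N k s : ℕ} (hk : k ≤ N) (hs : s ≤ N) :
    rightVec μ₁ μ₂ μ₃ N k (N - s) 0 s = if k ≤ s then
      (-1) ^ (k * (N + 1) + s * (s + 1) / 2) / (bracketFactorial μ₁ (N - s) *
        bracketFactorial (coupledMu μ₂ μ₃ k) (s - k) * bracketFactorial μ₃ k) else 0 := by
  unfold rightVec
  split_ifs with h
  · obtain ⟨m, rfl⟩ := Nat.exists_eq_add_of_le h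
    have := raise_iterate_apply_zero_left (lowestVec μ₂ μ₃ k) m k
    rw [show N - k - (N - (k + m)) = m by omega, this, lowestVec, if_pos (by omega), lowestVec,
      if_pos (by omega), Nat.add_sub_cancel_left]
    have e : (-1 : ℝ) ^ ((N - (k + m)) * k) * (-1) ^ (m * (m + 1) / 2) * (-1) ^ (k * (k + 1) / 2) =
        (-1) ^ (k * (N + 1) + (k + m) * (k + m + 1) / 2) := by
      rw [← pow_add, ← pow_add]
      obtain ⟨r, rfl⟩ := Nat.exists_eq_add_of_le hs
      rw [show k + m + r - (k + m) = r by omega]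
      obtain ⟨a, ha⟩ := Nat.even_mul_succ_self m
      obtain ⟨b, hb⟩ := Nat.even_mul_succ_self k
      have e1 : m * (m + 1) / 2 = a := by omega
      have e2 : k * (k + 1) / 2 = b := by omega
      have e3 : (k + m) * (k + m + 1) / 2 = a + b + k * m := by
        have : (k + m) * (k + m + 1) = (a + b + k * m) * 2 := by nlinarith
        omega
      rw [e1, e2, e3, show k * (k + m + r + 1) + (a + b + k * m) =
        (r * k + a + b) + (k * (k + 1) + 2 * (k * m)) by ring, pow_add _ (r * k + a + b)]
      rw [Even.neg_one_pow (n := k * (k + 1) + 2 * (k * m))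
        ((Nat.even_mul_succ_self k).add (even_two_mul _)), mul_one]
    rw [← e]
    simp only [bracketFactorial_zero, one_mul]
    ring
  · rw [lowestVec, if_neg (by omega), mul_zero, zero_mul]

/-- Recoupling coefficients are the solutions `Y` of a triangular system: by
`eq_zero_of_tripleLower_eq_zero` the vectors need to be compared at middle index `0` only, and
after removing common signs and factors `hY` is what this says at `(N - s, 0, s)`. -/
theorem coupledPoly_mul_eq_sum {μ₁ μ₂ μ₃ : ℝ} (h₁ : 0 < μ₁) (h₂ : 0 < μ₂) (h₃ : 0 < μ₃)
    {N n : ℕ} (hn : n ≤ N) (Y : ℕ → ℝ)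
    (hY : ∀ s ≤ N, (if n + s ≤ N then bracketFactorial μ₁ (N - s) /
        (bracketFactorial (coupledMu μ₁ μ₂ n) (N - n - s) * bracketFactorial μ₃ s) else 0) =
      ∑ k ∈ Finset.range (s + 1), Y k / bracketFactorial (coupledMu μ₂ μ₃ k) (s - k))
    (c x y z : ℝ) :
    coupledPoly μ₁ μ₂ n c x y *
        coupledPoly (coupledMu μ₁ μ₂ n) μ₃ (N - n) ((-1) ^ n * c) y z =
      ∑ k ∈ Finset.range (N + 1),
        ((-1) ^ (k * (N + 1)) * bracketFactorial μ₃ k / bracketFactorial μ₁ n * Y k) *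
        (coupledPoly μ₂ μ₃ k x y z *
          coupledPoly μ₁ (coupledMu μ₂ μ₃ k) (N - k) ((-1) ^ k * c) ((-1) ^ k * x) z) := by
  have hbf : ∀ {μ : ℝ} (_ : 0 < μ) (n : ℕ), bracketFactorial μ n ≠ 0 := fun hμ n =>
    (bracketFactorial_pos (by linarith) n).ne'
  set T : ℕ → ℝ := fun k =>
    (-1) ^ (k * (N + 1)) * bracketFactorial μ₃ k / bracketFactorial μ₁ n * Y k with hT
  have hvec : ∀ j i k, leftVec μ₁ μ₂ μ₃ N n i j k -
      ∑ a ∈ Finset.range (N + 1), T a * rightVec μ₁ μ₂ μ₃ N a i j k = 0 := by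
    refine eq_zero_of_tripleLower_eq_zero (μ₁ := μ₁) (μ₂ := μ₂) (μ₃ := μ₃) (by linarith)
      (v := fun i j k => leftVec μ₁ μ₂ μ₃ N n i j k -
        ∑ a ∈ Finset.range (N + 1), T a * rightVec μ₁ μ₂ μ₃ N a i j k) ?_ ?_
    · intro i j k
      have e : tripleLower μ₁ μ₂ μ₃ (fun i j k => leftVec μ₁ μ₂ μ₃ N n i j k -
          ∑ a ∈ Finset.range (N + 1), T a * rightVec μ₁ μ₂ μ₃ N a i j k) i j k =
          tripleLower μ₁ μ₂ μ₃ (leftVec μ₁ μ₂ μ₃ N n) i j k -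
          ∑ a ∈ Finset.range (N + 1), T a *
            tripleLower μ₁ μ₂ μ₃ (rightVec μ₁ μ₂ μ₃ N a) i j k := by
        simp only [tripleLower, mul_sub, mul_add, Finset.sum_add_distrib, Finset.mul_sum]
        simp only [mul_left_comm (T _)]
        ring
      rw [e, tripleLower_leftVec h₁ h₂ h₃]
      simp [tripleLower_rightVec h₁ h₂ h₃]
    · intro i s
      by_cases his : i + s = N
      · obtain rfl : i = N - s := by omega
        have hs : s ≤ N := by omega
        have hsum : ∑ a ∈ Finset.range (N + 1), T a * rightVec μ₁ μ₂ μ₃ N a (N - s) 0 s =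
            ∑ a ∈ Finset.range (s + 1), T a * rightVec μ₁ μ₂ μ₃ N a (N - s) 0 s := by
          symm
          apply Finset.sum_subset (Finset.range_mono (by omega))
          intro a ha ha'
          have ha := Finset.mem_range.1 ha
          have ha' : ¬ a < s + 1 := fun h => ha' (Finset.mem_range.2 h)
          rw [rightVec_zero _ _ _ (by omega) hs, if_neg (by omega), mul_zero]
        have hterm : ∀ a ∈ Finset.range (s + 1), T a * rightVec μ₁ μ₂ μ₃ N a (N - s) 0 s =
            (-1) ^ (s * (s + 1) / 2) / (bracketFactorial μ₁ (N - s) * bracketFactorial μ₁ n) *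
            (Y a / bracketFactorial (coupledMu μ₂ μ₃ a) (s - a)) := by
          intro a ha
          have ha := Finset.mem_range.1 ha
          have hs1 : ((-1 : ℝ) ^ (a * (N + 1))) * (-1) ^ (a * (N + 1)) = 1 := by
            rw [← mul_pow]; simp
          have b1 := hbf h₁ (N - s)
          have b2 := hbf h₁ n
          have b3 := hbf h₃ a
          have b4 := hbf (μ := coupledMu μ₂ μ₃ a) (by unfold coupledMu; positivity) (s - a)
          rw [rightVec_zero _ _ _ (by omega) hs, if_pos (by omega), hT, pow_add]
          field_simp
          linear_combination Y a * hs1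
        rw [hsum, Finset.sum_congr rfl hterm, ← Finset.mul_sum, ← hY s hs, leftVec_zero _ _ _ hn hs]
        have b1 := hbf h₁ (N - s)
        split_ifs
        · field_simp; ring
        · ring
      · have h0 : leftVec μ₁ μ₂ μ₃ N n i 0 s = 0 := by
          unfold leftVec
          by_cases h : n + s ≤ N
          · rw [(isHomogeneousOfDegree_lowestVec μ₁ μ₂ n).raise_iterate (N - n - s) i 0 (by omega),
              mul_zero]
          · rw [lowestVec, if_neg (by omega), zero_mul]
        rw [h0, Finset.sum_eq_zero, sub_zero]
        intro a ha
        have ha := Finset.mem_range.1 ha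
        unfold rightVec
        by_cases h : a + i ≤ N
        · rw [(isHomogeneousOfDegree_lowestVec μ₂ μ₃ a).raise_iterate (N - a - i) 0 s (by omega),
            mul_zero, mul_zero]
        · rw [lowestVec, if_neg (by omega)]; simp
  rw [← triplePoly_leftVec μ₁ μ₂ μ₃ hn]
  have hfun : leftVec μ₁ μ₂ μ₃ N n = fun i j k =>
      ∑ a ∈ Finset.range (N + 1), T a * rightVec μ₁ μ₂ μ₃ N a i j k := by
    funext i j k
    linarith [hvec j i k]
  rw [hfun, triplePoly_sum_smul]
  refine Finset.sum_congr rfl fun a ha => ?_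
  have ha := Finset.mem_range.1 ha
  rw [triplePoly_rightVec μ₁ μ₂ μ₃ (by omega)]

/-! ### A Dunkl-type operator on Newton bases -/

/-- The Newton basis polynomial `∏_{t < i} (z - y t)`. -/
def newtonBasis (y : ℕ → ℝ) (i : ℕ) (z : ℝ) : ℝ := ∏ t ∈ Finset.range i, (z - y t)

lemma newtonBasis_zero (y : ℕ → ℝ) (z : ℝ) : newtonBasis y 0 z = 1 := by simp [newtonBasis]

lemma newtonBasis_succ (y : ℕ → ℝ) (i : ℕ) (z : ℝ) :
    newtonBasis y (i + 1) z = newtonBasis y i z * (z - y i) := Finset.prod_range_succ _ _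

lemma newtonBasis_eq_zero (y : ℕ → ℝ) {i t : ℕ} (h : t < i) : newtonBasis y i (y t) = 0 :=
  Finset.prod_eq_zero (Finset.mem_range.2 h) (sub_self _)

/-- Newton basis polynomials of even degree are invariant under the reflection that exchanges the
nodes within each of the pairs `(y 0, y 1), (y 2, y 3), …`. -/
lemma newtonBasis_reflect_even {y : ℕ → ℝ} {δ₀ : ℝ} (h0 : ∀ j, y (2 * j) + y (2 * j + 1) = δ₀)
    (j : ℕ) (z : ℝ) : newtonBasis y (2 * j) (δ₀ - z) = newtonBasis y (2 * j) z := by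
  induction j with
  | zero => simp [newtonBasis_zero]
  | succ j ih =>
    rw [show 2 * (j + 1) = 2 * j + 1 + 1 by ring, newtonBasis_succ, newtonBasis_succ,
      newtonBasis_succ, newtonBasis_succ, ih, ← h0 j]
    ring

/-- The reflection that exchanges the nodes within the pairs `(y 1, y 2), (y 3, y 4), …` affects
only the factor of the node `y 0`. -/
lemma newtonBasis_reflect_odd {y : ℕ → ℝ} {δ₁ : ℝ}
    (h1 : ∀ j, y (2 * j + 1) + y (2 * j + 2) = δ₁) (j : ℕ) (z : ℝ) :
    (z - y 0) * newtonBasis y (2 * j + 1) (δ₁ - z) =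
      (δ₁ - z - y 0) * newtonBasis y (2 * j + 1) z := by
  induction j with
  | zero => simp [newtonBasis_zero, newtonBasis_succ]; ring
  | succ j ih =>
    rw [show 2 * (j + 1) + 1 = 2 * j + 1 + 1 + 1 by ring, newtonBasis_succ, newtonBasis_succ,
      newtonBasis_succ y (2 * j + 1 + 1), newtonBasis_succ y (2 * j + 1) z]
    have h := h1 j
    rw [show 2 * j + 2 = 2 * j + 1 + 1 by ring] at h
    rw [← h] at ih ⊢
    linear_combination (y (2 * j + 1) + y (2 * j + 1 + 1) - z - y (2 * j + 1)) *
      (y (2 * j + 1) + y (2 * j + 1 + 1) - z - y (2 * j + 1 + 1)) * ih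

/-- The eigenvalue of the Dunkl-type operator of `bannaiItoOp_newtonBasis` at the `i`-th Newton
basis polynomial. -/
def biEigen (y : ℕ → ℝ) (δ₁ a b e : ℝ) (i : ℕ) : ℝ :=
  if i = 0 then 0 else if Even i then δ₁ - y 0 - y (i - 1) else a + b - e - y (i - 1)

/-- The subdiagonal coefficient of the Dunkl-type operator of `bannaiItoOp_newtonBasis`. -/
def biLower (y : ℕ → ℝ) (δ₁ a b e : ℝ) (i : ℕ) : ℝ :=
  if i = 0 then 0
  else if Even i then (δ₁ - y 0 - y (i - 1)) * (y (i - 1) - e)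
  else -(y (i - 1) - a) * (y (i - 1) - b)

/-- The operator `A (f(δ₀ - z) - f(z)) + (z - y 0) C (f(δ₁ - z) - f(z))`, with the rational
coefficients `A = (z - a) (z - b) / (2 z - δ₀)` and `C = -(z - e) / (2 z - δ₁)`, acts bidiagonally
on the Newton basis when consecutive nodes have the alternating sums `δ₀` and `δ₁`. The
coefficients are given by `hA` and `hC` so that the zeros of the denominators need no separate
treatment. -/
theorem bannaiItoOp_newtonBasis {y : ℕ → ℝ} {δ₀ δ₁ : ℝ}
    (h0 : ∀ j, y (2 * j) + y (2 * j + 1) = δ₀) (h1 : ∀ j, y (2 * j + 1) + y (2 * j + 2) = δ₁)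
    {a b e z A C : ℝ} (hA : A * (2 * z - δ₀) = (z - a) * (z - b))
    (hC : C * (2 * z - δ₁) = -(z - e)) (i : ℕ) :
    A * (newtonBasis y i (δ₀ - z) - newtonBasis y i z) +
      (z - y 0) * C * (newtonBasis y i (δ₁ - z) - newtonBasis y i z) =
    biEigen y δ₁ a b e i * newtonBasis y i z +
      biLower y δ₁ a b e i * newtonBasis y (i - 1) z := by
  rcases Nat.even_or_odd' i with ⟨j, rfl | rfl⟩
  · rcases j with _ | j
    · simp [biEigen, biLower, newtonBasis_zero]
    · rw [newtonBasis_reflect_even h0]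
      have hr := newtonBasis_reflect_odd h1 j z
      have hev : Even (2 * j + 1 + 1) := ⟨j + 1, by ring⟩
      rw [show 2 * (j + 1) = 2 * j + 1 + 1 by ring, newtonBasis_succ y (2 * j + 1) (δ₁ - z),
        newtonBasis_succ y (2 * j + 1) z]
      simp only [biEigen, biLower, hev, if_true, Nat.add_eq_zero_iff, one_ne_zero, and_false,
        if_false, Nat.add_sub_cancel]
      linear_combination C * (δ₁ - z - y (2 * j + 1)) * hr -
        (δ₁ - y 0 - y (2 * j + 1)) * newtonBasis y (2 * j + 1) z * hC
  · have hr := newtonBasis_reflect_odd h1 j z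
    have hodd : ¬ Even (2 * j + 1) := by simp
    simp only [biEigen, biLower, hodd, Nat.add_eq_zero_iff, one_ne_zero, and_false,
        if_false, Nat.add_sub_cancel]
    rw [newtonBasis_succ y (2 * j) (δ₀ - z), newtonBasis_reflect_even h0]
    rw [newtonBasis_succ y (2 * j) z] at hr ⊢
    linear_combination C * hr - newtonBasis y (2 * j) z * hA -
      newtonBasis y (2 * j) z * (z - y (2 * j)) * hC

/-! ### The three-term recurrence of the Bannai-Ito polynomials -/

/-- The spectral points `(-1)^n (n + ν + 1/2) / 2`. For `ν = μ₂ + μ₃` they are the grid points of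
the Bannai-Ito polynomials shifted by `1/4`. -/
def node (ν : ℝ) (n : ℕ) : ℝ := (-1) ^ n * ((n : ℝ) + ν + 1 / 2) / 2

/-- The point to which the second reflection (for even `n`) or the first one (for odd `n`) sends
`node ν n`; it is the preceding node, and lies off the grid when `n = 0`. -/
def reflNode (ν : ℝ) (n : ℕ) : ℝ := if Even n then 1 / 2 - node ν n else -1 / 2 - node ν n

lemma node_of_even (ν : ℝ) {n : ℕ} (h : Even n) : node ν n = ((n : ℝ) + ν + 1 / 2) / 2 := by
  rw [node, h.neg_one_pow, one_mul]

lemma node_of_not_even (ν : ℝ) {n : ℕ} (h : ¬ Even n) :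
    node ν n = -((n : ℝ) + ν + 1 / 2) / 2 := by
  rw [node, (Nat.not_even_iff_odd.1 h).neg_one_pow]; ring

lemma node_succ_of_even (ν : ℝ) {n : ℕ} (h : Even n) : node ν (n + 1) = -1 / 2 - node ν n := by
  rw [node_of_even ν h, node_of_not_even ν (by simpa [Nat.even_add_one] using h)]
  push_cast; ring

lemma node_succ_of_not_even (ν : ℝ) {n : ℕ} (h : ¬ Even n) :
    node ν (n + 1) = 1 / 2 - node ν n := by
  rw [node_of_not_even ν h, node_of_even ν (by simpa [Nat.even_add_one] using h)]
  push_cast; ring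

lemma reflNode_succ (ν : ℝ) (n : ℕ) : reflNode ν (n + 1) = node ν n := by
  by_cases h : Even n
  · rw [reflNode, if_neg (by simpa [Nat.even_add_one] using h), node_succ_of_even ν h]; ring
  · rw [reflNode, if_pos (by simpa [Nat.even_add_one] using h), node_succ_of_not_even ν h]; ring

lemma node_even_add (ν : ℝ) (j : ℕ) : node ν (2 * j) + node ν (2 * j + 1) = -1 / 2 := by
  rw [node_succ_of_even ν (even_two_mul j)]; ring

lemma node_odd_add (ν : ℝ) (j : ℕ) : node ν (2 * j + 1) + node ν (2 * j + 2) = 1 / 2 := by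
  have h := node_succ_of_not_even ν (n := 2 * j + 1) (by simp)
  rw [show 2 * j + 2 = 2 * j + 1 + 1 by ring, h]; ring

/-- The zeros in the variable `X = x + 1/4` of the basis in which the Bannai-Ito polynomials are
expanded. -/
def xNode (μ₂ μ₃ : ℝ) (t : ℕ) : ℝ := (-1) ^ t * ((μ₃ - μ₂) / 2 - (t : ℝ) / 2 - 1 / 4)

/-- The Newton-type basis `∏_{t < i} (-1)^t (X - xNode t)` in the variable of the Bannai-Ito
polynomials. -/
def xNewton (μ₂ μ₃ : ℝ) (i : ℕ) (X : ℝ) : ℝ :=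
  ∏ t ∈ Finset.range i, (-1) ^ t * (X - xNode μ₂ μ₃ t)

lemma xNewton_succ (μ₂ μ₃ : ℝ) (i : ℕ) (X : ℝ) :
    xNewton μ₂ μ₃ (i + 1) X = xNewton μ₂ μ₃ i X * ((-1) ^ i * (X - xNode μ₂ μ₃ i)) :=
  Finset.prod_range_succ _ _

/-- The parameter `b` of the Dunkl-type operator for the Bannai-Ito polynomials with truncation
`N`. -/
def dualB (μ₁ μ₂ μ₃ : ℝ) (N : ℕ) : ℝ :=
  if Even N then -((N : ℝ) + μ₁ + μ₂ + 3 / 2) / 2 else ((N : ℝ) + μ₁ + μ₂ + 1 / 2) / 2 + μ₃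

/-- The parameter `e` of the Dunkl-type operator for the Bannai-Ito polynomials with truncation
`N`. -/
def dualE (μ₁ μ₂ μ₃ : ℝ) (N : ℕ) : ℝ :=
  if Even N then -(((N : ℝ) + μ₁ + μ₂ + 1 / 2) / 2 + μ₃) else ((N : ℝ) + μ₁ + μ₂ + 3 / 2) / 2

/-- The difference of the node `t` and the parameter `b` (even `t`) or `e` (odd `t`); these appear
in the denominators of `biSum`. -/
def dualGap (μ₁ μ₂ μ₃ : ℝ) (N t : ℕ) : ℝ :=
  node (μ₁ + μ₂) t - if Even t then dualB μ₁ μ₂ μ₃ N else dualE μ₁ μ₂ μ₃ N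

/-- The coefficients of `biSum`. -/
def biCoeff (μ₁ μ₂ μ₃ : ℝ) (N i : ℕ) : ℝ :=
  ∏ t ∈ Finset.range i, (bracket μ₂ (t + 1) * dualGap μ₁ μ₂ μ₃ N t)⁻¹

lemma biCoeff_succ (μ₁ μ₂ μ₃ : ℝ) (N i : ℕ) : biCoeff μ₁ μ₂ μ₃ N (i + 1) =
    biCoeff μ₁ μ₂ μ₃ N i * (bracket μ₂ (i + 1) * dualGap μ₁ μ₂ μ₃ N i)⁻¹ :=
  Finset.prod_range_succ _ _

/-- The Bannai-Ito polynomial divided by `η_n`, as a function of the dual variable `z` and of `X =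
x + 1/4`; at `z = node (μ₁ + μ₂) n` the sum stops at `i = n`. -/
def biSum (μ₁ μ₂ μ₃ : ℝ) (N : ℕ) (z X : ℝ) : ℝ :=
  ∑ i ∈ Finset.range (N + 1), biCoeff μ₁ μ₂ μ₃ N i * xNewton μ₂ μ₃ i X *
    newtonBasis (node (μ₁ + μ₂)) i z

lemma dualGap_ne_zero {μ₁ μ₂ μ₃ : ℝ} (h₁ : 0 < μ₁) (h₂ : 0 < μ₂) (h₃ : 0 < μ₃) {N t : ℕ}
    (ht : t < N) : dualGap μ₁ μ₂ μ₃ N t ≠ 0 := by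
  have ht' : (t : ℝ) < N := by exact_mod_cast ht
  have ht0 : (0 : ℝ) ≤ t := t.cast_nonneg
  unfold dualGap dualB dualE
  by_cases he : Even t <;> by_cases hN : Even N <;>
    simp only [he, hN, if_true, if_false, node_of_even, node_of_not_even, not_false_eq_true]
  · apply ne_of_gt; linarith
  · apply ne_of_lt; linarith
  · apply ne_of_gt; linarith
  · apply ne_of_lt; linarith

lemma biEigen_node {μ₁ μ₂ μ₃ : ℝ} (N i : ℕ) :
    biEigen (node (μ₁ + μ₂)) (1 / 2) ((μ₁ - μ₂) / 2 - 1 / 4) (dualB μ₁ μ₂ μ₃ N)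
      (dualE μ₁ μ₂ μ₃ N) i = xNode μ₂ μ₃ 0 - xNode μ₂ μ₃ i := by
  rcases i with _ | i
  · simp [biEigen]
  · have h0 : node (μ₁ + μ₂) 0 = (μ₁ + μ₂ + 1 / 2) / 2 := by simp [node]
    have hbe : dualB μ₁ μ₂ μ₃ N - dualE μ₁ μ₂ μ₃ N = μ₃ - 1 / 2 := by
      unfold dualB dualE; split_ifs <;> ring
    simp only [biEigen, Nat.add_eq_zero_iff, one_ne_zero, and_false, if_false, Nat.add_sub_cancel,
      xNode, h0]
    by_cases h : Even i
    · have h' : ¬ Even (i + 1) := by simpa [Nat.even_add_one] using h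
      rw [if_neg h', node_of_even _ h, pow_succ, h.neg_one_pow]
      push_cast
      linear_combination hbe
    · have h' : Even (i + 1) := by simpa [Nat.even_add_one] using h
      rw [if_pos h', node_of_not_even _ h, h'.neg_one_pow]
      push_cast
      ring

lemma biLower_node {μ₁ μ₂ μ₃ : ℝ} (N i : ℕ) :
    biLower (node (μ₁ + μ₂)) (1 / 2) ((μ₁ - μ₂) / 2 - 1 / 4) (dualB μ₁ μ₂ μ₃ N)
      (dualE μ₁ μ₂ μ₃ N) (i + 1) =
      -(-1) ^ i * bracket μ₂ (i + 1) * dualGap μ₁ μ₂ μ₃ N i := by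
  have h0 : node (μ₁ + μ₂) 0 = (μ₁ + μ₂ + 1 / 2) / 2 := by simp [node]
  simp only [biLower, Nat.add_eq_zero_iff, one_ne_zero, and_false, if_false, Nat.add_sub_cancel,
      h0, dualGap, bracket]
  by_cases h : Even i
  · have h' : ¬ Even (i + 1) := by simpa [Nat.even_add_one] using h
    rw [if_neg h', if_neg h', if_pos h, node_of_even _ h, h.neg_one_pow]
    push_cast
    ring
  · have h' : Even (i + 1) := by simpa [Nat.even_add_one] using h
    rw [if_pos h', if_pos h', if_neg h, node_of_not_even _ h,
      (Nat.not_even_iff_odd.1 h).neg_one_pow]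
    push_cast
    ring

/-- `biSum` is an eigenfunction in `z` of the Dunkl-type operator, provided the sum terminates at
`z`. -/
lemma biSum_op {μ₁ μ₂ μ₃ : ℝ} (h₁ : 0 < μ₁) (h₂ : 0 < μ₂) (h₃ : 0 < μ₃) (N : ℕ) {z A C : ℝ}
    (hz : newtonBasis (node (μ₁ + μ₂)) N z = 0)
    (hA : A * (2 * z + 1 / 2) = (z - ((μ₁ - μ₂) / 2 - 1 / 4)) * (z - dualB μ₁ μ₂ μ₃ N))
    (hC : C * (2 * z - 1 / 2) = -(z - dualE μ₁ μ₂ μ₃ N)) (X : ℝ) :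
    A * (biSum μ₁ μ₂ μ₃ N (-1 / 2 - z) X - biSum μ₁ μ₂ μ₃ N z X) +
      (z - node (μ₁ + μ₂) 0) * C *
        (biSum μ₁ μ₂ μ₃ N (1 / 2 - z) X - biSum μ₁ μ₂ μ₃ N z X) =
      -(X - xNode μ₂ μ₃ 0) * biSum μ₁ μ₂ μ₃ N z X := by
  have key : ∀ i ∈ Finset.range (N + 1),
      A * (biCoeff μ₁ μ₂ μ₃ N i * xNewton μ₂ μ₃ i X * newtonBasis (node (μ₁ + μ₂)) i (-1 / 2 - z) -
        biCoeff μ₁ μ₂ μ₃ N i * xNewton μ₂ μ₃ i X * newtonBasis (node (μ₁ + μ₂)) i z) +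
      (z - node (μ₁ + μ₂) 0) * C *
        (biCoeff μ₁ μ₂ μ₃ N i * xNewton μ₂ μ₃ i X * newtonBasis (node (μ₁ + μ₂)) i (1 / 2 - z) -
        biCoeff μ₁ μ₂ μ₃ N i * xNewton μ₂ μ₃ i X * newtonBasis (node (μ₁ + μ₂)) i z) +
      (X - xNode μ₂ μ₃ 0) * (biCoeff μ₁ μ₂ μ₃ N i * xNewton μ₂ μ₃ i X *
        newtonBasis (node (μ₁ + μ₂)) i z) =
      (X - xNode μ₂ μ₃ i) * (biCoeff μ₁ μ₂ μ₃ N i * xNewton μ₂ μ₃ i X *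
        newtonBasis (node (μ₁ + μ₂)) i z) +
      biLower (node (μ₁ + μ₂)) (1 / 2) ((μ₁ - μ₂) / 2 - 1 / 4) (dualB μ₁ μ₂ μ₃ N)
        (dualE μ₁ μ₂ μ₃ N) i * biCoeff μ₁ μ₂ μ₃ N i * xNewton μ₂ μ₃ i X *
        newtonBasis (node (μ₁ + μ₂)) (i - 1) z := by
    intro i _
    have h := bannaiItoOp_newtonBasis (node_even_add (μ₁ + μ₂)) (node_odd_add (μ₁ + μ₂))
      (A := A) (C := C) (z := z) (by rw [← hA]; ring) hC i
    rw [biEigen_node] at h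
    linear_combination (biCoeff μ₁ μ₂ μ₃ N i * xNewton μ₂ μ₃ i X) * h
  rw [neg_mul, ← sub_eq_zero, sub_neg_eq_add]
  unfold biSum
  simp only [← Finset.sum_sub_distrib, Finset.mul_sum, ← Finset.sum_add_distrib]
  rw [Finset.sum_congr rfl key, Finset.sum_add_distrib, Finset.sum_range_succ, hz,
    Finset.sum_range_succ' (fun i => biLower (node (μ₁ + μ₂)) (1 / 2) ((μ₁ - μ₂) / 2 - 1 / 4)
      (dualB μ₁ μ₂ μ₃ N) (dualE μ₁ μ₂ μ₃ N) i * biCoeff μ₁ μ₂ μ₃ N i * xNewton μ₂ μ₃ i X *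
        newtonBasis (node (μ₁ + μ₂)) (i - 1) z)]
  have h00 : biLower (node (μ₁ + μ₂)) (1 / 2) ((μ₁ - μ₂) / 2 - 1 / 4)
      (dualB μ₁ μ₂ μ₃ N) (dualE μ₁ μ₂ μ₃ N) 0 = 0 := by simp [biLower]
  rw [h00]
  simp only [mul_zero, zero_mul, add_zero]
  rw [← Finset.sum_add_distrib]
  refine Finset.sum_eq_zero fun i hi => ?_
  have hg := dualGap_ne_zero h₁ h₂ h₃ (Finset.mem_range.1 hi)
  have hb := (bracket_succ_pos (μ := μ₂) (by linarith) i).ne'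
  have hs : ((-1 : ℝ) ^ i) * (-1) ^ i = 1 := by rw [← mul_pow]; simp
  rw [biLower_node, biCoeff_succ, xNewton_succ, Nat.add_sub_cancel]
  field_simp
  linear_combination -(X - xNode μ₂ μ₃ i) * biCoeff μ₁ μ₂ μ₃ N i * xNewton μ₂ μ₃ i X *
    newtonBasis (node (μ₁ + μ₂)) i z * hs

/-- The coefficient of `n ↦ n + 1` in the three-term recurrence of `biSum`. -/
def stepUp (μ₁ μ₂ μ₃ : ℝ) (N n : ℕ) : ℝ :=
  if Even n then -bracket μ₂ (n + 1) * (node (μ₁ + μ₂) n - dualB μ₁ μ₂ μ₃ N) / (n + μ₁ + μ₂ + 1)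
  else (((n : ℝ) + 1) / 2 + μ₁ + μ₂) * (node (μ₁ + μ₂) n - dualE μ₁ μ₂ μ₃ N) / (n + μ₁ + μ₂ + 1)

/-- The coefficient of `n ↦ n - 1` in the three-term recurrence of `biSum`. -/
def stepDown (μ₁ μ₂ μ₃ : ℝ) (N n : ℕ) : ℝ :=
  if Even n then bracket μ₁ n * (node (μ₁ + μ₂) n - dualE μ₁ μ₂ μ₃ N) / (n + μ₁ + μ₂)
  else -bracket μ₁ n * (node (μ₁ + μ₂) n - dualB μ₁ μ₂ μ₃ N) / (n + μ₁ + μ₂)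

/-- The three-term recurrence in `n` of the Bannai-Ito polynomials, for `n < N`. -/
theorem biSum_recurrence {μ₁ μ₂ μ₃ : ℝ} (h₁ : 0 < μ₁) (h₂ : 0 < μ₂) (h₃ : 0 < μ₃) {N n : ℕ}
    (hn : n < N) (X : ℝ) :
    stepUp μ₁ μ₂ μ₃ N n * (biSum μ₁ μ₂ μ₃ N (node (μ₁ + μ₂) (n + 1)) X -
        biSum μ₁ μ₂ μ₃ N (node (μ₁ + μ₂) n) X) +
      stepDown μ₁ μ₂ μ₃ N n * (biSum μ₁ μ₂ μ₃ N (reflNode (μ₁ + μ₂) n) X -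
        biSum μ₁ μ₂ μ₃ N (node (μ₁ + μ₂) n) X) =
      (X - xNode μ₂ μ₃ 0) * biSum μ₁ μ₂ μ₃ N (node (μ₁ + μ₂) n) X := by
  have hn0 : (0 : ℝ) ≤ n := n.cast_nonneg
  have hd : (n : ℝ) + μ₁ + μ₂ + 1 ≠ 0 := by positivity
  have hd' : (n : ℝ) + μ₁ + μ₂ ≠ 0 := by positivity
  have h0 : node (μ₁ + μ₂) 0 = (μ₁ + μ₂ + 1 / 2) / 2 := by simp [node]
  have hz := newtonBasis_eq_zero (node (μ₁ + μ₂)) hn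
  by_cases h : Even n
  · have h' : ¬ Even (n + 1) := by simpa [Nat.even_add_one] using h
    have := biSum_op h₁ h₂ h₃ N hz (A := -stepUp μ₁ μ₂ μ₃ N n)
      (C := -(node (μ₁ + μ₂) n - dualE μ₁ μ₂ μ₃ N) / (n + μ₁ + μ₂)) ?_ ?_ X
    · rw [node_succ_of_even _ h, reflNode, if_pos h]
      rw [h0] at this
      have e : stepDown μ₁ μ₂ μ₃ N n = (node (μ₁ + μ₂) n - (μ₁ + μ₂ + 1 / 2) / 2) *
          ((node (μ₁ + μ₂) n - dualE μ₁ μ₂ μ₃ N) / (n + μ₁ + μ₂)) := by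
        rw [stepDown, if_pos h, bracket, if_pos h, mul_div_assoc]
        congr 1
        rw [node_of_even _ h]; ring
      rw [e]
      linear_combination -this
    · rw [stepUp, if_pos h, bracket, if_neg h', node_of_even _ h]
      push_cast
      field_simp
      ring
    · rw [node_of_even _ h]
      field_simp
      ring
  · have h' : Even (n + 1) := by simpa [Nat.even_add_one] using h
    have := biSum_op h₁ h₂ h₃ N hz (A := -stepDown μ₁ μ₂ μ₃ N n)
      (C := (node (μ₁ + μ₂) n - dualE μ₁ μ₂ μ₃ N) / (n + μ₁ + μ₂ + 1)) ?_ ?_ X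
    · rw [node_succ_of_not_even _ h, reflNode, if_neg h]
      rw [h0] at this
      have e : stepUp μ₁ μ₂ μ₃ N n = -(node (μ₁ + μ₂) n - (μ₁ + μ₂ + 1 / 2) / 2) *
          ((node (μ₁ + μ₂) n - dualE μ₁ μ₂ μ₃ N) / (n + μ₁ + μ₂ + 1)) := by
        rw [stepUp, if_neg h, mul_div_assoc]
        congr 1
        rw [node_of_not_even _ h]; ring
      rw [e]
      linear_combination -this
    · rw [stepDown, if_neg h, bracket, if_neg h, node_of_not_even _ h]
      field_simp
      ring
    · rw [node_of_not_even _ h]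
      field_simp
      ring

/-! ### The recurrence of the reversed Newton basis -/

lemma not_even_add_one {n : ℕ} (h : Even n) : ¬ Even (n + 1) := by
  simpa [Nat.even_add_one] using h

lemma even_add_one_of_not {n : ℕ} (h : ¬ Even n) : Even (n + 1) := by
  simpa [Nat.even_add_one] using h

/-- The nodes in reverse order, `revNode ν N t = node ν (N - t)`, extended to all `t`. -/
def revNode (ν : ℝ) (N t : ℕ) : ℝ := (-1) ^ (N + t) * ((N : ℝ) - t + ν + 1 / 2) / 2

lemma revNode_eq_node (ν : ℝ) {N t : ℕ} (h : t ≤ N) : revNode ν N t = node ν (N - t) := by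
  obtain ⟨r, rfl⟩ := Nat.exists_eq_add_of_le h
  have hs : ((-1 : ℝ) ^ t) * (-1) ^ t = 1 := by rw [← mul_pow]; simp
  rw [revNode, node, Nat.add_sub_cancel_left, pow_add, pow_add]
  push_cast
  linear_combination (-1) ^ r * ((r : ℝ) + ν + 1 / 2) / 2 * hs

lemma revNode_even_add (ν : ℝ) (N j : ℕ) :
    revNode ν N (2 * j) + revNode ν N (2 * j + 1) = (-1) ^ N / 2 := by
  simp only [revNode, pow_add, pow_mul]
  push_cast
  norm_num
  ring

lemma revNode_odd_add (ν : ℝ) (N j : ℕ) :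
    revNode ν N (2 * j + 1) + revNode ν N (2 * j + 2) = -(-1) ^ N / 2 := by
  simp only [revNode, pow_add, pow_mul]
  push_cast
  norm_num
  ring

/-- The ratio of consecutive gauge factors that turn the recurrence of the reversed Newton basis
into the one of the Bannai-Ito polynomials. -/
def gaugeRatio (μ₁ μ₂ μ₃ : ℝ) (N n : ℕ) : ℝ :=
  if Even (N + n) then ((N : ℝ) - n) / 2 / (((N : ℝ) + n) / 2 + μ₁ + μ₂ + 1)
  else (((N : ℝ) + n) / 2 + μ₁ + μ₂ + μ₃ + 1) / (((N : ℝ) - n) / 2 + μ₃)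

/-- The factor that `stepUp` has in common for both parities of `N`. -/
def stepWeight (μ₁ μ₂ : ℝ) (n : ℕ) : ℝ :=
  if Even n then ((n : ℝ) + 1) / 2 + μ₂ else ((n : ℝ) + 1) / 2 + μ₁ + μ₂

lemma stepUp_eq (μ₁ μ₂ μ₃ : ℝ) (N n : ℕ) :
    stepUp μ₁ μ₂ μ₃ N n = stepWeight μ₁ μ₂ n / (n + μ₁ + μ₂ + 1) *
      if Even (N + n) then -(((N : ℝ) + n) / 2 + μ₁ + μ₂ + 1) else ((N : ℝ) - n) / 2 + μ₃ := by
  unfold stepUp stepWeight dualB dualE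
  by_cases hn : Even n <;> by_cases hN : Even N
  · have h' := not_even_add_one hn
    simp only [hn, hN, Nat.even_add, h', if_true, if_false, bracket, node_of_even]
    push_cast; ring
  · have h' := not_even_add_one hn
    simp only [hn, hN, Nat.even_add, h', if_true, if_false, iff_true, bracket, node_of_even]
    push_cast; ring
  · simp only [hn, hN, Nat.even_add, if_true, if_false, iff_false, not_true,
      node_of_not_even, not_false_eq_true]
    ring
  · simp only [hn, hN, Nat.even_add, if_true, if_false, not_false_eq_true,
      node_of_not_even]
    ring

lemma stepDown_eq (μ₁ μ₂ μ₃ : ℝ) (N n : ℕ) :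
    stepDown μ₁ μ₂ μ₃ N n = bracket μ₁ n / (n + μ₁ + μ₂) *
      if Even (N + n) then ((N : ℝ) + n + 1) / 2 + μ₁ + μ₂ + μ₃ else -((N : ℝ) - n + 1) / 2 := by
  unfold stepDown dualB dualE
  by_cases hn : Even n <;> by_cases hN : Even N
  · simp only [hn, hN, Nat.even_add, if_true, node_of_even]
    ring
  · simp only [hn, hN, Nat.even_add, if_true, if_false, iff_true, node_of_even]
    ring
  · simp only [hn, hN, Nat.even_add, if_true, if_false, iff_false, not_true,
      node_of_not_even, not_false_eq_true]
    ring
  · simp only [hn, hN, Nat.even_add, if_true, if_false, not_false_eq_true,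
      node_of_not_even]
    ring

lemma stepUp_mul_gaugeRatio {μ₁ μ₂ μ₃ : ℝ} (h₁ : 0 < μ₁) (h₂ : 0 < μ₂) (h₃ : 0 < μ₃) {N n : ℕ}
    (hn : n ≤ N) :
    stepUp μ₁ μ₂ μ₃ N n * gaugeRatio μ₁ μ₂ μ₃ N n = stepWeight μ₁ μ₂ n / (n + μ₁ + μ₂ + 1) *
      if Even (N + n) then -((N : ℝ) - n) / 2 else ((N : ℝ) + n) / 2 + μ₁ + μ₂ + μ₃ + 1 := by
  have hn' : (n : ℝ) ≤ N := by exact_mod_cast hn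
  have hn0 : (0 : ℝ) ≤ n := n.cast_nonneg
  have d1 : (n : ℝ) + μ₁ + μ₂ + 1 ≠ 0 := by positivity
  have d2 : ((N : ℝ) + n) / 2 + μ₁ + μ₂ + 1 ≠ 0 := by positivity
  have d3 : ((N : ℝ) - n) / 2 + μ₃ ≠ 0 := by apply ne_of_gt; linarith
  rw [stepUp_eq, gaugeRatio]
  split_ifs
  · generalize ((N : ℝ) + n) / 2 + μ₁ + μ₂ + 1 = D at *
    field_simp
  · generalize ((N : ℝ) - n) / 2 + μ₃ = D at *
    field_simp

lemma gaugeRatio_ne_zero {μ₁ μ₂ μ₃ : ℝ} (h₁ : 0 < μ₁) (h₂ : 0 < μ₂) (h₃ : 0 < μ₃) {N n : ℕ}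
    (hn : n < N) : gaugeRatio μ₁ μ₂ μ₃ N n ≠ 0 := by
  have hn' : (0 : ℝ) < N - n := by
    have : (n : ℝ) < N := by exact_mod_cast hn
    linarith
  unfold gaugeRatio
  split_ifs <;> positivity

lemma stepUp_ne_zero {μ₁ μ₂ μ₃ : ℝ} (h₁ : 0 < μ₁) (h₂ : 0 < μ₂) (h₃ : 0 < μ₃) {N n : ℕ}
    (hn : n < N) : stepUp μ₁ μ₂ μ₃ N n ≠ 0 := by
  have hn' : (0 : ℝ) < N - n := by
    have : (n : ℝ) < N := by exact_mod_cast hn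
    linarith
  have : stepWeight μ₁ μ₂ n ≠ 0 := by unfold stepWeight; split_ifs <;> positivity
  rw [stepUp_eq]
  refine mul_ne_zero (by positivity) ?_
  split_ifs
  · apply neg_ne_zero.2; positivity
  · positivity

lemma stepDown_div_gaugeRatio {μ₁ μ₂ μ₃ : ℝ} (h₁ : 0 < μ₁) (h₂ : 0 < μ₂) (h₃ : 0 < μ₃) {N n : ℕ}
    (hn : n ≤ N) :
    stepDown μ₁ μ₂ μ₃ N n / gaugeRatio μ₁ μ₂ μ₃ N (n - 1) = bracket μ₁ n / (n + μ₁ + μ₂) *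
      if Even (N + n) then ((N : ℝ) - n + 1) / 2 + μ₃ else -(((N : ℝ) + n + 1) / 2 + μ₁ + μ₂) := by
  rw [stepDown_eq]
  rcases n with _ | n
  · simp [bracket_zero]
  have hn' : ((n + 1 : ℕ) : ℝ) ≤ N := by exact_mod_cast hn
  push_cast at hn'
  have hn0 : (0 : ℝ) ≤ n := n.cast_nonneg
  rw [Nat.add_sub_cancel, gaugeRatio]
  have d1 : (n : ℝ) + 1 + μ₁ + μ₂ ≠ 0 := by positivity
  have d2 : ((N : ℝ) + n) / 2 + μ₁ + μ₂ + 1 ≠ 0 := by positivity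
  have d3 : ((N : ℝ) - n) / 2 + μ₃ ≠ 0 := by apply ne_of_gt; linarith
  have d4 : ((N : ℝ) + n) / 2 + μ₁ + μ₂ + μ₃ + 1 ≠ 0 := by positivity
  have d5 : ((N : ℝ) - n) / 2 ≠ 0 := by apply ne_of_gt; linarith
  rw [← add_assoc N n 1]
  by_cases h : Even (N + n)
  · rw [if_neg (not_even_add_one h), if_pos h, if_neg (not_even_add_one h)]
    push_cast
    rw [show ((N : ℝ) + (n + 1) + 1) / 2 + μ₁ + μ₂ = ((N : ℝ) + n) / 2 + μ₁ + μ₂ + 1 by ring,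
      show -((N : ℝ) - (n + 1) + 1) / 2 = -(((N : ℝ) - n) / 2) by ring]
    generalize ((N : ℝ) + n) / 2 + μ₁ + μ₂ + 1 = D at *
    generalize ((N : ℝ) - n) / 2 = E at *
    field_simp
  · rw [if_pos (even_add_one_of_not h), if_neg h, if_pos (even_add_one_of_not h)]
    push_cast
    rw [show ((N : ℝ) + (n + 1) + 1) / 2 + μ₁ + μ₂ + μ₃ =
        ((N : ℝ) + n) / 2 + μ₁ + μ₂ + μ₃ + 1 by ring,
      show ((N : ℝ) - (n + 1) + 1) / 2 + μ₃ = ((N : ℝ) - n) / 2 + μ₃ by ring]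
    generalize ((N : ℝ) + n) / 2 + μ₁ + μ₂ + μ₃ + 1 = D at *
    generalize ((N : ℝ) - n) / 2 + μ₃ = E at *
    field_simp

/-- Gauging changes the sum of the two rates, the diagonal coefficient of the three-term
recurrence, by a constant only. -/
lemma gauged_step_sum {μ₁ μ₂ μ₃ : ℝ} (h₁ : 0 < μ₁) (h₂ : 0 < μ₂) (h₃ : 0 < μ₃) {N n : ℕ}
    (hn : n ≤ N) :
    stepUp μ₁ μ₂ μ₃ N n * gaugeRatio μ₁ μ₂ μ₃ N n +
      stepDown μ₁ μ₂ μ₃ N n / gaugeRatio μ₁ μ₂ μ₃ N (n - 1) =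
      stepUp μ₁ μ₂ μ₃ N n + stepDown μ₁ μ₂ μ₃ N n + (μ₂ + 1 / 2) := by
  have hn0 : (0 : ℝ) ≤ n := n.cast_nonneg
  have d1 : (n : ℝ) + μ₁ + μ₂ + 1 ≠ 0 := by positivity
  have d2 : (n : ℝ) + μ₁ + μ₂ ≠ 0 := by positivity
  have hw : stepWeight μ₁ μ₂ n - bracket μ₁ n = μ₂ + 1 / 2 := by
    unfold stepWeight bracket; split_ifs <;> ring
  rw [stepUp_mul_gaugeRatio h₁ h₂ h₃ hn, stepDown_div_gaugeRatio h₁ h₂ h₃ hn, stepUp_eq,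
    stepDown_eq, ← hw]
  split_ifs <;> field_simp <;> ring

/-- The operator of `bannaiItoOp_newtonBasis` on the Newton basis with reversed nodes, evaluated at
the nodes. Its coefficients are those of `biSum_recurrence` after a gauge transformation. The roles
of the parameters `a`, `b`, `e` depend on the parity of `N`. -/
theorem revBasis_recurrence {μ₁ μ₂ μ₃ : ℝ} (h₁ : 0 < μ₁) (h₂ : 0 < μ₂) (h₃ : 0 < μ₃) {N n : ℕ}
    (hn : n ≤ N) {s : ℕ} (hs : s ≤ N) :
    stepUp μ₁ μ₂ μ₃ N n * gaugeRatio μ₁ μ₂ μ₃ N n *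
        (newtonBasis (revNode (μ₁ + μ₂) N) s (node (μ₁ + μ₂) (n + 1)) -
          newtonBasis (revNode (μ₁ + μ₂) N) s (node (μ₁ + μ₂) n)) +
      stepDown μ₁ μ₂ μ₃ N n / gaugeRatio μ₁ μ₂ μ₃ N (n - 1) *
        (newtonBasis (revNode (μ₁ + μ₂) N) s (reflNode (μ₁ + μ₂) n) -
          newtonBasis (revNode (μ₁ + μ₂) N) s (node (μ₁ + μ₂) n)) =
      (node (μ₂ + μ₃) s - node (μ₂ + μ₃) 0) *
        newtonBasis (revNode (μ₁ + μ₂) N) s (node (μ₁ + μ₂) n) -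
      (-1) ^ N * bracket μ₁ (N + 1 - s) * bracket μ₃ s *
        newtonBasis (revNode (μ₁ + μ₂) N) (s - 1) (node (μ₁ + μ₂) n) := by
  have hn0 : (0 : ℝ) ≤ n := n.cast_nonneg
  have d1 : (n : ℝ) + μ₁ + μ₂ + 1 ≠ 0 := by positivity
  have d2 : (n : ℝ) + μ₁ + μ₂ ≠ 0 := by positivity
  rw [stepUp_mul_gaugeRatio h₁ h₂ h₃ hn, stepDown_div_gaugeRatio h₁ h₂ h₃ hn]
  set z := node (μ₁ + μ₂) n with hz
  set y := revNode (μ₁ + μ₂) N with hy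
  by_cases hN : Even N
  · have hN1 : (-1 : ℝ) ^ N = 1 := hN.neg_one_pow
    have h0 : ∀ j, y (2 * j) + y (2 * j + 1) = 1 / 2 := fun j => by
      rw [hy, revNode_even_add, hN1]
    have h1 : ∀ j, y (2 * j + 1) + y (2 * j + 2) = -1 / 2 := fun j => by
      rw [hy, revNode_odd_add, hN1]
    have hy0 : y 0 = ((N : ℝ) + (μ₁ + μ₂) + 1 / 2) / 2 := by
      rw [hy, revNode, add_zero, hN1]; push_cast; ring
    have hE : biEigen y (-1 / 2) ((μ₁ + μ₂ + 1 / 2) / 2)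
        (1 / 2 + (((N : ℝ) + μ₁ + μ₂ + 1 / 2) / 2 + μ₃)) ((μ₁ - μ₂) / 2 - 1 / 4) s =
        -(node (μ₂ + μ₃) s - node (μ₂ + μ₃) 0) := by
      rcases s with _ | s
      · simp [biEigen]
      · rw [node_of_even _ (by simp : Even 0)]
        simp only [biEigen, Nat.add_eq_zero_iff, one_ne_zero, and_false, if_false,
          Nat.add_sub_cancel, hy0]
        by_cases h : Even s
        · rw [if_neg (not_even_add_one h), node_of_not_even _ (not_even_add_one h), hy, revNode,
            pow_add, hN1, h.neg_one_pow]
          push_cast; ring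
        · rw [if_pos (even_add_one_of_not h), node_of_even _ (even_add_one_of_not h), hy, revNode,
            pow_add, hN1, (Nat.not_even_iff_odd.1 h).neg_one_pow]
          push_cast; ring
    have hL : biLower y (-1 / 2) ((μ₁ + μ₂ + 1 / 2) / 2)
        (1 / 2 + (((N : ℝ) + μ₁ + μ₂ + 1 / 2) / 2 + μ₃)) ((μ₁ - μ₂) / 2 - 1 / 4) s =
        (-1) ^ N * bracket μ₁ (N + 1 - s) * bracket μ₃ s := by
      rcases s with _ | s
      · simp [biLower, bracket_zero]
      · have hsub : N + 1 - (s + 1) = N - s := by omega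
        have hpar := Nat.even_sub (show s ≤ N by omega)
        simp only [biLower, Nat.add_eq_zero_iff, one_ne_zero, and_false, if_false,
          Nat.add_sub_cancel, hy0, hsub, bracket, hpar, hN, hN1]
        rw [Nat.cast_sub (by omega)]
        by_cases h : Even s
        · simp only [h, not_even_add_one h, if_true, if_false]
          rw [hy, revNode, pow_add, hN1, h.neg_one_pow]
          push_cast; ring
        · simp only [h, even_add_one_of_not h, if_true, if_false, iff_false, not_true]
          rw [hy, revNode, pow_add, hN1, (Nat.not_even_iff_odd.1 h).neg_one_pow]
          push_cast; ring
    have op := fun A C hA hC => bannaiItoOp_newtonBasis h0 h1 (z := z) (a := (μ₁ + μ₂ + 1 / 2) / 2)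
      (b := 1 / 2 + (((N : ℝ) + μ₁ + μ₂ + 1 / 2) / 2 + μ₃)) (e := (μ₁ - μ₂) / 2 - 1 / 4)
      (A := A) (C := C) hA hC s
    rw [hE, hL] at op
    by_cases h : Even n
    · have hNn : Even (N + n) := hN.add h
      have hzv : z = ((n : ℝ) + (μ₁ + μ₂) + 1 / 2) / 2 := node_of_even _ h
      have := op ((z - (μ₁ + μ₂ + 1 / 2) / 2) *
          (z - (1 / 2 + (((N : ℝ) + μ₁ + μ₂ + 1 / 2) / 2 + μ₃))) / (n + μ₁ + μ₂))
        (-(z - ((μ₁ - μ₂) / 2 - 1 / 4)) / (n + μ₁ + μ₂ + 1))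
        (by rw [div_mul_eq_mul_div, div_eq_iff d2, hzv]; ring)
        (by rw [div_mul_eq_mul_div, div_eq_iff d1, hzv]; ring)
      rw [node_succ_of_even _ h, reflNode, if_pos h, if_pos hNn, if_pos hNn, stepWeight, if_pos h,
        bracket, if_pos h, ← hz]
      have e1 : ((n : ℝ) + 1) / 2 + μ₂ = z - ((μ₁ - μ₂) / 2 - 1 / 4) := by rw [hzv]; ring
      have e2 : -((N : ℝ) - n) / 2 = z - y 0 := by rw [hzv, hy0]; ring
      have e3 : (n : ℝ) / 2 = z - (μ₁ + μ₂ + 1 / 2) / 2 := by rw [hzv]; ring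
      have e4 : ((N : ℝ) - n + 1) / 2 + μ₃ =
        -(z - (1 / 2 + (((N : ℝ) + μ₁ + μ₂ + 1 / 2) / 2 + μ₃))) := by rw [hzv]; ring
      rw [e1, e2, e3, e4]
      linear_combination -this
    · have hNn : ¬ Even (N + n) := by simp [Nat.even_add, hN, h]
      have hzv : z = -((n : ℝ) + (μ₁ + μ₂) + 1 / 2) / 2 := node_of_not_even _ h
      have := op (-(z - (μ₁ + μ₂ + 1 / 2) / 2) *
          (z - (1 / 2 + (((N : ℝ) + μ₁ + μ₂ + 1 / 2) / 2 + μ₃))) / (n + μ₁ + μ₂ + 1))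
        ((z - ((μ₁ - μ₂) / 2 - 1 / 4)) / (n + μ₁ + μ₂))
        (by rw [div_mul_eq_mul_div, div_eq_iff d1, hzv]; ring)
        (by rw [div_mul_eq_mul_div, div_eq_iff d2, hzv]; ring)
      rw [node_succ_of_not_even _ h, reflNode, if_neg h, if_neg hNn, if_neg hNn, stepWeight,
        if_neg h, bracket, if_neg h, ← hz]
      have e1 : ((n : ℝ) + 1) / 2 + μ₁ + μ₂ = -(z - (μ₁ + μ₂ + 1 / 2) / 2) := by rw [hzv]; ring
      have e2 : ((N : ℝ) + n) / 2 + μ₁ + μ₂ + μ₃ + 1 =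
        -(z - (1 / 2 + (((N : ℝ) + μ₁ + μ₂ + 1 / 2) / 2 + μ₃))) := by rw [hzv]; ring
      have e3 : (n : ℝ) / 2 + μ₁ = -(z - ((μ₁ - μ₂) / 2 - 1 / 4)) := by rw [hzv]; ring
      have e4 : -(((N : ℝ) + n + 1) / 2 + μ₁ + μ₂) = z - y 0 := by rw [hzv, hy0]; ring
      rw [e1, e2, e3, e4]
      linear_combination -this
  · have hN1 : (-1 : ℝ) ^ N = -1 := (Nat.not_even_iff_odd.1 hN).neg_one_pow
    have h0 : ∀ j, y (2 * j) + y (2 * j + 1) = -1 / 2 := fun j => by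
      rw [hy, revNode_even_add, hN1]
    have h1 : ∀ j, y (2 * j + 1) + y (2 * j + 2) = 1 / 2 := fun j => by
      rw [hy, revNode_odd_add, hN1, neg_neg]
    have hy0 : y 0 = -((N : ℝ) + (μ₁ + μ₂) + 1 / 2) / 2 := by
      rw [hy, revNode, add_zero, hN1]; push_cast; ring
    have hE : biEigen y (1 / 2) ((μ₁ - μ₂) / 2 - 1 / 4)
        (-1 / 2 - (((N : ℝ) + μ₁ + μ₂ + 1 / 2) / 2 + μ₃)) ((μ₁ + μ₂ + 1 / 2) / 2) s =
        node (μ₂ + μ₃) s - node (μ₂ + μ₃) 0 := by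
      rcases s with _ | s
      · simp [biEigen]
      · rw [node_of_even _ (by simp : Even 0)]
        simp only [biEigen, Nat.add_eq_zero_iff, one_ne_zero, and_false, if_false,
          Nat.add_sub_cancel, hy0]
        by_cases h : Even s
        · rw [if_neg (not_even_add_one h), node_of_not_even _ (not_even_add_one h), hy, revNode,
            pow_add, hN1, h.neg_one_pow]
          push_cast; ring
        · rw [if_pos (even_add_one_of_not h), node_of_even _ (even_add_one_of_not h), hy, revNode,
            pow_add, hN1, (Nat.not_even_iff_odd.1 h).neg_one_pow]
          push_cast; ring
    have hL : biLower y (1 / 2) ((μ₁ - μ₂) / 2 - 1 / 4)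
        (-1 / 2 - (((N : ℝ) + μ₁ + μ₂ + 1 / 2) / 2 + μ₃)) ((μ₁ + μ₂ + 1 / 2) / 2) s =
        -(-1) ^ N * bracket μ₁ (N + 1 - s) * bracket μ₃ s := by
      rcases s with _ | s
      · simp [biLower, bracket_zero]
      · have hsub : N + 1 - (s + 1) = N - s := by omega
        have hpar := Nat.even_sub (show s ≤ N by omega)
        simp only [biLower, Nat.add_eq_zero_iff, one_ne_zero, and_false, if_false,
          Nat.add_sub_cancel, hy0, hsub, bracket, hpar, hN, hN1]
        rw [Nat.cast_sub (by omega)]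
        by_cases h : Even s
        · simp only [h, not_even_add_one h, if_false, iff_true]
          rw [hy, revNode, pow_add, hN1, h.neg_one_pow]
          push_cast; ring
        · simp only [h, even_add_one_of_not h, if_true]
          rw [hy, revNode, pow_add, hN1, (Nat.not_even_iff_odd.1 h).neg_one_pow]
          push_cast; ring
    have op := fun A C hA hC => bannaiItoOp_newtonBasis h0 h1 (z := z) (a := (μ₁ - μ₂) / 2 - 1 / 4)
      (b := -1 / 2 - (((N : ℝ) + μ₁ + μ₂ + 1 / 2) / 2 + μ₃)) (e := (μ₁ + μ₂ + 1 / 2) / 2)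
      (A := A) (C := C) hA hC s
    rw [hE, hL] at op
    by_cases h : Even n
    · have hNn : ¬ Even (N + n) := by simp [Nat.even_add, hN, h]
      have hzv : z = ((n : ℝ) + (μ₁ + μ₂) + 1 / 2) / 2 := node_of_even _ h
      have := op ((z - ((μ₁ - μ₂) / 2 - 1 / 4)) *
          (z - (-1 / 2 - (((N : ℝ) + μ₁ + μ₂ + 1 / 2) / 2 + μ₃))) / (n + μ₁ + μ₂ + 1))
        (-(z - (μ₁ + μ₂ + 1 / 2) / 2) / (n + μ₁ + μ₂))
        (by rw [div_mul_eq_mul_div, div_eq_iff d1, hzv]; ring)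
        (by rw [div_mul_eq_mul_div, div_eq_iff d2, hzv]; ring)
      rw [node_succ_of_even _ h, reflNode, if_pos h, if_neg hNn, if_neg hNn, stepWeight, if_pos h,
        bracket, if_pos h, ← hz]
      have e1 : ((n : ℝ) + 1) / 2 + μ₂ = z - ((μ₁ - μ₂) / 2 - 1 / 4) := by rw [hzv]; ring
      have e2 : ((N : ℝ) + n) / 2 + μ₁ + μ₂ + μ₃ + 1 =
        z - (-1 / 2 - (((N : ℝ) + μ₁ + μ₂ + 1 / 2) / 2 + μ₃)) := by rw [hzv]; ring
      have e3 : (n : ℝ) / 2 = z - (μ₁ + μ₂ + 1 / 2) / 2 := by rw [hzv]; ring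
      have e4 : -(((N : ℝ) + n + 1) / 2 + μ₁ + μ₂) = -(z - y 0) := by rw [hzv, hy0]; ring
      rw [e1, e2, e3, e4]
      linear_combination this
    · have hNn : Even (N + n) := by simp [Nat.even_add, hN, h]
      have hzv : z = -((n : ℝ) + (μ₁ + μ₂) + 1 / 2) / 2 := node_of_not_even _ h
      have := op (-(z - ((μ₁ - μ₂) / 2 - 1 / 4)) *
          (z - (-1 / 2 - (((N : ℝ) + μ₁ + μ₂ + 1 / 2) / 2 + μ₃))) / (n + μ₁ + μ₂))
        ((z - (μ₁ + μ₂ + 1 / 2) / 2) / (n + μ₁ + μ₂ + 1))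
        (by rw [div_mul_eq_mul_div, div_eq_iff d2, hzv]; ring)
        (by rw [div_mul_eq_mul_div, div_eq_iff d1, hzv]; ring)
      rw [node_succ_of_not_even _ h, reflNode, if_neg h, if_pos hNn, if_pos hNn, stepWeight,
        if_neg h, bracket, if_neg h, ← hz]
      have e1 : ((n : ℝ) + 1) / 2 + μ₁ + μ₂ = -(z - (μ₁ + μ₂ + 1 / 2) / 2) := by rw [hzv]; ring
      have e2 : -((N : ℝ) - n) / 2 = -(z - y 0) := by rw [hzv, hy0]; ring
      have e3 : (n : ℝ) / 2 + μ₁ = -(z - ((μ₁ - μ₂) / 2 - 1 / 4)) := by rw [hzv]; ring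
      have e4 : ((N : ℝ) - n + 1) / 2 + μ₃ =
        z - (-1 / 2 - (((N : ℝ) + μ₁ + μ₂ + 1 / 2) / 2 + μ₃)) := by rw [hzv]; ring
      rw [e1, e2, e3, e4]
      linear_combination this

/-! ### The weight and its moments -/

/-- Differences of nodes are brackets up to sign. -/
lemma node_sub_node (ν : ℝ) {k m : ℕ} (h : k ≤ m) :
    node ν m - node ν k = (-1) ^ m * bracket (ν + k + 1 / 2) (m - k) := by
  obtain ⟨r, rfl⟩ := Nat.exists_eq_add_of_le h
  have hs : ((-1 : ℝ) ^ r) * (-1) ^ r = 1 := by rw [← mul_pow]; simp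
  rw [Nat.add_sub_cancel_left, bracket, node, node, pow_add]
  split_ifs with hr
  · rw [hr.neg_one_pow]; push_cast; ring
  · rw [(Nat.not_even_iff_odd.1 hr).neg_one_pow]; push_cast; ring

/-- The sign `∏_{t < j} (-(-1)^(N + t))` relating a reversed Newton basis polynomial at a node to a
quotient of bracket factorials. -/
def flipSign (N j : ℕ) : ℝ := ∏ t ∈ Finset.range j, -(-1) ^ (N + t)

lemma flipSign_succ (N j : ℕ) : flipSign N (j + 1) = flipSign N j * (-(-1) ^ (N + j)) :=
  Finset.prod_range_succ _ _

lemma bracketFactorial_mul_revBasis (ν : ℝ) {N k j : ℕ} (h : k + j ≤ N) :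
    bracketFactorial (ν + k + 1 / 2) (N - k - j) *
      (flipSign N j * newtonBasis (revNode ν N) j (node ν k)) =
      bracketFactorial (ν + k + 1 / 2) (N - k) := by
  induction j with
  | zero => simp [flipSign, newtonBasis_zero]
  | succ j ih =>
    rw [← ih (by omega), flipSign_succ, newtonBasis_succ, revNode_eq_node ν (by omega),
      show N - k - j = N - k - (j + 1) + 1 by omega, bracketFactorial_succ]
    have h1 := node_sub_node ν (k := k) (m := N - j) (by omega)
    have hs : ((-1 : ℝ) ^ (N + j)) * (-1) ^ (N - j) = 1 := by
      rw [← pow_add, show N + j + (N - j) = 2 * N by omega, pow_mul]; simp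
    rw [show N - j - k = N - k - (j + 1) + 1 by omega] at h1
    rw [← neg_sub, h1]
    linear_combination bracketFactorial (ν + k + 1 / 2) (N - k - (j + 1)) * flipSign N j *
      newtonBasis (revNode ν N) j (node ν k) * bracket (ν + k + 1 / 2) (N - k - (j + 1) + 1) * hs

lemma revBasis_eq_zero (ν : ℝ) {N k j : ℕ} (hk : k ≤ N) (h : N < k + j) :
    newtonBasis (revNode ν N) j (node ν k) = 0 := by
  have := newtonBasis_eq_zero (revNode ν N) (i := j) (t := N - k) (by omega)
  rwa [revNode_eq_node ν (by omega), show N - (N - k) = k by omega] at this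

/-- The gauged coefficient of `k ↦ k + 1`, with the roles of `μ₁` and `μ₃` exchanged. -/
def upRate (μ₁ μ₂ μ₃ : ℝ) (N k : ℕ) : ℝ :=
  stepUp μ₃ μ₂ μ₁ N k * gaugeRatio μ₃ μ₂ μ₁ N k

/-- The gauged coefficient of `k ↦ k - 1`, with the roles of `μ₁` and `μ₃` exchanged. -/
def downRate (μ₁ μ₂ μ₃ : ℝ) (N k : ℕ) : ℝ :=
  stepDown μ₃ μ₂ μ₁ N k / gaugeRatio μ₃ μ₂ μ₁ N (k - 1)

lemma upRate_self {μ₁ μ₂ μ₃ : ℝ} (h₁ : 0 < μ₁) (h₂ : 0 < μ₂) (h₃ : 0 < μ₃) (N : ℕ) :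
    upRate μ₁ μ₂ μ₃ N N = 0 := by
  rw [upRate, stepUp_mul_gaugeRatio h₃ h₂ h₁ le_rfl, if_pos ⟨N, rfl⟩]; simp

lemma downRate_zero (μ₁ μ₂ μ₃ : ℝ) (N : ℕ) : downRate μ₁ μ₂ μ₃ N 0 = 0 := by
  simp [downRate, stepDown_eq, bracket_zero]

lemma downRate_succ_ne_zero {μ₁ μ₂ μ₃ : ℝ} (h₁ : 0 < μ₁) (h₂ : 0 < μ₂) (h₃ : 0 < μ₃) {N k : ℕ}
    (hk : k < N) : downRate μ₁ μ₂ μ₃ N (k + 1) ≠ 0 := by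
  have hk' : (0 : ℝ) < N - k := by
    have : (k : ℝ) < N := by exact_mod_cast hk
    linarith
  have hb := bracket_succ_pos (μ := μ₃) (by linarith) k
  rw [downRate, stepDown_div_gaugeRatio h₃ h₂ h₁ hk]
  push_cast
  refine mul_ne_zero (by positivity) ?_
  split_ifs
  · apply ne_of_gt; linarith
  · apply neg_ne_zero.2; positivity

/-- The weight in `k` that is in detailed balance for the rates `upRate` and `downRate`. -/
def balanceWeight (μ₁ μ₂ μ₃ : ℝ) (N k : ℕ) : ℝ :=
  bracketFactorial μ₁ N /
    (bracketFactorial (coupledMu μ₁ μ₂ 0) N * bracketFactorial (coupledMu μ₂ μ₃ 0) N) *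
  ∏ t ∈ Finset.range k, upRate μ₁ μ₂ μ₃ N t / downRate μ₁ μ₂ μ₃ N (t + 1)

lemma balanceWeight_succ {μ₁ μ₂ μ₃ : ℝ} (h₁ : 0 < μ₁) (h₂ : 0 < μ₂) (h₃ : 0 < μ₃) {N k : ℕ}
    (hk : k < N) : balanceWeight μ₁ μ₂ μ₃ N (k + 1) * downRate μ₁ μ₂ μ₃ N (k + 1) =
      balanceWeight μ₁ μ₂ μ₃ N k * upRate μ₁ μ₂ μ₃ N k := by
  have := downRate_succ_ne_zero h₁ h₂ h₃ hk
  simp only [balanceWeight, Finset.prod_range_succ]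
  field_simp

/-- The moment of `balanceWeight` against the `j`-th reversed Newton basis polynomial. -/
def balanceMoment (μ₁ μ₂ μ₃ : ℝ) (N j : ℕ) : ℝ :=
  ∑ k ∈ Finset.range (N + 1), balanceWeight μ₁ μ₂ μ₃ N k *
    newtonBasis (revNode (μ₃ + μ₂) N) j (node (μ₃ + μ₂) k)

/-- By detailed balance the operator of `revBasis_recurrence` has mean zero for `balanceWeight`,
which relates consecutive moments. -/
lemma balanceMoment_rec {μ₁ μ₂ μ₃ : ℝ} (h₁ : 0 < μ₁) (h₂ : 0 < μ₂) (h₃ : 0 < μ₃) {N j : ℕ}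
    (hj : j ≤ N) :
    (node (μ₂ + μ₁) j - node (μ₂ + μ₁) 0) * balanceMoment μ₁ μ₂ μ₃ N j =
      (-1) ^ N * bracket μ₃ (N + 1 - j) * bracket μ₁ j * balanceMoment μ₁ μ₂ μ₃ N (j - 1) := by
  have key : ∑ k ∈ Finset.range (N + 1), balanceWeight μ₁ μ₂ μ₃ N k *
      ((node (μ₂ + μ₁) j - node (μ₂ + μ₁) 0) *
        newtonBasis (revNode (μ₃ + μ₂) N) j (node (μ₃ + μ₂) k) -
      (-1) ^ N * bracket μ₃ (N + 1 - j) * bracket μ₁ j *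
        newtonBasis (revNode (μ₃ + μ₂) N) (j - 1) (node (μ₃ + μ₂) k)) = 0 := by
    have h : ∀ k ∈ Finset.range (N + 1), balanceWeight μ₁ μ₂ μ₃ N k *
      ((node (μ₂ + μ₁) j - node (μ₂ + μ₁) 0) *
        newtonBasis (revNode (μ₃ + μ₂) N) j (node (μ₃ + μ₂) k) -
      (-1) ^ N * bracket μ₃ (N + 1 - j) * bracket μ₁ j *
        newtonBasis (revNode (μ₃ + μ₂) N) (j - 1) (node (μ₃ + μ₂) k)) =
      balanceWeight μ₁ μ₂ μ₃ N k * upRate μ₁ μ₂ μ₃ N k *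
        (newtonBasis (revNode (μ₃ + μ₂) N) j (node (μ₃ + μ₂) (k + 1)) -
          newtonBasis (revNode (μ₃ + μ₂) N) j (node (μ₃ + μ₂) k)) +
      balanceWeight μ₁ μ₂ μ₃ N k * downRate μ₁ μ₂ μ₃ N k *
        (newtonBasis (revNode (μ₃ + μ₂) N) j (reflNode (μ₃ + μ₂) k) -
          newtonBasis (revNode (μ₃ + μ₂) N) j (node (μ₃ + μ₂) k)) := by
      intro k hk
      rw [← revBasis_recurrence h₃ h₂ h₁ (Nat.lt_succ_iff.1 (Finset.mem_range.1 hk)) hj, upRate,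
        downRate]
      ring
    rw [Finset.sum_congr rfl h, Finset.sum_add_distrib, Finset.sum_range_succ,
      upRate_self h₁ h₂ h₃, Finset.sum_range_succ' (fun k => balanceWeight μ₁ μ₂ μ₃ N k *
        downRate μ₁ μ₂ μ₃ N k * (newtonBasis (revNode (μ₃ + μ₂) N) j (reflNode (μ₃ + μ₂) k) -
          newtonBasis (revNode (μ₃ + μ₂) N) j (node (μ₃ + μ₂) k))), downRate_zero]
    simp only [mul_zero, zero_mul, add_zero]
    rw [← Finset.sum_add_distrib]
    refine Finset.sum_eq_zero fun k hk => ?_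
    rw [reflNode_succ, balanceWeight_succ h₁ h₂ h₃ (Finset.mem_range.1 hk)]
    ring
  unfold balanceMoment
  rw [← sub_eq_zero, Finset.mul_sum, Finset.mul_sum, ← Finset.sum_sub_distrib, ← key]
  exact Finset.sum_congr rfl fun k _ => by ring

/-- The solution of the triangular system of `coupledPoly_mul_eq_sum` for `n = 0`. -/
def couplingWeight (μ₁ μ₂ μ₃ : ℝ) (N k : ℕ) : ℝ :=
  balanceWeight μ₁ μ₂ μ₃ N k * bracketFactorial (coupledMu μ₂ μ₃ k) (N - k)

lemma coupledMu_pos {μ₁ μ₂ : ℝ} (h₁ : 0 < μ₁) (h₂ : 0 < μ₂) (n : ℕ) : 0 < coupledMu μ₁ μ₂ n := by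
  unfold coupledMu; positivity

lemma bracketFactorial_ne_zero {μ : ℝ} (hμ : 0 < μ) (n : ℕ) : bracketFactorial μ n ≠ 0 :=
  (bracketFactorial_pos (by linarith) n).ne'

lemma sum_couplingWeight_eq_moment {μ₁ μ₂ μ₃ : ℝ} (h₂ : 0 < μ₂) (h₃ : 0 < μ₃)
    {N j : ℕ} (hj : j ≤ N) :
    ∑ k ∈ Finset.range (N - j + 1), couplingWeight μ₁ μ₂ μ₃ N k /
      bracketFactorial (coupledMu μ₂ μ₃ k) (N - j - k) =
      flipSign N j * balanceMoment μ₁ μ₂ μ₃ N j := by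
  rw [balanceMoment, Finset.mul_sum]
  apply Finset.sum_subset_zero_on_sdiff (Finset.range_mono (by omega))
  · intro k hk
    simp only [Finset.mem_sdiff, Finset.mem_range] at hk
    rw [revBasis_eq_zero _ (by omega) (by omega)]; simp
  · intro k hk
    have hk := Finset.mem_range.1 hk
    have hb := bracketFactorial_ne_zero (coupledMu_pos h₂ h₃ k) (N - j - k)
    have := bracketFactorial_mul_revBasis (μ₃ + μ₂) (N := N) (k := k) (j := j) (by omega)
    rw [show μ₃ + μ₂ + (k : ℝ) + 1 / 2 = coupledMu μ₂ μ₃ k by unfold coupledMu; ring,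
      show N - k - j = N - j - k by omega] at this
    rw [couplingWeight, ← this]
    field_simp

/-- The triangular system of `coupledPoly_mul_eq_sum` for `n = 0`. -/
theorem sum_couplingWeight {μ₁ μ₂ μ₃ : ℝ} (h₁ : 0 < μ₁) (h₂ : 0 < μ₂) (h₃ : 0 < μ₃)
    {N s : ℕ} (hs : s ≤ N) :
    ∑ k ∈ Finset.range (s + 1), couplingWeight μ₁ μ₂ μ₃ N k /
      bracketFactorial (coupledMu μ₂ μ₃ k) (s - k) =
      bracketFactorial μ₁ (N - s) /
        (bracketFactorial (coupledMu μ₁ μ₂ 0) (N - s) * bracketFactorial μ₃ s) := by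
  induction s with
  | zero =>
    have hb := bracketFactorial_ne_zero (coupledMu_pos h₂ h₃ 0) N
    simp only [zero_add, Finset.sum_range_one, Nat.sub_zero, bracketFactorial_zero, couplingWeight,
      balanceWeight, Finset.prod_range_zero]
    field_simp
  | succ s ih =>
    have ih := ih (by omega)
    have m1 := sum_couplingWeight_eq_moment (μ₁ := μ₁) h₂ h₃ (N := N) (j := N - s) (by omega)
    have m2 := sum_couplingWeight_eq_moment (μ₁ := μ₁) h₂ h₃ (N := N) (j := N - (s + 1)) (by omega)
    have hrec := balanceMoment_rec h₁ h₂ h₃ (N := N) (j := N - s) (by omega)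
    rw [show N - (N - s) = s by omega, ih] at m1
    rw [show N - (N - (s + 1)) = s + 1 by omega] at m2
    rw [m2]
    obtain ⟨r, rfl⟩ := Nat.exists_eq_add_of_le hs
    rw [show s + 1 + r - s = r + 1 by omega] at m1 hrec
    rw [show s + 1 + r - (s + 1) = r by omega]
    rw [show s + 1 + r + 1 - (r + 1) = s + 1 by omega, Nat.add_sub_cancel,
      node_sub_node _ (Nat.zero_le _)] at hrec
    rw [flipSign_succ] at m1
    rw [show μ₂ + μ₁ + ((0 : ℕ) : ℝ) + 1 / 2 = coupledMu μ₁ μ₂ 0 by unfold coupledMu; ring,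
      Nat.sub_zero] at hrec
    simp only [bracketFactorial_succ] at m1 ⊢
    have b1 := bracketFactorial_ne_zero h₁ r
    have b2 := bracketFactorial_ne_zero h₃ s
    have b3 := bracketFactorial_ne_zero (coupledMu_pos h₁ h₂ 0) r
    have c1 := (bracket_succ_pos (μ := μ₁) (by linarith) r).ne'
    have c2 := (bracket_succ_pos (μ := μ₃) (by linarith) s).ne'
    have c3 := (bracket_succ_pos (μ := coupledMu μ₁ μ₂ 0)
      (by linarith [coupledMu_pos h₁ h₂ 0]) r).ne'
    have hs1 : ((-1 : ℝ) ^ (s + 1 + r)) * (-1) ^ (s + 1 + r) = 1 := by rw [← mul_pow]; simp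
    have hs2 : ((-1 : ℝ) ^ r) * (-1) ^ r = 1 := by rw [← mul_pow]; simp
    have e : (-1 : ℝ) ^ (r + 1) = -(-1) ^ r := by ring
    rw [e] at hrec
    rw [pow_add _ (s + 1 + r) r] at m1
    set σ := (-1 : ℝ) ^ (s + 1 + r)
    set τ := (-1 : ℝ) ^ r
    have hM : balanceMoment μ₁ μ₂ μ₃ (s + 1 + r) r * (bracket μ₃ (s + 1) * bracket μ₁ (r + 1)) =
        -σ * τ * bracket (coupledMu μ₁ μ₂ 0) (r + 1) *
          balanceMoment μ₁ μ₂ μ₃ (s + 1 + r) (r + 1) := by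
      linear_combination (-σ) * hrec - bracket μ₃ (s + 1) * bracket μ₁ (r + 1) *
        balanceMoment μ₁ μ₂ μ₃ (s + 1 + r) r * hs1
    rw [eq_div_iff (by positivity)]
    rw [div_eq_iff (by positivity)] at m1
    refine mul_right_cancel₀ c1 ?_
    linear_combination flipSign (s + 1 + r) r * bracketFactorial (coupledMu μ₁ μ₂ 0) r *
      bracketFactorial μ₃ s * hM - m1

/-! ### The recoupling coefficients -/

/-- The gauge factor, normalised for the comparison in `profile_eq_convSum`. -/
def gaugeFactor (μ₁ μ₂ μ₃ : ℝ) (N n : ℕ) : ℝ :=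
  (∏ t ∈ Finset.range n, gaugeRatio μ₁ μ₂ μ₃ N t) / bracketFactorial (coupledMu μ₁ μ₂ 0) N

lemma gaugeFactor_succ (μ₁ μ₂ μ₃ : ℝ) (N n : ℕ) : gaugeFactor μ₁ μ₂ μ₃ N (n + 1) =
    gaugeFactor μ₁ μ₂ μ₃ N n * gaugeRatio μ₁ μ₂ μ₃ N n := by
  rw [gaugeFactor, gaugeFactor, Finset.prod_range_succ]; ring

lemma gaugeFactor_ne_zero {μ₁ μ₂ μ₃ : ℝ} (h₁ : 0 < μ₁) (h₂ : 0 < μ₂) (h₃ : 0 < μ₃) {N n : ℕ}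
    (hn : n ≤ N) : gaugeFactor μ₁ μ₂ μ₃ N n ≠ 0 :=
  div_ne_zero (Finset.prod_ne_zero_iff.2 fun t ht =>
    gaugeRatio_ne_zero h₁ h₂ h₃ (by have := Finset.mem_range.1 ht; omega))
    (bracketFactorial_ne_zero (coupledMu_pos h₁ h₂ 0) N)

/-- The left side of the triangular system as a function of `s` and of the node `z` that belongs to
`n`: the quotient of bracket factorials is a reversed Newton basis polynomial in `z`. -/
def profile (μ₁ μ₂ μ₃ : ℝ) (N s : ℕ) (z : ℝ) : ℝ :=
  bracketFactorial μ₁ (N - s) / bracketFactorial μ₃ s *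
    (flipSign N s * newtonBasis (revNode (μ₁ + μ₂) N) s z)

/-- The right side of the triangular system: the convolution with `couplingWeight` of a function of
`k`. -/
def convSum (μ₁ μ₂ μ₃ : ℝ) (N s : ℕ) (f : ℕ → ℝ) : ℝ :=
  ∑ k ∈ Finset.range (s + 1), couplingWeight μ₁ μ₂ μ₃ N k /
    bracketFactorial (coupledMu μ₂ μ₃ k) (s - k) * f k

lemma biSum_node_zero (μ₁ μ₂ μ₃ : ℝ) (N : ℕ) (X : ℝ) :
    biSum μ₁ μ₂ μ₃ N (node (μ₁ + μ₂) 0) X = 1 := by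
  rw [biSum, Finset.sum_eq_single 0]
  · simp [biCoeff, xNewton, newtonBasis_zero]
  · intro i _ hi
    rw [newtonBasis_eq_zero _ (Nat.pos_of_ne_zero hi), mul_zero]
  · simp

/-- Multiplication by the grid point `node (μ₂ + μ₃) k` under the sum is a two-term operation in
`s`. -/
lemma convSum_mul_node {μ₁ μ₂ μ₃ : ℝ} (h₂ : 0 < μ₂) (h₃ : 0 < μ₃)
    (N s : ℕ) (a : ℝ) (f : ℕ → ℝ) :
    convSum μ₁ μ₂ μ₃ N s (fun k => (node (μ₂ + μ₃) k - a) * f k) =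
      (node (μ₂ + μ₃) s - a) * convSum μ₁ μ₂ μ₃ N s f -
        if s = 0 then 0 else (-1) ^ s * convSum μ₁ μ₂ μ₃ N (s - 1) f := by
  rcases s with _ | s
  · simp only [convSum, zero_add, Finset.sum_range_one, if_true]
    ring
  · rw [if_neg (by omega), Nat.add_sub_cancel]
    unfold convSum
    rw [Finset.mul_sum, Finset.sum_range_succ, Finset.sum_range_succ _ (s + 1), Finset.mul_sum,
      add_sub_right_comm, ← Finset.sum_sub_distrib]
    congr 1
    · refine Finset.sum_congr rfl fun k hk => ?_
      have hk := Finset.mem_range.1 hk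
      have h1 := node_sub_node (μ₂ + μ₃) (k := k) (m := s + 1) (by omega)
      rw [show s + 1 - k = s - k + 1 by omega] at h1 ⊢
      rw [show μ₂ + μ₃ + (k : ℝ) + 1 / 2 = coupledMu μ₂ μ₃ k from rfl] at h1
      have hb := bracketFactorial_ne_zero (coupledMu_pos h₂ h₃ k) (s - k)
      have hc := (bracket_succ_pos (μ := coupledMu μ₂ μ₃ k)
        (by linarith [coupledMu_pos h₂ h₃ k]) (s - k)).ne'
      rw [bracketFactorial_succ]
      field_simp
      linear_combination -(couplingWeight μ₁ μ₂ μ₃ N k * f k) * h1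
    · ring

lemma profile_pred {μ₁ μ₂ μ₃ : ℝ} (h₃ : 0 < μ₃) {N s : ℕ} (hs : s ≤ N)
    (z : ℝ) :
    bracketFactorial μ₁ (N - s) / bracketFactorial μ₃ s * flipSign N s *
      ((-1) ^ N * bracket μ₁ (N + 1 - s) * bracket μ₃ s *
        newtonBasis (revNode (μ₁ + μ₂) N) (s - 1) z) =
      if s = 0 then 0 else (-1) ^ s * profile μ₁ μ₂ μ₃ N (s - 1) z := by
  rcases s with _ | s
  · simp [bracket_zero]
  · obtain ⟨r, rfl⟩ := Nat.exists_eq_add_of_le hs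
    have b2 := bracketFactorial_ne_zero h₃ s
    have c2 := (bracket_succ_pos (μ := μ₃) (by linarith) s).ne'
    have hs1 : ((-1 : ℝ) ^ (s + 1 + r)) * (-1) ^ (s + 1 + r) = 1 := by rw [← mul_pow]; simp
    rw [if_neg (by omega), Nat.add_sub_cancel, profile, flipSign_succ, bracketFactorial_succ μ₃ s,
      Nat.add_sub_cancel_left, show s + 1 + r - s = r + 1 by omega,
      show s + 1 + r + 1 - (s + 1) = r + 1 by omega, bracketFactorial_succ, pow_add _ (s + 1 + r) s]
    field_simp
    rw [pow_succ]
    linear_combination -(bracketFactorial μ₁ r * flipSign (s + 1 + r) s * (-1) ^ s *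
      bracket μ₁ (r + 1) * newtonBasis (revNode (μ₁ + μ₂) (s + 1 + r)) s z) * hs1

/-- The triangular system for all `n`, by induction on `n` through the three-term recurrences. -/
theorem profile_eq_convSum {μ₁ μ₂ μ₃ : ℝ} (h₁ : 0 < μ₁) (h₂ : 0 < μ₂) (h₃ : 0 < μ₃) {N : ℕ}
    (n : ℕ) (hn : n ≤ N) {s : ℕ} (hs : s ≤ N) :
    convSum μ₁ μ₂ μ₃ N s
        (fun k => biSum μ₁ μ₂ μ₃ N (node (μ₁ + μ₂) n) (node (μ₂ + μ₃) k)) =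
      gaugeFactor μ₁ μ₂ μ₃ N n * profile μ₁ μ₂ μ₃ N s (node (μ₁ + μ₂) n) := by
  induction n using Nat.strong_induction_on generalizing s with
  | _ n ih =>
    rcases n with _ | n
    · have h := bracketFactorial_mul_revBasis (μ₁ + μ₂) (N := N) (k := 0) (j := s) (by omega)
      rw [show μ₁ + μ₂ + ((0 : ℕ) : ℝ) + 1 / 2 = coupledMu μ₁ μ₂ 0 from rfl, Nat.sub_zero] at h
      have b1 := bracketFactorial_ne_zero (coupledMu_pos h₁ h₂ 0) (N - s)
      have b2 := bracketFactorial_ne_zero (coupledMu_pos h₁ h₂ 0) N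
      have b3 := bracketFactorial_ne_zero h₃ s
      simp only [biSum_node_zero, convSum, mul_one]
      rw [sum_couplingWeight h₁ h₂ h₃ hs, profile, gaugeFactor, Finset.prod_range_zero]
      field_simp
      linear_combination -(bracketFactorial μ₁ (N - s)) * h
    · have hnN : n < N := by omega
      -- the value at the reflected node enters with a coefficient that vanishes for `n = 0`
      have hdown : ∀ s ≤ N, stepDown μ₁ μ₂ μ₃ N n * convSum μ₁ μ₂ μ₃ N s
          (fun k => biSum μ₁ μ₂ μ₃ N (reflNode (μ₁ + μ₂) n) (node (μ₂ + μ₃) k)) =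
          stepDown μ₁ μ₂ μ₃ N n / gaugeRatio μ₁ μ₂ μ₃ N (n - 1) *
            (gaugeFactor μ₁ μ₂ μ₃ N n *
              profile μ₁ μ₂ μ₃ N s (reflNode (μ₁ + μ₂) n)) := by
        intro s hs
        rcases n with _ | m
        · simp [stepDown_eq, bracket_zero]
        · have hg := gaugeRatio_ne_zero h₁ h₂ h₃ (show m < N by omega)
          rw [reflNode_succ, ih m (by omega) (by omega) hs, gaugeFactor_succ, Nat.add_sub_cancel]
          field_simp
      have hcur := fun {s} (hs : s ≤ N) => ih n (by omega) (by omega) hs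
      have hbi : stepUp μ₁ μ₂ μ₃ N n * (convSum μ₁ μ₂ μ₃ N s
            (fun k => biSum μ₁ μ₂ μ₃ N (node (μ₁ + μ₂) (n + 1)) (node (μ₂ + μ₃) k)) -
          convSum μ₁ μ₂ μ₃ N s
            (fun k => biSum μ₁ μ₂ μ₃ N (node (μ₁ + μ₂) n) (node (μ₂ + μ₃) k))) +
          stepDown μ₁ μ₂ μ₃ N n * (convSum μ₁ μ₂ μ₃ N s
            (fun k => biSum μ₁ μ₂ μ₃ N (reflNode (μ₁ + μ₂) n) (node (μ₂ + μ₃) k)) -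
          convSum μ₁ μ₂ μ₃ N s
            (fun k => biSum μ₁ μ₂ μ₃ N (node (μ₁ + μ₂) n) (node (μ₂ + μ₃) k))) =
          convSum μ₁ μ₂ μ₃ N s (fun k => (node (μ₂ + μ₃) k - xNode μ₂ μ₃ 0) *
            biSum μ₁ μ₂ μ₃ N (node (μ₁ + μ₂) n) (node (μ₂ + μ₃) k)) := by
        simp only [← biSum_recurrence h₁ h₂ h₃ hnN, convSum, Finset.mul_sum,
          ← Finset.sum_sub_distrib, ← Finset.sum_add_distrib]
        exact Finset.sum_congr rfl fun k _ => by ring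
      rw [convSum_mul_node h₂ h₃, mul_sub, mul_sub, hdown s hs, hcur hs] at hbi
      have hrev := revBasis_recurrence h₁ h₂ h₃ hnN.le hs
      have hsum := gauged_step_sum h₁ h₂ h₃ hnN.le
      have hpred := profile_pred (μ₁ := μ₁) (μ₂ := μ₂) h₃ hs (node (μ₁ + μ₂) n)
      have hx : node (μ₂ + μ₃) 0 - xNode μ₂ μ₃ 0 = μ₂ + 1 / 2 := by
        simp [node, xNode]; ring
      have hif : (if s = 0 then 0 else (-1) ^ s * convSum μ₁ μ₂ μ₃ N (s - 1)
          (fun k => biSum μ₁ μ₂ μ₃ N (node (μ₁ + μ₂) n) (node (μ₂ + μ₃) k))) =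
          gaugeFactor μ₁ μ₂ μ₃ N n *
          if s = 0 then 0 else (-1) ^ s * profile μ₁ μ₂ μ₃ N (s - 1) (node (μ₁ + μ₂) n) := by
        split_ifs
        · simp
        · rw [hcur (by omega)]; ring
      rw [hif, ← hpred] at hbi
      refine mul_left_cancel₀ (stepUp_ne_zero h₁ h₂ h₃ hnN) ?_
      rw [gaugeFactor_succ]
      simp only [profile] at hbi ⊢
      set κ := bracketFactorial μ₁ (N - s) / bracketFactorial μ₃ s
      set E := gaugeFactor μ₁ μ₂ μ₃ N n
      linear_combination hbi - E * κ * flipSign N s * hrev +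
        E * κ * flipSign N s * newtonBasis (revNode (μ₁ + μ₂) N) s (node (μ₁ + μ₂) n) * (hx - hsum)

/-- The `n`-dependent factor of the recoupling coefficients. -/
def racahFactor (μ₁ μ₂ μ₃ : ℝ) (N n : ℕ) : ℝ :=
  (gaugeFactor μ₁ μ₂ μ₃ N n * bracketFactorial (coupledMu μ₁ μ₂ n) (N - n))⁻¹

/-- The convolution identity without normalisations and square roots. -/
theorem coupledPoly_mul_eq_sum_biSum {μ₁ μ₂ μ₃ : ℝ} (h₁ : 0 < μ₁) (h₂ : 0 < μ₂) (h₃ : 0 < μ₃)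
    {N n : ℕ} (hn : n ≤ N) (c x y z : ℝ) :
    coupledPoly μ₁ μ₂ n c x y *
        coupledPoly (coupledMu μ₁ μ₂ n) μ₃ (N - n) ((-1) ^ n * c) y z =
      ∑ k ∈ Finset.range (N + 1),
        ((-1) ^ (k * (N + 1)) * bracketFactorial μ₃ k / bracketFactorial μ₁ n *
          (couplingWeight μ₁ μ₂ μ₃ N k * racahFactor μ₁ μ₂ μ₃ N n *
            biSum μ₁ μ₂ μ₃ N (node (μ₁ + μ₂) n) (node (μ₂ + μ₃) k))) *
        (coupledPoly μ₂ μ₃ k x y z *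
          coupledPoly μ₁ (coupledMu μ₂ μ₃ k) (N - k) ((-1) ^ k * c) ((-1) ^ k * x) z) := by
  refine coupledPoly_mul_eq_sum h₁ h₂ h₃ hn _ (fun s hs => ?_) c x y z
  have hE := gaugeFactor_ne_zero h₁ h₂ h₃ hn
  have hb := bracketFactorial_ne_zero (coupledMu_pos h₁ h₂ n) (N - n)
  have h := profile_eq_convSum h₁ h₂ h₃ n hn hs
  have e : ∑ k ∈ Finset.range (s + 1), couplingWeight μ₁ μ₂ μ₃ N k * racahFactor μ₁ μ₂ μ₃ N n *
      biSum μ₁ μ₂ μ₃ N (node (μ₁ + μ₂) n) (node (μ₂ + μ₃) k) /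
      bracketFactorial (coupledMu μ₂ μ₃ k) (s - k) = racahFactor μ₁ μ₂ μ₃ N n *
      (gaugeFactor μ₁ μ₂ μ₃ N n * profile μ₁ μ₂ μ₃ N s (node (μ₁ + μ₂) n)) := by
    rw [← h, convSum, Finset.mul_sum]
    exact Finset.sum_congr rfl fun k _ => by ring
  rw [e, racahFactor, profile]
  split_ifs with hns
  · have hr := bracketFactorial_mul_revBasis (μ₁ + μ₂) hns
    rw [show μ₁ + μ₂ + (n : ℝ) + 1 / 2 = coupledMu μ₁ μ₂ n from rfl] at hr
    have b1 := bracketFactorial_ne_zero (coupledMu_pos h₁ h₂ n) (N - n - s)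
    have b3 := bracketFactorial_ne_zero h₃ s
    field_simp
    linear_combination -(bracketFactorial μ₁ (N - s)) * hr
  · rw [revBasis_eq_zero _ hn (by omega)]; simp

/-! ### Bannai-Ito polynomials as Newton sums -/

lemma poch_zero (a : ℝ) : poch a 0 = 1 := by simp [poch]

lemma poch_succ (a : ℝ) (n : ℕ) : poch a (n + 1) = poch a n * (a + n) := by
  simp [poch, ascPochhammer_succ_eval]

lemma poch_neg_eq_zero {m k : ℕ} (h : m < k) : poch (-(m : ℝ)) k = 0 := by
  induction k with
  | zero => omega
  | succ k ih =>
    rw [poch_succ]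
    rcases Nat.lt_succ_iff_lt_or_eq.1 h with h | rfl
    · rw [ih h, zero_mul]
    · simp

/-- The `k`-th term of a `₄F₃` at argument `1`. -/
def term43 (a₁ a₂ a₃ a₄ b₁ b₂ b₃ : ℝ) (k : ℕ) : ℝ :=
  poch a₁ k * poch a₂ k * poch a₃ k * poch a₄ k /
    (poch b₁ k * poch b₂ k * poch b₃ k * (k.factorial : ℝ))

lemma term43_zero (a₁ a₂ a₃ a₄ b₁ b₂ b₃ : ℝ) : term43 a₁ a₂ a₃ a₄ b₁ b₂ b₃ 0 = 1 := by
  simp [term43, poch_zero]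

lemma term43_succ (a₁ a₂ a₃ a₄ b₁ b₂ b₃ : ℝ) (k : ℕ) :
    term43 a₁ a₂ a₃ a₄ b₁ b₂ b₃ (k + 1) = term43 a₁ a₂ a₃ a₄ b₁ b₂ b₃ k *
      ((a₁ + k) * (a₂ + k) * (a₃ + k) * (a₄ + k) *
        ((b₁ + k) * (b₂ + k) * (b₃ + k) * (k + 1))⁻¹) := by
  simp only [term43, poch_succ, Nat.factorial_succ, div_eq_mul_inv]
  push_cast
  simp only [mul_inv]
  ring

lemma hypergeom43_neg_nat (m : ℕ) (a₂ a₃ a₄ b₁ b₂ b₃ : ℝ) :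
    hypergeom43 (-(m : ℝ)) a₂ a₃ a₄ b₁ b₂ b₃ 1 =
      ∑ k ∈ Finset.range (m + 1), term43 (-(m : ℝ)) a₂ a₃ a₄ b₁ b₂ b₃ k := by
  unfold hypergeom43
  rw [tsum_eq_sum (s := Finset.range (m + 1))]
  · exact Finset.sum_congr rfl fun k _ => by rw [one_pow, mul_one, term43]
  · intro k hk
    have : m < k := by simpa using hk
    rw [poch_neg_eq_zero this]; simp

lemma sum_range_two_mul_add_one (f : ℕ → ℝ) (m : ℕ) :
    ∑ i ∈ Finset.range (2 * m + 1), f i =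
      ∑ j ∈ Finset.range (m + 1), f (2 * j) + ∑ j ∈ Finset.range m, f (2 * j + 1) := by
  induction m with
  | zero => simp
  | succ m ih =>
    rw [show 2 * (m + 1) + 1 = 2 * m + 1 + 1 + 1 by ring, Finset.sum_range_succ,
      Finset.sum_range_succ _ (2 * m + 1), ih, Finset.sum_range_succ (fun j => f (2 * j)) (m + 1),
      Finset.sum_range_succ (fun j => f (2 * j + 1)) m]
    rw [show 2 * (m + 1) = 2 * m + 1 + 1 by ring]
    ring

lemma sum_range_two_mul_add_two (f : ℕ → ℝ) (m : ℕ) :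
    ∑ i ∈ Finset.range (2 * m + 1 + 1), f i =
      ∑ j ∈ Finset.range (m + 1), f (2 * j) + ∑ j ∈ Finset.range (m + 1), f (2 * j + 1) := by
  rw [Finset.sum_range_succ, sum_range_two_mul_add_one,
    Finset.sum_range_succ (fun j => f (2 * j + 1)), add_assoc]

lemma racahParams_g (μ₁ μ₂ μ₃ : ℝ) (N : ℕ) : (racahParams μ₁ μ₂ μ₃ N).g = μ₁ + μ₂ := by
  simp only [BIParams.g, racahParams]; ring

lemma dualGap_even (μ₁ μ₂ μ₃ : ℝ) (N j : ℕ) : dualGap μ₁ μ₂ μ₃ N (2 * j) =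
    (racahParams μ₁ μ₂ μ₃ N).ρ₂ - (racahParams μ₁ μ₂ μ₃ N).r₁ + 1 / 2 + j := by
  rw [dualGap, if_pos (even_two_mul j), node_of_even _ (even_two_mul j)]
  simp only [racahParams, tripleMu, dualB]
  split_ifs with hN
  · rw [hN.neg_one_pow]; push_cast; ring
  · rw [(Nat.not_even_iff_odd.1 hN).neg_one_pow]; push_cast; ring

lemma dualGap_odd (μ₁ μ₂ μ₃ : ℝ) (N j : ℕ) : dualGap μ₁ μ₂ μ₃ N (2 * j + 1) =
    -(1 - (racahParams μ₁ μ₂ μ₃ N).r₁ - (racahParams μ₁ μ₂ μ₃ N).r₂ + j) := by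
  have h := not_even_add_one (even_two_mul j)
  rw [dualGap, if_neg h, node_of_not_even _ h]
  simp only [racahParams, tripleMu, dualE]
  split_ifs with hN
  · rw [hN.neg_one_pow]; push_cast; ring
  · rw [(Nat.not_even_iff_odd.1 hN).neg_one_pow]; push_cast; ring

lemma bracket_odd (μ : ℝ) (j : ℕ) : bracket μ (2 * j + 1) = j + (μ + 1 / 2) := by
  rw [bracket, if_neg (not_even_add_one (even_two_mul j))]; push_cast; ring

lemma bracket_even (μ : ℝ) (j : ℕ) : bracket μ (2 * j) = j := by
  rw [bracket, if_pos (even_two_mul j)]; push_cast; ring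

/-- The `i`-th term of `biSum`. -/
def biTerm (μ₁ μ₂ μ₃ : ℝ) (N : ℕ) (z X : ℝ) (i : ℕ) : ℝ :=
  biCoeff μ₁ μ₂ μ₃ N i * xNewton μ₂ μ₃ i X * newtonBasis (node (μ₁ + μ₂)) i z

lemma biTerm_zero (μ₁ μ₂ μ₃ : ℝ) (N : ℕ) (z X : ℝ) : biTerm μ₁ μ₂ μ₃ N z X 0 = 1 := by
  simp [biTerm, biCoeff, xNewton, newtonBasis]

lemma biTerm_succ (μ₁ μ₂ μ₃ : ℝ) (N : ℕ) (z X : ℝ) (i : ℕ) :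
    biTerm μ₁ μ₂ μ₃ N z X (i + 1) = biTerm μ₁ μ₂ μ₃ N z X i *
      ((bracket μ₂ (i + 1) * dualGap μ₁ μ₂ μ₃ N i)⁻¹ * ((-1) ^ i * (X - xNode μ₂ μ₃ i)) *
        (z - node (μ₁ + μ₂) i)) := by
  simp only [biTerm, biCoeff_succ, xNewton_succ, newtonBasis_succ]; ring

lemma biSum_eq_sum_range (μ₁ μ₂ μ₃ : ℝ) {N n : ℕ} (hn : n ≤ N) (X : ℝ) :
    biSum μ₁ μ₂ μ₃ N (node (μ₁ + μ₂) n) X =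
      ∑ i ∈ Finset.range (n + 1), biTerm μ₁ μ₂ μ₃ N (node (μ₁ + μ₂) n) X i := by
  symm
  apply Finset.sum_subset (Finset.range_mono (by omega))
  intro i _ hi
  have : n < i := by simpa using hi
  rw [biTerm, newtonBasis_eq_zero _ this, mul_zero]

lemma xNode_even (μ₂ μ₃ : ℝ) (j : ℕ) : xNode μ₂ μ₃ (2 * j) = (μ₃ - μ₂) / 2 - j - 1 / 4 := by
  rw [xNode, (even_two_mul j).neg_one_pow]; push_cast; ring

lemma xNode_odd (μ₂ μ₃ : ℝ) (j : ℕ) :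
    xNode μ₂ μ₃ (2 * j + 1) = -((μ₃ - μ₂) / 2 - j - 3 / 4) := by
  rw [xNode, (odd_two_mul_add_one j).neg_one_pow]; push_cast; ring

/-- The terms of even and odd index of `biSum` are the terms of the two `₄F₃` series. -/
theorem bannaiIto_racahParams (μ₁ μ₂ μ₃ : ℝ) {N n : ℕ} (hn : n ≤ N) (x : ℝ) :
    bannaiIto n x (racahParams μ₁ μ₂ μ₃ N) = bannaiItoEta n (racahParams μ₁ μ₂ μ₃ N) *
      biSum μ₁ μ₂ μ₃ N (node (μ₁ + μ₂) n) (x + 1 / 4) := by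
  rw [biSum_eq_sum_range _ _ _ hn, bannaiIto, racahParams_g]
  congr 1
  have hr1 : (racahParams μ₁ μ₂ μ₃ N).r₁ = (μ₃ - μ₂) / 2 := rfl
  have hA : (racahParams μ₁ μ₂ μ₃ N).ρ₁ - (racahParams μ₁ μ₂ μ₃ N).r₁ = μ₂ := by
    simp only [racahParams]; ring
  have hg0 := dualGap_even μ₁ μ₂ μ₃ N
  have hg1 := dualGap_odd μ₁ μ₂ μ₃ N
  rw [hA, hr1] at *
  set C := (racahParams μ₁ μ₂ μ₃ N).ρ₂ - (μ₃ - μ₂) / 2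
  set B := 1 - (μ₃ - μ₂) / 2 - (racahParams μ₁ μ₂ μ₃ N).r₂
  have hb1 : ∀ j, bracket μ₂ (2 * j + 1 + 1) = j + 1 := fun j => by
    have := bracket_even μ₂ (j + 1); push_cast at this; exact this
  have hs1 : ∀ j : ℕ, (-1 : ℝ) ^ (2 * j + 1) = -1 := fun j =>
    (odd_two_mul_add_one j).neg_one_pow
  have hs2 : ∀ j : ℕ, (-1 : ℝ) ^ (2 * j + 1 + 1) = 1 := fun j =>
    (even_two_mul (j + 1)).neg_one_pow
  rcases Nat.even_or_odd' n with ⟨m, rfl | rfl⟩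
  · have hz0 : ∀ j : ℕ, node (μ₁ + μ₂) (2 * m) - node (μ₁ + μ₂) (2 * j) = m - j := fun j => by
      rw [node_of_even _ (even_two_mul m), node_of_even _ (even_two_mul j)]; push_cast; ring
    have hz1 : ∀ j : ℕ, node (μ₁ + μ₂) (2 * m) - node (μ₁ + μ₂) (2 * j + 1) =
        m + (μ₁ + μ₂) + 1 + j := fun j => by
      rw [node_of_even _ (even_two_mul m),
        node_of_not_even _ (not_even_add_one (even_two_mul j))]; push_cast; ring
    rw [sum_range_two_mul_add_one, Nat.mul_div_cancel_left _ two_pos, Nat.mul_mod_right,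
      hypergeom43_neg_nat]
    congr 1
    · refine Finset.sum_congr rfl fun j hj => ?_
      clear hj
      induction j with
      | zero => rw [term43_zero, mul_zero, biTerm_zero]
      | succ j ih =>
        rw [term43_succ, show 2 * (j + 1) = 2 * j + 1 + 1 by ring, biTerm_succ, biTerm_succ, ih,
          hz0, hz1, hg0, hg1, bracket_odd, hb1, xNode_even, xNode_odd, hs1 j,
          (even_two_mul j).neg_one_pow]
        simp only [mul_inv, inv_neg]
        ring
    · rcases m with _ | m
        -- for `n = 0` the vanishing prefactor removes the second series, which does not terminate
      · simp
      · rw [show -((m + 1 : ℕ) : ℝ) - ((0 : ℕ) : ℝ) + 1 = -(m : ℝ) by push_cast; ring,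
          hypergeom43_neg_nat, Finset.mul_sum]
        refine Finset.sum_congr rfl fun j hj => ?_
        clear hj
        induction j with
        | zero =>
          have h0 := hz0 0
          have h1 := hg0 0
          have h2 := bracket_odd μ₂ 0
          have h3 := xNode_even μ₂ μ₃ 0
          rw [term43_zero, biTerm_succ, biTerm_zero, h0, h1, h2, h3, mul_zero,
            (even_two_mul (m + 1)).neg_one_pow]
          simp only [mul_inv, div_eq_mul_inv]
          push_cast
          ring
        | succ j ih =>
          have h0 := hz0 (j + 1)
          have h1 := hg0 (j + 1)
          have h2 := bracket_odd μ₂ (j + 1)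
          have h3 := xNode_even μ₂ μ₃ (j + 1)
          rw [show 2 * (j + 1) = 2 * j + 1 + 1 by ring] at h0 h1 h2 h3 ⊢
          rw [term43_succ, biTerm_succ, biTerm_succ, ← mul_assoc, ih, h0, h1, h2, h3, hz1, hg1, hb1,
            xNode_odd, hs2 j, hs1 j]
          push_cast
          rw [show μ₂ + 3 / 2 + (j : ℝ) = (j : ℝ) + 1 + (μ₂ + 1 / 2) by ring,
            show C + 3 / 2 + (j : ℝ) = C + 1 / 2 + ((j : ℝ) + 1) by ring]
          simp only [mul_inv, inv_neg]
          ring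
  · have hz0 : ∀ j : ℕ, node (μ₁ + μ₂) (2 * m + 1) - node (μ₁ + μ₂) (2 * j) =
        -(m + (μ₁ + μ₂) + 1 + j) := fun j => by
      rw [node_of_not_even _ (not_even_add_one (even_two_mul m)),
        node_of_even _ (even_two_mul j)]; push_cast; ring
    have hz1 : ∀ j : ℕ, node (μ₁ + μ₂) (2 * m + 1) - node (μ₁ + μ₂) (2 * j + 1) =
        -m + j := fun j => by
      rw [node_of_not_even _ (not_even_add_one (even_two_mul m)),
        node_of_not_even _ (not_even_add_one (even_two_mul j))]; push_cast; ring
    rw [sum_range_two_mul_add_two, show (2 * m + 1) / 2 = m by omega,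
      show (2 * m + 1) % 2 = 1 by omega,
      hypergeom43_neg_nat]
    congr 1
    · refine Finset.sum_congr rfl fun j hj => ?_
      clear hj
      induction j with
      | zero => rw [term43_zero, mul_zero, biTerm_zero]
      | succ j ih =>
        rw [term43_succ, show 2 * (j + 1) = 2 * j + 1 + 1 by ring, biTerm_succ, biTerm_succ, ih,
          hz0, hz1, hg0, hg1, bracket_odd, hb1, xNode_even, xNode_odd, hs1 j,
          (even_two_mul j).neg_one_pow]
        simp only [mul_inv, inv_neg]
        ring
    · rw [show -(m : ℝ) - ((1 : ℕ) : ℝ) + 1 = -(m : ℝ) by push_cast; ring,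
        hypergeom43_neg_nat, Finset.mul_sum]
      refine Finset.sum_congr rfl fun j hj => ?_
      clear hj
      induction j with
      | zero =>
        have h0 := hz0 0
        have h1 := hg0 0
        have h2 := bracket_odd μ₂ 0
        have h3 := xNode_even μ₂ μ₃ 0
        rw [term43_zero, biTerm_succ, biTerm_zero, h0, h1, h2, h3, mul_zero,
          (odd_two_mul_add_one m).neg_one_pow]
        simp only [mul_inv, div_eq_mul_inv]
        push_cast
        ring
      | succ j ih =>
        have h0 := hz0 (j + 1)
        have h1 := hg0 (j + 1)
        have h2 := bracket_odd μ₂ (j + 1)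
        have h3 := xNode_even μ₂ μ₃ (j + 1)
        rw [show 2 * (j + 1) = 2 * j + 1 + 1 by ring] at h0 h1 h2 h3 ⊢
        rw [term43_succ, biTerm_succ, biTerm_succ, ← mul_assoc, ih, h0, h1, h2, h3, hz1, hg1, hb1,
          xNode_odd, hs2 j, hs1 j]
        push_cast
        rw [show μ₂ + 3 / 2 + (j : ℝ) = (j : ℝ) + 1 + (μ₂ + 1 / 2) by ring,
          show C + 3 / 2 + (j : ℝ) = C + 1 / 2 + ((j : ℝ) + 1) by ring]
        simp only [mul_inv, inv_neg]
        ring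

/-! ### Big -1 Jacobi polynomials as coupled polynomials -/

/-- The `k`-th term of a `₂F₁`. -/
def term21 (a b c z : ℝ) (k : ℕ) : ℝ :=
  poch a k * poch b k / (poch c k * (k.factorial : ℝ)) * z ^ k

lemma term21_zero (a b c z : ℝ) : term21 a b c z 0 = 1 := by simp [term21, poch_zero]

lemma term21_succ (a b c z : ℝ) (k : ℕ) :
    term21 a b c z (k + 1) =
      term21 a b c z k * ((a + k) * (b + k) * ((c + k) * (k + 1))⁻¹ * z) := by
  simp only [term21, poch_succ, Nat.factorial_succ, div_eq_mul_inv]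
  push_cast
  simp only [mul_inv]
  ring

lemma ordinaryHypergeometric_neg_nat (m : ℕ) (b c z : ℝ) :
    ordinaryHypergeometric (-(m : ℝ)) b c z =
      ∑ k ∈ Finset.range (m + 1), term21 (-(m : ℝ)) b c z k := by
  rw [ordinaryHypergeometric_eq_tsum]
  dsimp only
  rw [tsum_eq_sum (s := Finset.range (m + 1))]
  · refine Finset.sum_congr rfl fun k _ => ?_
    simp only [term21, poch, smul_eq_mul, div_eq_mul_inv, mul_inv]
    ring
  · intro k hk
    have h : m < k := by simpa using hk
    have := poch_neg_eq_zero h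
    rw [poch] at this
    rw [this]; simp

/-- The `j`-th term of the Big -1 Jacobi polynomial as one sum, whose terms of even and odd index
are those of the two `₂F₁` series. -/
def jacobiTerm (μ₁ μ₂ : ℝ) (n : ℕ) (c x y : ℝ) (j : ℕ) : ℝ :=
  jacobiCoeff μ₁ μ₂ n j * (signedPow j x y / signedPow j c y)

lemma jacobiTerm_zero (μ₁ μ₂ : ℝ) (n : ℕ) (c x y : ℝ) : jacobiTerm μ₁ μ₂ n c x y 0 = 1 := by
  simp [jacobiTerm, jacobiCoeff_zero, signedPow_zero]

lemma jacobiTerm_succ (μ₁ μ₂ : ℝ) (n : ℕ) (c x y : ℝ) (j : ℕ) :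
    jacobiTerm μ₁ μ₂ n c x y (j + 1) = jacobiTerm μ₁ μ₂ n c x y j *
      ((-1) ^ (n + j) * bracket (coupledMu μ₁ μ₂ j) (n - j) * (bracket μ₂ (j + 1))⁻¹ *
        ((y - (-1) ^ j * x) * (y - (-1) ^ j * c)⁻¹)) := by
  simp only [jacobiTerm, jacobiCoeff_succ, signedPow_succ, div_eq_mul_inv, mul_inv]; ring

lemma jacobiTerm_even_succ (μ₁ μ₂ : ℝ) {m i : ℕ} (hi : i < m) (c x y : ℝ) :
    jacobiTerm μ₁ μ₂ (2 * m) c x y (2 * i + 1) = jacobiTerm μ₁ μ₂ (2 * m) c x y (2 * i) *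
      ((m - i) * ((i : ℝ) + (μ₂ + 1 / 2))⁻¹ * ((y - x) * (y - c)⁻¹)) := by
  obtain ⟨d, rfl⟩ := Nat.exists_eq_add_of_lt hi
  rw [jacobiTerm_succ, ← mul_add, (even_two_mul _).neg_one_pow, (even_two_mul _).neg_one_pow,
    show 2 * (i + d + 1) - 2 * i = 2 * (d + 1) by omega, bracket_even, bracket_odd]
  push_cast; ring

lemma jacobiTerm_even_succ_succ (μ₁ μ₂ : ℝ) {m i : ℕ} (hi : i < m) (c x y : ℝ) :
    jacobiTerm μ₁ μ₂ (2 * m) c x y (2 * i + 1 + 1) = jacobiTerm μ₁ μ₂ (2 * m) c x y (2 * i + 1) *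
      (-(m + μ₁ + μ₂ + 1 + i) * ((i : ℝ) + 1)⁻¹ * ((y + x) * (y + c)⁻¹)) := by
  obtain ⟨d, rfl⟩ := Nat.exists_eq_add_of_lt hi
  rw [jacobiTerm_succ, ← add_assoc, ← mul_add, (odd_two_mul_add_one _).neg_one_pow,
    (odd_two_mul_add_one _).neg_one_pow,
    show 2 * (i + d + 1) - (2 * i + 1) = 2 * d + 1 by omega, bracket_odd,
    show 2 * i + 1 + 1 = 2 * (i + 1) by ring, bracket_even, coupledMu]
  push_cast; ring

lemma jacobiTerm_odd_succ (μ₁ μ₂ : ℝ) {m i : ℕ} (hi : i ≤ m) (c x y : ℝ) :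
    jacobiTerm μ₁ μ₂ (2 * m + 1) c x y (2 * i + 1) = jacobiTerm μ₁ μ₂ (2 * m + 1) c x y (2 * i) *
      (-(m + μ₁ + μ₂ + 1 + i) * ((i : ℝ) + (μ₂ + 1 / 2))⁻¹ * ((y - x) * (y - c)⁻¹)) := by
  obtain ⟨d, rfl⟩ := Nat.exists_eq_add_of_le hi
  rw [jacobiTerm_succ, show 2 * (i + d) + 1 + 2 * i = 2 * (i + d + i) + 1 by ring,
    (odd_two_mul_add_one _).neg_one_pow, (even_two_mul _).neg_one_pow,
    show 2 * (i + d) + 1 - 2 * i = 2 * d + 1 by omega, bracket_odd, bracket_odd, coupledMu]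
  push_cast; ring

lemma jacobiTerm_odd_succ_succ (μ₁ μ₂ : ℝ) {m i : ℕ} (hi : i < m) (c x y : ℝ) :
    jacobiTerm μ₁ μ₂ (2 * m + 1) c x y (2 * i + 1 + 1) =
      jacobiTerm μ₁ μ₂ (2 * m + 1) c x y (2 * i + 1) *
        ((m - i) * ((i : ℝ) + 1)⁻¹ * ((y + x) * (y + c)⁻¹)) := by
  obtain ⟨d, rfl⟩ := Nat.exists_eq_add_of_lt hi
  rw [jacobiTerm_succ, show 2 * (i + d + 1) + 1 + (2 * i + 1) = 2 * (i + d + 1 + i + 1) by ring,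
    (even_two_mul _).neg_one_pow, (odd_two_mul_add_one _).neg_one_pow,
    show 2 * (i + d + 1) + 1 - (2 * i + 1) = 2 * (d + 1) by omega, bracket_even,
    show 2 * i + 1 + 1 = 2 * (i + 1) by ring, bracket_even]
  push_cast; ring

theorem bigJacobi_eq_sum (μ₁ μ₂ : ℝ) (n : ℕ) (c x : ℝ) {y : ℝ} (hy : y ≠ 0) :
    bigJacobi n (x / y) (2 * μ₂) (2 * μ₁) (-(c / y)) =
      ∑ j ∈ Finset.range (n + 1), jacobiTerm μ₁ μ₂ n c x y j := by
  have hz : (1 - (x / y) ^ 2) / (1 - (-(c / y)) ^ 2) =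
      (y - x) * (y - c)⁻¹ * ((y + x) * (y + c)⁻¹) := by
    rw [show 1 - (x / y) ^ 2 = (y - x) * (y + x) / y ^ 2 by field_simp; ring,
      show 1 - (-(c / y)) ^ 2 = (y - c) * (y + c) / y ^ 2 by field_simp; ring,
      div_div_div_cancel_right₀ (by positivity), div_eq_mul_inv, mul_inv]
    ring
  have h1 : (1 - x / y) = (y - x) * y⁻¹ := by field_simp
  have h2 : (1 + -(c / y))⁻¹ = (y - c)⁻¹ * y := by
    rw [show 1 + -(c / y) = (y - c) * y⁻¹ by field_simp; ring, mul_inv, inv_inv]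
  have h3 : (2 * μ₂ + 1)⁻¹ = (μ₂ + 1 / 2)⁻¹ * 2⁻¹ := by rw [← mul_inv]; ring_nf
  have hyy : y⁻¹ * y = 1 := inv_mul_cancel₀ hy
  rw [bigJacobi, hz, show (2 * μ₂ + 1) / 2 = μ₂ + 1 / 2 by ring,
    show (2 * μ₂ + 3) / 2 = μ₂ + 3 / 2 by ring]
  have h4 : ∀ i : ℕ, μ₂ + 3 / 2 + (i : ℝ) = (i : ℝ) + 1 + (μ₂ + 1 / 2) := fun i => by ring
  rcases Nat.even_or_odd' n with ⟨m, rfl | rfl⟩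
  · rw [if_pos (even_two_mul m), sum_range_two_mul_add_one,
      show -((2 * m : ℕ) : ℝ) / 2 = -(m : ℝ) by push_cast; ring,
      show (((2 * m : ℕ) : ℝ) + 2 * μ₂ + 2 * μ₁ + 2) / 2 = m + μ₁ + μ₂ + 1 by push_cast; ring,
      ordinaryHypergeometric_neg_nat]
    congr 1
    · refine Finset.sum_congr rfl fun j hj => ?_
      rw [Finset.mem_range, Nat.lt_succ_iff] at hj
      induction j with
      | zero => rw [term21_zero, mul_zero, jacobiTerm_zero]
      | succ j ih =>
        rw [term21_succ, ih (by omega), show 2 * (j + 1) = 2 * j + 1 + 1 by ring,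
          jacobiTerm_even_succ_succ _ _ hj, jacobiTerm_even_succ _ _ hj, mul_inv]
        ring
    · rcases m with _ | m
        -- for `n = 0` the vanishing prefactor removes the second series, which does not terminate
      · simp
      · rw [show (1 : ℝ) - ((2 * (m + 1) : ℕ) : ℝ) / 2 = -(m : ℝ) by push_cast; ring,
          ordinaryHypergeometric_neg_nat, Finset.mul_sum]
        refine Finset.sum_congr rfl fun j hj => ?_
        rw [Finset.mem_range] at hj
        induction j with
        | zero =>
          rw [term21_zero, jacobiTerm_even_succ _ _ hj, mul_zero, jacobiTerm_zero, h1,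
            div_eq_mul_inv, mul_inv, h2, h3]
          push_cast
          rw [zero_add]
          linear_combination ((m : ℝ) + 1) * (y - x) * (y - c)⁻¹ * (μ₂ + 1 / 2)⁻¹ * hyy
        | succ j ih =>
          have hj' : j < m + 1 := by omega
          rw [term21_succ, ← mul_assoc, ih hj', show 2 * (j + 1) + 1 = 2 * (j + 1) + 1 from rfl,
            jacobiTerm_even_succ _ _ hj, show 2 * (j + 1) = 2 * j + 1 + 1 by ring,
            jacobiTerm_even_succ_succ _ _ hj', h4, mul_inv]
          push_cast
          ring
  · rw [if_neg (not_even_add_one (even_two_mul m)), sum_range_two_mul_add_two,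
      show -(((2 * m + 1 : ℕ) : ℝ) - 1) / 2 = -(m : ℝ) by push_cast; ring,
      show (((2 * m + 1 : ℕ) : ℝ) + 2 * μ₂ + 2 * μ₁ + 1) = 2 * (m + μ₁ + μ₂ + 1) by
        push_cast; ring,
      show (((2 * m + 1 : ℕ) : ℝ) + 2 * μ₂ + 2 * μ₁ + 3) / 2 = m + μ₁ + μ₂ + 2 by
        push_cast; ring,
      mul_div_cancel_left₀ _ (two_ne_zero' ℝ), sub_eq_add_neg,
      ordinaryHypergeometric_neg_nat, ordinaryHypergeometric_neg_nat]
    congr 1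
    · refine Finset.sum_congr rfl fun j hj => ?_
      rw [Finset.mem_range, Nat.lt_succ_iff] at hj
      induction j with
      | zero => rw [term21_zero, mul_zero, jacobiTerm_zero]
      | succ j ih =>
        rw [term21_succ, ih (by omega), show 2 * (j + 1) = 2 * j + 1 + 1 by ring,
          jacobiTerm_odd_succ_succ _ _ hj, jacobiTerm_odd_succ _ _ (by omega), mul_inv]
        ring
    · rw [← neg_mul, Finset.mul_sum]
      refine Finset.sum_congr rfl fun j hj => ?_
      rw [Finset.mem_range, Nat.lt_succ_iff] at hj
      induction j with
      | zero =>
        rw [term21_zero, jacobiTerm_odd_succ _ _ hj, mul_zero, jacobiTerm_zero, h1,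
          div_eq_mul_inv, mul_inv, h2, h3]
        push_cast
        rw [zero_add]
        linear_combination
          -((m : ℝ) + μ₁ + μ₂ + 1) * (y - x) * (y - c)⁻¹ * (μ₂ + 1 / 2)⁻¹ * hyy
      | succ j ih =>
        rw [term21_succ, ← mul_assoc, ih (by omega),
          jacobiTerm_odd_succ _ _ hj, show 2 * (j + 1) = 2 * j + 1 + 1 by ring,
          jacobiTerm_odd_succ_succ _ _ hj, h4, mul_inv]
        push_cast
        ring

lemma signedPow_add (j k : ℕ) (x y : ℝ) :
    signedPow (j + k) x y = signedPow j x y * signedPow k ((-1) ^ j * x) y := by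
  induction k with
  | zero => simp [signedPow_zero]
  | succ k ih => rw [← add_assoc, signedPow_succ, signedPow_succ, ih, pow_add]; ring

lemma signedPow_ne_zero (n : ℕ) {c y : ℝ} (h : |c| < |y|) : signedPow n c y ≠ 0 := by
  refine Finset.prod_ne_zero_iff.2 fun t _ h0 => ?_
  rw [sub_eq_zero.1 h0, abs_mul, abs_pow, abs_neg, abs_one, one_pow, one_mul] at h
  exact lt_irrefl _ h

theorem signedPow_mul_bigJacobi {μ₁ μ₂ : ℝ} (h₁ : 0 < μ₁ + 1 / 2) (h₂ : 0 < μ₂ + 1 / 2) (n : ℕ)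
    {c y : ℝ} (h : |c| < |y|) (x : ℝ) :
    signedPow n c y * bigJacobi n (x / y) (2 * μ₂) (2 * μ₁) (-(c / y)) =
      bracketFactorial μ₁ n * coupledPoly μ₁ μ₂ n c x y := by
  have hy : y ≠ 0 := abs_pos.1 ((abs_nonneg c).trans_lt h)
  rw [bigJacobi_eq_sum _ _ _ _ _ hy, ← sum_jacobiCoeff_mul_signedPow h₁ h₂, Finset.mul_sum]
  refine Finset.sum_congr rfl fun j hj => ?_
  obtain ⟨d, rfl⟩ := Nat.exists_eq_add_of_le (Nat.lt_succ_iff.1 (Finset.mem_range.1 hj))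
  have := signedPow_ne_zero j h
  rw [Nat.add_sub_cancel_left, signedPow_add, jacobiTerm]
  field_simp

/-! ### The normalisation of the Big -1 Jacobi polynomials -/

lemma poch_pos {a : ℝ} (ha : 0 < a) (n : ℕ) : 0 < poch a n := ascPochhammer_pos n a ha

lemma poch_succ_left (a : ℝ) (n : ℕ) : poch a (n + 1) = a * poch (a + 1) n := by
  simp [poch, ascPochhammer_succ_left, Polynomial.eval_comp]

lemma Gamma_add_nat {a : ℝ} (ha : 0 < a) (n : ℕ) :
    Real.Gamma (a + n) = poch a n * Real.Gamma a := by
  induction n with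
  | zero => simp [poch_zero]
  | succ n ih =>
    rw [Nat.cast_succ, ← add_assoc, Real.Gamma_add_one (by positivity), ih, poch_succ]; ring

lemma bracketFactorial_even (μ : ℝ) (m : ℕ) :
    bracketFactorial μ (2 * m) = (m.factorial : ℝ) * poch (μ + 1 / 2) m := by
  induction m with
  | zero => simp [bracketFactorial_zero, poch_zero]
  | succ m ih =>
    have := bracket_even μ (m + 1)
    rw [show 2 * (m + 1) = 2 * m + 1 + 1 by ring] at this ⊢
    rw [bracketFactorial_succ, bracketFactorial_succ, ih, bracket_odd, this, poch_succ,
      Nat.factorial_succ]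
    push_cast; ring

lemma bracketFactorial_odd (μ : ℝ) (m : ℕ) :
    bracketFactorial μ (2 * m + 1) = (m.factorial : ℝ) * poch (μ + 1 / 2) (m + 1) := by
  rw [bracketFactorial_succ, bracketFactorial_even, bracket_odd, poch_succ]; ring

/-- The closed form `⌊n/2⌋! (ν + ⌊n/2⌋ + 1)_⌈n/2⌉` of `∏_{t < n} [n - t]_{ν + t + 1/2}`, the
product of brackets that enters the norm of the coupled polynomials. -/
def normProd (ν : ℝ) (n : ℕ) : ℝ :=
  ((n / 2).factorial : ℝ) * poch (ν + (n / 2 : ℕ) + 1) (n / 2 + n % 2)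

lemma normProd_even (ν : ℝ) (m : ℕ) :
    normProd ν (2 * m) = (m.factorial : ℝ) * poch (ν + m + 1) m := by
  rw [normProd, Nat.mul_div_cancel_left _ two_pos, Nat.mul_mod_right, add_zero]

lemma normProd_odd (ν : ℝ) (m : ℕ) :
    normProd ν (2 * m + 1) = (m.factorial : ℝ) * poch (ν + m + 1) (m + 1) := by
  rw [normProd, show (2 * m + 1) / 2 = m by omega, show (2 * m + 1) % 2 = 1 by omega]

lemma normProd_pos {ν : ℝ} (hν : 0 < ν) (n : ℕ) : 0 < normProd ν n := by
  have := poch_pos (show 0 < ν + (n / 2 : ℕ) + 1 by positivity) (n / 2 + n % 2)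
  unfold normProd; positivity

lemma normProd_succ_left (ν : ℝ) (n : ℕ) :
    normProd ν (n + 1) = bracket (ν + 1 / 2) (n + 1) * normProd (ν + 1) n := by
  rcases Nat.even_or_odd' n with ⟨m, rfl | rfl⟩
  · rw [normProd_odd, normProd_even, bracket_odd, poch_succ_left,
      show ν + 1 + (m : ℝ) + 1 = ν + m + 1 + 1 by ring]
    ring
  · have h := bracket_even (ν + 1 / 2) (m + 1)
    have h' := normProd_even ν (m + 1)
    rw [show 2 * (m + 1) = 2 * m + 1 + 1 by ring] at h h'
    rw [normProd_odd, h, h', Nat.factorial_succ]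
    push_cast
    rw [show ν + 1 + (m : ℝ) + 1 = ν + (m + 1) + 1 by ring]
    ring

lemma normProd_succ_of_even (ν : ℝ) {n : ℕ} (h : Even n) :
    normProd ν (n + 1) = normProd ν n * (ν + n + 1) := by
  obtain ⟨m, rfl⟩ := even_iff_exists_two_mul.1 h
  rw [normProd_odd, normProd_even, poch_succ]
  push_cast; ring

lemma normProd_succ_of_odd (ν : ℝ) {n : ℕ} (h : ¬ Even n) :
    normProd ν (n + 1) * (ν + ((n : ℝ) + 1) / 2) =
      normProd ν n * (((n : ℝ) + 1) / 2 * (ν + n + 1)) := by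
  obtain ⟨m, rfl⟩ := (Nat.not_even_iff_odd.1 h)
  have h' := normProd_even ν (m + 1)
  rw [show 2 * (m + 1) = 2 * m + 1 + 1 by ring] at h'
  rw [h', normProd_odd, poch_succ_left (ν + m + 1), poch_succ, Nat.factorial_succ]
  push_cast
  rw [show ν + ((m : ℝ) + 1) + 1 = ν + m + 1 + 1 by ring]
  ring

lemma Gamma_mul_Gamma_div_bigJacobiNorm {μ₁ μ₂ : ℝ} (h₁ : 0 < μ₁) (h₂ : 0 < μ₂) (n : ℕ) :
    Real.Gamma (μ₁ + 1 / 2) * Real.Gamma (μ₂ + 1 / 2) /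
      (Real.Gamma (coupledMu μ₁ μ₂ n + 1 / 2) * bigJacobiNorm n (2 * μ₂) (2 * μ₁)) =
      bracketFactorial μ₂ n / (bracketFactorial μ₁ n * normProd (μ₁ + μ₂) n) := by
  have g1 := (Real.Gamma_pos_of_pos (show 0 < μ₁ + 1 / 2 by positivity)).ne'
  have g2 := (Real.Gamma_pos_of_pos (show 0 < μ₂ + 1 / 2 by positivity)).ne'
  rcases Nat.even_or_odd' n with ⟨m, rfl | rfl⟩
  · have g3 := (Real.Gamma_pos_of_pos (show 0 < μ₁ + μ₂ + m + 1 by positivity)).ne'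
    have p1 := (poch_pos (show 0 < μ₁ + 1 / 2 by positivity) m).ne'
    have p2 := (poch_pos (show 0 < μ₂ + 1 / 2 by positivity) m).ne'
    have p3 := (poch_pos (show 0 < μ₁ + μ₂ + m + 1 by positivity) m).ne'
    have f := Nat.cast_ne_zero (R := ℝ).2 m.factorial_ne_zero
    have d : (μ₂ + 1 / 2 + (m : ℝ)) ≠ 0 := by positivity
    rw [bigJacobiNorm, if_pos (even_two_mul m), Nat.mul_div_cancel_left _ two_pos, normProd_even,
      bracketFactorial_even, bracketFactorial_even, coupledMu]
    push_cast
    rw [show μ₁ + μ₂ + 2 * (m : ℝ) + 1 / 2 + 1 / 2 = μ₁ + μ₂ + m + 1 + m by ring,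
      show (2 * (m : ℝ) + 2 * μ₁ + 1) / 2 = μ₁ + 1 / 2 + m by ring,
      show (2 * (m : ℝ) + 2 * μ₂ + 3) / 2 = μ₂ + 1 / 2 + m + 1 by ring,
      show (2 * (m : ℝ) + 2 * μ₂ + 2 * μ₁ + 2) / 2 = μ₁ + μ₂ + m + 1 by ring,
      show 2 * (m : ℝ) + 2 * μ₂ + 1 = 2 * (μ₂ + 1 / 2 + m) by ring,
      show (2 * μ₂ + 1) / 2 = μ₂ + 1 / 2 by ring,
      Real.Gamma_add_one d, Gamma_add_nat (by positivity), Gamma_add_nat (by positivity),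
      Gamma_add_nat (by positivity)]
    generalize Real.Gamma (μ₁ + 1 / 2) = x1 at *
    generalize Real.Gamma (μ₂ + 1 / 2) = x2 at *
    generalize Real.Gamma (μ₁ + μ₂ + m + 1) = x3 at *
    generalize poch (μ₁ + 1 / 2) m = y1 at *
    generalize poch (μ₂ + 1 / 2) m = y2 at *
    generalize poch (μ₁ + μ₂ + m + 1) m = y3 at *
    generalize μ₂ + 1 / 2 + (m : ℝ) = d1 at *
    field_simp
  · have g3 := (Real.Gamma_pos_of_pos (show 0 < μ₁ + μ₂ + m + 1 by positivity)).ne'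
    have p1 := (poch_pos (show 0 < μ₁ + 1 / 2 by positivity) (m + 1)).ne'
    have p2 := (poch_pos (show 0 < μ₂ + 1 / 2 by positivity) (m + 1)).ne'
    have p3 := (poch_pos (show 0 < μ₁ + μ₂ + m + 1 by positivity) (m + 1)).ne'
    have f := Nat.cast_ne_zero (R := ℝ).2 m.factorial_ne_zero
    have d : (μ₁ + μ₂ + (m : ℝ) + 1) ≠ 0 := by positivity
    have c1 := Gamma_add_nat (show 0 < μ₁ + 1 / 2 by positivity) (m + 1)
    have c2 := Gamma_add_nat (show 0 < μ₂ + 1 / 2 by positivity) (m + 1)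
    have c3 := Gamma_add_nat (show 0 < μ₁ + μ₂ + m + 1 by positivity) (m + 1)
    push_cast at c1 c2 c3
    rw [bigJacobiNorm, if_neg (not_even_add_one (even_two_mul m)), normProd_odd,
      show (2 * m + 1 - 1) / 2 = m by omega, show (2 * m + 1 + 1) / 2 = m + 1 by omega,
      bracketFactorial_odd, bracketFactorial_odd, coupledMu]
    push_cast
    rw [show μ₁ + μ₂ + (2 * (m : ℝ) + 1) + 1 / 2 + 1 / 2 = μ₁ + μ₂ + m + 1 + (m + 1) by ring,
      show (2 * (m : ℝ) + 1 + 2 * μ₁ + 2) / 2 = μ₁ + 1 / 2 + (m + 1) by ring,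
      show (2 * (m : ℝ) + 1 + 2 * μ₂ + 2) / 2 = μ₂ + 1 / 2 + (m + 1) by ring,
      show (2 * (m : ℝ) + 1 + 2 * μ₂ + 2 * μ₁ + 3) / 2 = μ₁ + μ₂ + m + 1 + 1 by ring,
      show 2 * (m : ℝ) + 1 + 2 * μ₂ + 2 * μ₁ + 1 = 2 * (μ₁ + μ₂ + m + 1) by ring,
      show (2 * μ₂ + 1) / 2 = μ₂ + 1 / 2 by ring,
      Real.Gamma_add_one d, c1, c2, c3]
    clear c1 c2 c3
    generalize Real.Gamma (μ₁ + 1 / 2) = x1 at *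
    generalize Real.Gamma (μ₂ + 1 / 2) = x2 at *
    generalize Real.Gamma (μ₁ + μ₂ + m + 1) = x3 at *
    generalize poch (μ₁ + 1 / 2) (m + 1) = y1 at *
    generalize poch (μ₂ + 1 / 2) (m + 1) = y2 at *
    generalize poch (μ₁ + μ₂ + m + 1) (m + 1) = y3 at *
    generalize μ₁ + μ₂ + (m : ℝ) + 1 = d1 at *
    field_simp

/-- The squared factor between `coupledPoly` and the normalised Big -1 Jacobi polynomial. -/
def coupledNorm (μ₁ μ₂ : ℝ) (n : ℕ) : ℝ :=
  bracketFactorial μ₁ n * bracketFactorial μ₂ n / (2 ^ n * normProd (μ₁ + μ₂) n)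

lemma coupledNorm_pos {μ₁ μ₂ : ℝ} (h₁ : 0 < μ₁) (h₂ : 0 < μ₂) (n : ℕ) :
    0 < coupledNorm μ₁ μ₂ n := by
  have := bracketFactorial_pos (μ := μ₁) (by linarith) n
  have := bracketFactorial_pos (μ := μ₂) (by linarith) n
  have := normProd_pos (add_pos h₁ h₂) n
  unfold coupledNorm; positivity

lemma abs_signedPow (n : ℕ) {c y : ℝ} (h : |c| < |y|) :
    |signedPow n c y| = Real.sign y ^ n * signedPow n c y := by
  induction n with
  | zero => simp [signedPow_zero]
  | succ n ih =>
    rw [signedPow_succ, abs_mul, ih, pow_succ]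
    have h' : |(-1) ^ n * c| < |y| := by simpa [abs_mul] using h
    generalize (-1) ^ n * c = a at *
    have : |y - a| = Real.sign y * (y - a) := by
      rcases lt_or_ge y 0 with hy | hy
      · rw [abs_of_neg hy] at h'
        rw [Real.sign_of_neg hy, abs_of_neg (by linarith [neg_abs_le a])]; ring
      · rw [abs_of_nonneg hy] at h'
        rw [Real.sign_of_pos ((abs_nonneg a).trans_lt h'),
          abs_of_pos (by linarith [le_abs_self a])]; ring
    rw [this]; ring

lemma signedPow_sq (n : ℕ) {c y : ℝ} (h : |c| < |y|) :
    signedPow n c y ^ 2 = (y ^ 2 - c ^ 2) ^ n * ((y - c) / (y - (-1) ^ n * c)) := by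
  have hp : y + c ≠ 0 := by
    intro h0
    rw [show y = -c by linarith, abs_neg] at h
    exact lt_irrefl _ h
  have hm : y - c ≠ 0 := by
    intro h0
    rw [show y = c by linarith] at h
    exact lt_irrefl _ h
  induction n with
  | zero => simp [signedPow_zero, hm]
  | succ n ih =>
    rw [signedPow_succ, mul_pow, ih]
    rcases Nat.even_or_odd n with hn | hn
    · rw [hn.neg_one_pow, hn.add_one.neg_one_pow, show y - -1 * c = y + c by ring]
      field_simp
      ring
    · rw [hn.neg_one_pow, hn.add_one.neg_one_pow, show y - -1 * c = y + c by ring]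
      field_simp
      ring

/-- The normalised Big -1 Jacobi polynomial is a multiple of `coupledPoly`. The sign of `y` appears
because the square root in `couplingK` is the absolute value of `signedPow`. -/
theorem couplingK_mul_bigJacobi {μ₁ μ₂ : ℝ} (h₁ : 0 < μ₁) (h₂ : 0 < μ₂) {ε₁ ε₂ : ℝ}
    (hε₁ : ε₁ ^ 2 = 1) (hε₂ : ε₂ ^ 2 = 1) (n : ℕ) {c y : ℝ} (h : |c| < |y|) (x : ℝ) :
    couplingK n y μ₂ μ₁ c ε₂ ε₁ *
      bigJacobi n (x / y) (2 * μ₂) (2 * μ₁) (-(c * ε₁ * ε₂ / y)) =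
      Real.sign y ^ n * Real.sqrt (coupledNorm μ₁ μ₂ n) *
        coupledPoly μ₁ μ₂ n (c * ε₁ * ε₂) x y := by
  have hc2 : (c * ε₁ * ε₂) ^ 2 = c ^ 2 := by rw [mul_pow, mul_pow, hε₁, hε₂]; ring
  have h' : |c * ε₁ * ε₂| < |y| := by rwa [(sq_eq_sq_iff_abs_eq_abs _ _).1 hc2]
  have key := signedPow_mul_bigJacobi (μ₁ := μ₁) (μ₂ := μ₂) (by linarith) (by linarith) n h' x
  have hb1 := bracketFactorial_pos (μ := μ₁) (by linarith) n
  have hb2 := bracketFactorial_pos (μ := μ₂) (by linarith) n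
  have hz := normProd_pos (add_pos h₁ h₂) n
  have hK : couplingK n y μ₂ μ₁ c ε₂ ε₁ = Real.sqrt (coupledNorm μ₁ μ₂ n) *
      (Real.sign y ^ n * signedPow n (c * ε₁ * ε₂) y / bracketFactorial μ₁ n) := by
    have habs : Real.sign y ^ n * signedPow n (c * ε₁ * ε₂) y / bracketFactorial μ₁ n =
        Real.sqrt ((signedPow n (c * ε₁ * ε₂) y / bracketFactorial μ₁ n) ^ 2) := by
      rw [Real.sqrt_sq_eq_abs, abs_div, abs_signedPow n h', abs_of_pos hb1]
    rw [couplingK, Gamma_mul_Gamma_div_bigJacobiNorm h₁ h₂, habs,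
      ← Real.sqrt_mul (coupledNorm_pos h₁ h₂ n).le,
      div_pow (signedPow n (c * ε₁ * ε₂) y), signedPow_sq n h', hc2, coupledNorm, div_pow]
    rw [show (-1 : ℝ) ^ n * c * ε₁ * ε₂ = (-1) ^ n * (c * ε₁ * ε₂) by ring]
    congr 1
    field_simp
  rw [hK]
  generalize bigJacobi n (x / y) (2 * μ₂) (2 * μ₁) (-(c * ε₁ * ε₂ / y)) = J at *
  field_simp
  linear_combination Real.sqrt (coupledNorm μ₁ μ₂ n) * Real.sign y ^ n * key

/-! ### Recurrences of the Bannai-Ito weights and norms -/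

lemma stepUp_even (μ₁ μ₂ μ₃ : ℝ) (N j : ℕ) : stepUp μ₁ μ₂ μ₃ N (2 * j) =
    -((j + (μ₂ + 1 / 2)) * dualGap μ₁ μ₂ μ₃ N (2 * j)) / (2 * j + (μ₁ + μ₂) + 1) := by
  rw [stepUp, if_pos (even_two_mul j), bracket_odd, dualGap, if_pos (even_two_mul j)]
  push_cast; ring

lemma stepUp_odd (μ₁ μ₂ μ₃ : ℝ) (N j : ℕ) : stepUp μ₁ μ₂ μ₃ N (2 * j + 1) =
    (j + 1 + (μ₁ + μ₂)) * dualGap μ₁ μ₂ μ₃ N (2 * j + 1) / (2 * j + (μ₁ + μ₂) + 2) := by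
  have h := not_even_add_one (even_two_mul j)
  rw [stepUp, if_neg h, dualGap, if_neg h]
  push_cast
  rw [show 2 * (j : ℝ) + (μ₁ + μ₂) + 2 = 2 * j + 1 + μ₁ + μ₂ + 1 by ring]
  ring

lemma poch_add_one_mul (a : ℝ) (n : ℕ) : poch (a + 1) n * a = poch a n * (a + n) := by
  rw [← poch_succ, poch_succ_left]; ring

/-- The `η_n` are the products of the rates `stepUp`, since `η_n` makes the polynomials monic. -/
lemma bannaiItoEta_succ {μ₁ μ₂ : ℝ} (h₁ : 0 < μ₁) (h₂ : 0 < μ₂) (μ₃ : ℝ) (N n : ℕ) :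
    bannaiItoEta (n + 1) (racahParams μ₁ μ₂ μ₃ N) =
      bannaiItoEta n (racahParams μ₁ μ₂ μ₃ N) * stepUp μ₁ μ₂ μ₃ N n := by
  rcases Nat.even_or_odd' n with ⟨i, rfl | rfl⟩
  · have hA : (racahParams μ₁ μ₂ μ₃ N).ρ₁ - (racahParams μ₁ μ₂ μ₃ N).r₁ = μ₂ := by
      simp only [racahParams]; ring
    have p := (poch_pos (show 0 < (i : ℝ) + (μ₁ + μ₂) + 1 by positivity) i).ne'
    have d : 2 * (i : ℝ) + (μ₁ + μ₂) + 1 ≠ 0 := by positivity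
    rw [stepUp_even, dualGap_even]
    simp only [bannaiItoEta, racahParams_g, hA, show (2 * i + 1) / 2 = i by omega,
      show (2 * i + 1) % 2 = 1 by omega, show 2 * i / 2 = i by omega,
      show 2 * i % 2 = 0 by omega, add_zero, poch_succ, (even_two_mul i).neg_one_pow,
      (odd_two_mul_add_one i).neg_one_pow]
    rw [show (i : ℝ) + (μ₁ + μ₂) + 1 + i = 2 * (i : ℝ) + (μ₁ + μ₂) + 1 by ring]
    generalize 2 * (i : ℝ) + (μ₁ + μ₂) + 1 = D at *
    field_simp
    ring
  · have hs : (-1 : ℝ) ^ (2 * i + 1 + 1) = 1 := (even_two_mul (i + 1)).neg_one_pow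
    have p := (poch_pos (show 0 < (i : ℝ) + (μ₁ + μ₂) + 1 by positivity) (i + 1)).ne'
    have p' := (poch_pos (show 0 < (i : ℝ) + (μ₁ + μ₂) + 1 + 1 by positivity) (i + 1)).ne'
    have d : 2 * (i : ℝ) + (μ₁ + μ₂) + 2 ≠ 0 := by positivity
    have e := poch_add_one_mul ((i : ℝ) + (μ₁ + μ₂) + 1) (i + 1)
    push_cast at e
    rw [show (i : ℝ) + (μ₁ + μ₂) + 1 + (i + 1) = 2 * (i : ℝ) + (μ₁ + μ₂) + 2 by ring] at e
    rw [stepUp_odd, dualGap_odd]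
    simp only [bannaiItoEta, racahParams_g, show (2 * i + 1) / 2 = i by omega,
      show (2 * i + 1) % 2 = 1 by omega, show (2 * i + 1 + 1) / 2 = i + 1 by omega,
      show (2 * i + 1 + 1) % 2 = 0 by omega, add_zero, hs,
      (odd_two_mul_add_one i).neg_one_pow]
    push_cast
    rw [show (i : ℝ) + 1 + (μ₁ + μ₂) + 1 = (i : ℝ) + (μ₁ + μ₂) + 1 + 1 by ring,
      show (i : ℝ) + 1 + (μ₁ + μ₂) = (i : ℝ) + (μ₁ + μ₂) + 1 by ring,
      poch_succ (1 - (racahParams μ₁ μ₂ μ₃ N).r₁ - (racahParams μ₁ μ₂ μ₃ N).r₂)]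
    generalize poch ((i : ℝ) + (μ₁ + μ₂) + 1 + 1) (i + 1) = X at *
    generalize poch ((i : ℝ) + (μ₁ + μ₂) + 1) (i + 1) = Y at *
    generalize (i : ℝ) + (μ₁ + μ₂) + 1 = E at *
    generalize 2 * (i : ℝ) + (μ₁ + μ₂) + 2 = D at *
    generalize (1 - (racahParams μ₁ μ₂ μ₃ N).r₁ - (racahParams μ₁ μ₂ μ₃ N).r₂) + (i : ℝ) = V
    rw [div_eq_iff p', div_mul_div_comm, div_mul_eq_mul_div, eq_div_iff (mul_ne_zero p d)]
    generalize poch _ (i + 1) = a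
    generalize poch _ (i + 1) = b
    generalize poch _ i = c
    linear_combination (-a * b * c * V) * e

lemma bannaiItoEta_zero (p : BIParams) : bannaiItoEta 0 p = 1 := by
  simp [bannaiItoEta, poch_zero]

lemma bannaiItoWeight_zero (p : BIParams) : bannaiItoWeight 0 p = 1 := by
  simp [bannaiItoWeight, poch_zero]

lemma bannaiItoWeight_odd (i : ℕ) (p : BIParams) :
    bannaiItoWeight (2 * i + 1) p = bannaiItoWeight (2 * i) p *
      ((p.ρ₁ - p.r₁ + 1 / 2 + i) * -(p.ρ₁ - p.r₂ + 1 / 2 + i) /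
        ((p.ρ₁ + p.r₁ + 1 / 2 + i) * (p.ρ₁ + p.r₂ + 1 / 2 + i))) := by
  simp only [bannaiItoWeight, show (2 * i + 1) / 2 = i by omega,
    show (2 * i + 1) % 2 = 1 by omega, show 2 * i / 2 = i by omega,
    show 2 * i % 2 = 0 by omega, add_zero, poch_succ, (even_two_mul i).neg_one_pow,
    (odd_two_mul_add_one i).neg_one_pow, div_eq_mul_inv, mul_inv]
  ring

lemma bannaiItoWeight_even_succ (i : ℕ) (p : BIParams) :
    bannaiItoWeight (2 * i + 1 + 1) p = bannaiItoWeight (2 * i + 1) p *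
      ((2 * p.ρ₁ + 1 + i) * (p.ρ₁ + p.ρ₂ + 1 + i) /
        ((i + 1) * -(p.ρ₁ - p.ρ₂ + 1 + i))) := by
  simp only [bannaiItoWeight, show (2 * i + 1) / 2 = i by omega,
    show (2 * i + 1) % 2 = 1 by omega, show (2 * i + 1 + 1) / 2 = i + 1 by omega,
    show (2 * i + 1 + 1) % 2 = 0 by omega, add_zero]
  rw [poch_succ (p.ρ₁ + p.ρ₂ + 1), poch_succ (2 * p.ρ₁ + 1), poch_succ (p.ρ₁ - p.ρ₂ + 1),
    Nat.factorial_succ, pow_succ _ (2 * i + 1)]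
  push_cast
  simp only [div_eq_mul_inv, mul_inv, inv_neg]
  ring

lemma upRate_div_downRate {μ₁ μ₂ μ₃ : ℝ} (h₁ : 0 < μ₁) (h₂ : 0 < μ₂) (h₃ : 0 < μ₃) {N k : ℕ}
    (hk : k < N) : upRate μ₁ μ₂ μ₃ N k / downRate μ₁ μ₂ μ₃ N (k + 1) =
      stepWeight μ₃ μ₂ k / bracket μ₃ (k + 1) * gaugeRatio μ₃ μ₂ μ₁ N k := by
  have d : (k : ℝ) + μ₃ + μ₂ + 1 ≠ 0 := by positivity
  rw [upRate, downRate, stepUp_mul_gaugeRatio h₃ h₂ h₁ hk.le, stepDown_div_gaugeRatio h₃ h₂ h₁ hk,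
    mul_div_mul_comm, gaugeRatio, ← add_assoc N k 1]
  push_cast
  rw [show (k : ℝ) + 1 + μ₃ + μ₂ = k + μ₃ + μ₂ + 1 by ring, div_div_div_cancel_right₀ d]
  by_cases h : Even (N + k)
  · rw [if_pos h, if_pos h, if_neg (not_even_add_one h),
      show ((N : ℝ) + (k + 1) + 1) / 2 + μ₃ + μ₂ = ((N : ℝ) + k) / 2 + μ₃ + μ₂ + 1 by ring,
      neg_div 2, neg_div_neg_eq]
  · rw [if_neg h, if_neg h, if_pos (even_add_one_of_not h)]
    congr 2; ring

/-- The weights `w_k` are in detailed balance for the rates `upRate` and `downRate`. -/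
lemma bannaiItoWeight_succ {μ₁ μ₂ μ₃ : ℝ} (h₁ : 0 < μ₁) (h₂ : 0 < μ₂) (h₃ : 0 < μ₃) {N k : ℕ}
    (hk : k < N) :
    bannaiItoWeight (k + 1) (racahParams μ₁ μ₂ μ₃ N) =
      bannaiItoWeight k (racahParams μ₁ μ₂ μ₃ N) *
        (upRate μ₁ μ₂ μ₃ N k / downRate μ₁ μ₂ μ₃ N (k + 1)) := by
  rw [upRate_div_downRate h₁ h₂ h₃ hk, gaugeRatio]
  have hs : (-1 : ℝ) ^ N = if Even N then 1 else -1 := by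
    split_ifs with h
    · exact h.neg_one_pow
    · exact (Nat.not_even_iff_odd.1 h).neg_one_pow
  rcases Nat.even_or_odd' k with ⟨i, rfl | rfl⟩
  · rw [bannaiItoWeight_odd, stepWeight, if_pos (even_two_mul i), bracket_odd, mul_div_mul_comm]
    simp only [racahParams, tripleMu, hs, Nat.even_add, even_two_mul i, iff_true]
    push_cast
    split_ifs
    · congr 3 <;> ring
    · rw [← neg_div_neg_eq (-_) _]
      congr 3 <;> ring
  · have h := not_even_add_one (even_two_mul i)
    have hb := bracket_even μ₃ (i + 1)
    rw [show 2 * (i + 1) = 2 * i + 1 + 1 by ring] at hb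
    rw [bannaiItoWeight_even_succ, stepWeight, if_neg h, hb, mul_div_mul_comm]
    simp only [racahParams, tripleMu, hs, Nat.even_add, h, iff_false, ite_not]
    push_cast
    split_ifs
    · congr 3 <;> ring
    · rw [← neg_div_neg_eq _ (-_)]
      congr 3 <;> ring

lemma stepDown_succ (μ₁ μ₂ μ₃ : ℝ) (N n : ℕ) : stepDown μ₁ μ₂ μ₃ N (n + 1) =
    bracket μ₁ (n + 1) / (n + μ₁ + μ₂ + 1) *
      if Even (N + n) then -(((N : ℝ) - n) / 2) else ((N : ℝ) + n) / 2 + μ₁ + μ₂ + μ₃ + 1 := by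
  rw [stepDown_eq, ← add_assoc N n 1]
  push_cast
  rw [show (n : ℝ) + 1 + μ₁ + μ₂ = n + μ₁ + μ₂ + 1 by ring]
  by_cases h : Even (N + n)
  · rw [if_pos h, if_neg (not_even_add_one h)]; ring
  · rw [if_neg h, if_pos (even_add_one_of_not h)]; ring

/-- The norms obey `h_{n+1} / h_n = A_n C_{n+1}` with the coefficients of the three-term
recurrence. -/
lemma bannaiItoNorm_succ {μ₁ μ₂ μ₃ : ℝ} (h₁ : 0 < μ₁) (h₂ : 0 < μ₂) (h₃ : 0 < μ₃) {N n : ℕ}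
    (hn : n < N) :
    bannaiItoNorm (n + 1) N (racahParams μ₁ μ₂ μ₃ N) =
      bannaiItoNorm n N (racahParams μ₁ μ₂ μ₃ N) *
        (stepUp μ₁ μ₂ μ₃ N n * stepDown μ₁ μ₂ μ₃ N (n + 1)) := by
  have hA : 1 / 2 + (racahParams μ₁ μ₂ μ₃ N).ρ₁ - (racahParams μ₁ μ₂ μ₃ N).r₁ = 1 / 2 + μ₂ := by
    simp only [racahParams]; ring
  have hB : 1 / 2 + (racahParams μ₁ μ₂ μ₃ N).ρ₁ + (racahParams μ₁ μ₂ μ₃ N).r₁ = 1 / 2 + μ₃ := by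
    simp only [racahParams]; ring
  have hC : ∀ x : ℝ, x + (racahParams μ₁ μ₂ μ₃ N).ρ₂ - (racahParams μ₁ μ₂ μ₃ N).r₂ = x + μ₁ :=
    fun x => by simp only [racahParams]; ring
  rw [stepUp_eq, stepDown_succ]
  simp only [bannaiItoNorm, racahParams_g, hA, hB, hC]
  rcases Nat.even_or_odd' N with ⟨M, rfl | rfl⟩
  · have hs : (-1 : ℝ) ^ (2 * M) = 1 := (even_two_mul M).neg_one_pow
    simp only [Nat.even_add, even_two_mul M, true_iff,
      show 2 * M / 2 = M by omega]
    rcases Nat.even_or_odd' n with ⟨i, rfl | rfl⟩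
    · obtain ⟨d, rfl⟩ := Nat.exists_eq_add_of_lt (show i < M by omega)
      have hD : 1 / 2 + (racahParams μ₁ μ₂ μ₃ (2 * (i + d + 1))).ρ₂ -
          (racahParams μ₁ μ₂ μ₃ (2 * (i + d + 1))).r₁ + i = 2 * i + d + 2 + μ₁ + μ₂ := by
        simp only [racahParams, tripleMu, hs]; push_cast; ring
      have p1 := (poch_pos (show 0 < 1 + (i : ℝ) + (μ₁ + μ₂) by positivity) i).ne'
      have p2 := (poch_pos (show 0 < 1 / 2 + (i : ℝ) + 1 + μ₁ by positivity) d).ne'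
      have p3 := (poch_pos (show 0 < 1 / 2 + μ₃ by positivity) (d + 1)).ne'
      have q1 : 2 * (i : ℝ) + μ₁ + μ₂ + 1 ≠ 0 := by positivity
      have q2 : 1 / 2 + (i : ℝ) + μ₁ ≠ 0 := by positivity
      simp only [even_two_mul i, if_true, stepWeight, bracket_odd,
        show (2 * i + 1) / 2 = i by omega,
        show (2 * i + 1) % 2 = 1 by omega, show 2 * i / 2 = i by omega,
        show 2 * i % 2 = 0 by omega, add_zero, show i + d + 1 - i = d + 1 by omega,
        Nat.sub_zero, Nat.add_sub_cancel, poch_succ _ i, hD, Nat.cast_zero, Nat.cast_one,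
        poch_succ_left (1 / 2 + (i : ℝ) + μ₁), Nat.factorial_succ d]
      push_cast
      rw [show 1 / 2 + (i : ℝ) + μ₁ + 1 = 1 / 2 + i + 1 + μ₁ by ring,
        show 1 + (i : ℝ) + (μ₁ + μ₂) + i = 2 * i + μ₁ + μ₂ + 1 by ring]
      generalize poch (1 + (i : ℝ) + (μ₁ + μ₂)) i = X at *
      generalize poch (1 / 2 + (i : ℝ) + 1 + μ₁) d = Y at *
      generalize poch (1 / 2 + μ₃) (d + 1) = Z at *
      field_simp
      ring
    · obtain ⟨d, rfl⟩ := Nat.exists_eq_add_of_lt (show i < M by omega)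
      have hD : 1 + (racahParams μ₁ μ₂ μ₃ (2 * (i + d + 1))).ρ₁ +
          (racahParams μ₁ μ₂ μ₃ (2 * (i + d + 1))).ρ₂ + i =
            2 * i + d + 5 / 2 + μ₁ + μ₂ + μ₃ := by
        simp only [racahParams, tripleMu, hs]; push_cast; ring
      have p1 := (poch_pos (show 0 < 1 + (i : ℝ) + (μ₁ + μ₂) by positivity) (i + 1)).ne'
      have p1' := (poch_pos (show 0 < 1 + (i : ℝ) + (μ₁ + μ₂) + 1 by positivity) (i + 1)).ne'
      have p2 := (poch_pos (show 0 < 1 / 2 + (i : ℝ) + 1 + μ₁ by positivity) d).ne'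
      have p3 := (poch_pos (show 0 < 1 / 2 + μ₃ by positivity) d).ne'
      have q1 : 2 * (i : ℝ) + 1 + μ₁ + μ₂ + 1 ≠ 0 := by positivity
      have q2 : 1 + (i : ℝ) + (μ₁ + μ₂) ≠ 0 := by positivity
      have q3 : 1 / 2 + μ₃ + (d : ℝ) ≠ 0 := by positivity
      have e : poch (1 + (i : ℝ) + (μ₁ + μ₂)) (i + 1) =
          poch (1 + (i : ℝ) + (μ₁ + μ₂) + 1) (i + 1) * (1 + (i : ℝ) + (μ₁ + μ₂)) /
            (2 * (i : ℝ) + 1 + μ₁ + μ₂ + 1) := by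
        rw [poch_add_one_mul, eq_div_iff q1]; push_cast; ring
      have hb := bracket_even μ₁ (i + 1)
      rw [show 2 * (i + 1) = 2 * i + 1 + 1 by ring] at hb
      simp only [not_even_add_one (even_two_mul i), if_false, stepWeight, hb,
        show (2 * i + 1) / 2 = i by omega, show (2 * i + 1 + 1) / 2 = i + 1 by omega,
        show (2 * i + 1) % 2 = 1 by omega, show (2 * i + 1 + 1) % 2 = 0 by omega, add_zero,
        show i + d + 1 - i = d + 1 by omega, show i + d + 1 - (i + 1) = d by omega,
        Nat.sub_zero, Nat.add_sub_cancel, poch_succ _ i, hD, Nat.cast_zero, Nat.cast_one,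
        poch_succ_left (1 + (i : ℝ) + (μ₁ + μ₂)) d, Nat.factorial_succ i,
        poch_succ (1 / 2 + μ₃)]
      simp only [← poch_succ _ i]
      rw [e]
      push_cast
      rw [show 1 / 2 + ((i : ℝ) + 1) + μ₁ = 1 / 2 + i + 1 + μ₁ by ring,
        show 1 + ((i : ℝ) + 1) + (μ₁ + μ₂) = 1 + i + (μ₁ + μ₂) + 1 by ring]
      clear e p1
      generalize poch (1 + (i : ℝ) + (μ₁ + μ₂) + 1) (i + 1) = X at *
      generalize poch (1 / 2 + (i : ℝ) + 1 + μ₁) d = Y at *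
      generalize poch (1 / 2 + μ₃) d = Z at *
      field_simp
      ring
  · have hs : (-1 : ℝ) ^ (2 * M + 1) = -1 := (odd_two_mul_add_one M).neg_one_pow
    have hM := not_even_add_one (even_two_mul M)
    simp only [hM, if_false, Nat.even_add (m := 2 * M + 1), false_iff,
      show (2 * M + 1) / 2 = M by omega]
    rcases Nat.even_or_odd' n with ⟨i, rfl | rfl⟩
    · obtain ⟨d, rfl⟩ := Nat.exists_eq_add_of_le (show i ≤ M by omega)
      have hD : 1 / 2 + (racahParams μ₁ μ₂ μ₃ (2 * (i + d) + 1)).ρ₁ -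
          (racahParams μ₁ μ₂ μ₃ (2 * (i + d) + 1)).r₂ + i =
            2 * i + d + 3 / 2 + μ₁ + μ₂ + μ₃ := by
        simp only [racahParams, tripleMu, hs]; push_cast; ring
      have p1 := (poch_pos (show 0 < 1 + (i : ℝ) + (μ₁ + μ₂) by positivity) i).ne'
      have p2 := (poch_pos (show 0 < 1 / 2 + (i : ℝ) + 1 + μ₁ by positivity) d).ne'
      have p3 := (poch_pos (show 0 < 1 / 2 + μ₃ by positivity) d).ne'
      have q1 : 2 * (i : ℝ) + μ₁ + μ₂ + 1 ≠ 0 := by positivity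
      have q2 : 1 / 2 + (i : ℝ) + μ₁ ≠ 0 := by positivity
      have q3 : 1 / 2 + μ₃ + (d : ℝ) ≠ 0 := by positivity
      have f := Nat.cast_ne_zero (R := ℝ).2 d.factorial_ne_zero
      simp only [even_two_mul i, if_true, not_true, if_false, stepWeight, bracket_odd,
        show (2 * i + 1) / 2 = i by omega,
        show (2 * i + 1) % 2 = 1 by omega, show 2 * i / 2 = i by omega,
        show 2 * i % 2 = 0 by omega, add_zero, show i + d - i = d by omega,
        show i + d + 1 - i = d + 1 by omega,
        Nat.sub_zero, Nat.add_sub_cancel, poch_succ _ i, hD, Nat.cast_zero, Nat.cast_one,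
        poch_succ_left (1 / 2 + (i : ℝ) + μ₁) d, poch_succ (1 / 2 + μ₃) d]
      push_cast
      rw [show 1 / 2 + (i : ℝ) + μ₁ + 1 = 1 / 2 + i + 1 + μ₁ by ring,
        show 1 + (i : ℝ) + (μ₁ + μ₂) + i = 2 * i + μ₁ + μ₂ + 1 by ring]
      generalize poch (1 + (i : ℝ) + (μ₁ + μ₂)) i = X at *
      generalize poch (1 / 2 + (i : ℝ) + 1 + μ₁) d = Y at *
      generalize poch (1 / 2 + μ₃) d = Z at *
      field_simp
      ring
    · obtain ⟨d, rfl⟩ := Nat.exists_eq_add_of_lt (show i < M by omega)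
      have hD : 1 - (racahParams μ₁ μ₂ μ₃ (2 * (i + d + 1) + 1)).r₁ -
          (racahParams μ₁ μ₂ μ₃ (2 * (i + d + 1) + 1)).r₂ + i = 2 * i + d + 3 + μ₁ + μ₂ := by
        simp only [racahParams, tripleMu, hs]; push_cast; ring
      have p1 := (poch_pos (show 0 < 1 + (i : ℝ) + (μ₁ + μ₂) by positivity) (i + 1)).ne'
      have p1' := (poch_pos (show 0 < 1 + (i : ℝ) + (μ₁ + μ₂) + 1 by positivity) (i + 1)).ne'
      have p2 := (poch_pos (show 0 < 1 / 2 + (i : ℝ) + 1 + μ₁ by positivity) (d + 1)).ne'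
      have p3 := (poch_pos (show 0 < 1 / 2 + μ₃ by positivity) (d + 1)).ne'
      have q1 : 2 * (i : ℝ) + 1 + μ₁ + μ₂ + 1 ≠ 0 := by positivity
      have q2 : 1 + (i : ℝ) + (μ₁ + μ₂) ≠ 0 := by positivity
      have f := Nat.cast_ne_zero (R := ℝ).2 d.factorial_ne_zero
      have e : poch (1 + (i : ℝ) + (μ₁ + μ₂)) (i + 1) =
          poch (1 + (i : ℝ) + (μ₁ + μ₂) + 1) (i + 1) * (1 + (i : ℝ) + (μ₁ + μ₂)) /
            (2 * (i : ℝ) + 1 + μ₁ + μ₂ + 1) := by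
        rw [poch_add_one_mul, eq_div_iff q1]; push_cast; ring
      have hb := bracket_even μ₁ (i + 1)
      rw [show 2 * (i + 1) = 2 * i + 1 + 1 by ring] at hb
      simp only [not_even_add_one (even_two_mul i), not_false_eq_true, if_true, if_false,
        stepWeight, hb,
        show (2 * i + 1) / 2 = i by omega, show (2 * i + 1 + 1) / 2 = i + 1 by omega,
        show (2 * i + 1) % 2 = 1 by omega, show (2 * i + 1 + 1) % 2 = 0 by omega, add_zero,
        show i + d + 1 - i = d + 1 by omega, show i + d + 1 - (i + 1) = d by omega,
        show i + d + 1 + 1 - i = d + 1 + 1 by omega,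
        show i + d + 1 + 1 - (i + 1) = d + 1 by omega,
        Nat.sub_zero, Nat.add_sub_cancel, poch_succ _ i, hD, Nat.cast_zero, Nat.cast_one,
        poch_succ_left (1 + (i : ℝ) + (μ₁ + μ₂)) (d + 1), Nat.factorial_succ i,
        Nat.factorial_succ d]
      simp only [← poch_succ _ i]
      rw [e]
      push_cast
      rw [show 1 / 2 + ((i : ℝ) + 1) + μ₁ = 1 / 2 + i + 1 + μ₁ by ring,
        show 1 + ((i : ℝ) + 1) + (μ₁ + μ₂) = 1 + i + (μ₁ + μ₂) + 1 by ring]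
      clear e p1
      generalize poch (1 + (i : ℝ) + (μ₁ + μ₂) + 1) (i + 1) = X at *
      generalize poch (1 / 2 + (i : ℝ) + 1 + μ₁) (d + 1) = Y at *
      generalize poch (1 / 2 + μ₃) (d + 1) = Z at *
      field_simp
      ring

lemma bannaiItoNorm_zero {μ₁ μ₂ μ₃ : ℝ} (h₁ : 0 < μ₁) (h₃ : 0 < μ₃) (N : ℕ) :
    bannaiItoNorm 0 N (racahParams μ₁ μ₂ μ₃ N) * (bracketFactorial μ₁ N * bracketFactorial μ₃ N) =
      bracketFactorial (coupledMu μ₁ μ₂ 0) N * bracketFactorial (coupledMu μ₂ μ₃ 0) N := by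
  have hB : 1 / 2 + (racahParams μ₁ μ₂ μ₃ N).ρ₁ + (racahParams μ₁ μ₂ μ₃ N).r₁ = μ₃ + 1 / 2 := by
    simp only [racahParams]; ring
  have hC : ∀ x : ℝ, x + (racahParams μ₁ μ₂ μ₃ N).ρ₂ - (racahParams μ₁ μ₂ μ₃ N).r₂ = x + μ₁ :=
    fun x => by simp only [racahParams]; ring
  have hE : 1 + 2 * (racahParams μ₁ μ₂ μ₃ N).ρ₁ = μ₂ + μ₃ + 1 / 2 + 1 / 2 := by
    simp only [racahParams]; ring
  simp only [bannaiItoNorm, racahParams_g, hB, hC, hE]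
  rcases Nat.even_or_odd' N with ⟨M, rfl | rfl⟩
  · have p2 := (poch_pos (show 0 < μ₁ + 1 / 2 by positivity) M).ne'
    have p3 := (poch_pos (show 0 < μ₃ + 1 / 2 by positivity) M).ne'
    have f := Nat.cast_ne_zero (R := ℝ).2 M.factorial_ne_zero
    simp only [even_two_mul, if_true, bracketFactorial_even, coupledMu, poch_zero,
      show 2 * M / 2 = M by omega, Nat.zero_div, Nat.zero_mod, Nat.sub_zero, Nat.cast_zero,
      add_zero, Nat.factorial_zero, Nat.cast_one]
    rw [show 1 + (μ₁ + μ₂) = μ₁ + μ₂ + 1 / 2 + 1 / 2 by ring, add_comm (1 / 2) μ₁]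
    generalize poch (μ₁ + 1 / 2) M = X at *
    generalize poch (μ₃ + 1 / 2) M = Y at *
    generalize poch _ M = Z at *
    generalize poch _ M = W at *
    field_simp
  · have p2 := (poch_pos (show 0 < μ₁ + 1 / 2 by positivity) (M + 1)).ne'
    have p3 := (poch_pos (show 0 < μ₃ + 1 / 2 by positivity) (M + 1)).ne'
    have f := Nat.cast_ne_zero (R := ℝ).2 M.factorial_ne_zero
    simp only [not_even_add_one (even_two_mul M), if_false, bracketFactorial_odd, coupledMu,
      poch_zero, show (2 * M + 1) / 2 = M by omega, Nat.zero_div, Nat.zero_mod, Nat.sub_zero,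
      Nat.cast_zero, add_zero, Nat.factorial_zero, Nat.cast_one]
    rw [show 1 + (μ₁ + μ₂) = μ₁ + μ₂ + 1 / 2 + 1 / 2 by ring, add_comm (1 / 2) μ₁]
    generalize poch (μ₁ + 1 / 2) (M + 1) = X at *
    generalize poch (μ₃ + 1 / 2) (M + 1) = Y at *
    generalize poch _ (M + 1) = Z at *
    generalize poch _ (M + 1) = W at *
    field_simp

/-! ### Closed forms of the weights and norms -/

lemma bracketFactorial_succ_of_even (a : ℝ) {m : ℕ} (h : Even m) :
    bracketFactorial a (m + 1) = (a + 1 / 2) * bracketFactorial (a + 1) m := by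
  obtain ⟨r, rfl⟩ := even_iff_exists_two_mul.1 h
  rw [bracketFactorial_odd, bracketFactorial_even, poch_succ_left,
    show a + 1 + 1 / 2 = a + 1 / 2 + 1 by ring]
  ring

lemma bracketFactorial_succ_of_odd (a : ℝ) {m : ℕ} (h : ¬ Even m) :
    bracketFactorial a (m + 1) * (a + ((m : ℝ) + 1) / 2 + 1 / 2) =
      ((m : ℝ) + 1) / 2 * (a + 1 / 2) * bracketFactorial (a + 1) m := by
  obtain ⟨r, rfl⟩ := Nat.not_even_iff_odd.1 h
  have e := poch_add_one_mul (a + 1 / 2) (r + 1)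
  rw [show 2 * r + 1 + 1 = 2 * (r + 1) by ring, bracketFactorial_odd, bracketFactorial_even,
    show a + 1 + 1 / 2 = a + 1 / 2 + 1 by ring, Nat.factorial_succ]
  push_cast at e ⊢
  linear_combination (-((r : ℝ) + 1) * r.factorial) * e

lemma normProd_succ_mul_stepWeight (μ₁ μ₂ : ℝ) (n : ℕ) :
    normProd (μ₁ + μ₂) (n + 1) * stepWeight μ₁ μ₂ n =
      normProd (μ₁ + μ₂) n * (bracket μ₂ (n + 1) * (n + μ₁ + μ₂ + 1)) := by
  by_cases h : Even n
  · rw [normProd_succ_of_even _ h, stepWeight, if_pos h, bracket, if_neg (not_even_add_one h)]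
    push_cast; ring
  · rw [stepWeight, if_neg h, bracket, if_pos (even_add_one_of_not h)]
    have := normProd_succ_of_odd (μ₁ + μ₂) h
    push_cast
    linear_combination this

/-- The change of the coupled factors under `n ↦ n + 1` at fixed `N`; used for both orders of
coupling. -/
lemma gaugeRatio_mul_bracketFactorial_mul_normProd {μ₁ μ₂ μ₃ : ℝ} (h₁ : 0 < μ₁) (h₂ : 0 < μ₂)
    (h₃ : 0 < μ₃) (n m : ℕ) :
    gaugeRatio μ₁ μ₂ μ₃ (n + (m + 1)) n * bracket μ₃ (m + 1) * (n + μ₁ + μ₂ + 1) *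
      (bracketFactorial (coupledMu μ₁ μ₂ (n + 1)) m *
        normProd (μ₁ + μ₂ + μ₃ + (n + 1 : ℕ) + 1 / 2) m) =
      bracketFactorial (coupledMu μ₁ μ₂ n) (m + 1) *
        normProd (μ₁ + μ₂ + μ₃ + n + 1 / 2) (m + 1) := by
  have hp : (n + (m + 1) + n) = 2 * n + (m + 1) := by ring
  have hc : coupledMu μ₁ μ₂ (n + 1) = coupledMu μ₁ μ₂ n + 1 := by
    simp only [coupledMu]; push_cast; ring
  rw [normProd_succ_left, gaugeRatio, hp, hc]
  push_cast
  rw [show μ₁ + μ₂ + μ₃ + ((n : ℝ) + 1) + 1 / 2 = μ₁ + μ₂ + μ₃ + n + 1 / 2 + 1 by ring,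
    show (n : ℝ) + (m + 1) - n = m + 1 by ring]
  by_cases h : Even m
  · have h' := not_even_add_one h
    have d : ((m : ℝ) + 1) / 2 + μ₃ ≠ 0 := by positivity
    rw [if_neg (by simpa [Nat.even_add] using h'), bracket, if_neg h', bracket, if_neg h',
      bracketFactorial_succ_of_even _ h]
    push_cast
    rw [div_mul_cancel₀ _ d, coupledMu]
    ring
  · have h' := even_add_one_of_not h
    have d : ((n : ℝ) + (m + 1) + n) / 2 + μ₁ + μ₂ + 1 ≠ 0 := by positivity
    have := bracketFactorial_succ_of_odd (coupledMu μ₁ μ₂ n) h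
    rw [if_pos (by simpa [Nat.even_add] using h'), bracket, if_pos h', bracket, if_pos h']
    push_cast
    rw [div_mul_eq_mul_div, div_mul_eq_mul_div, div_mul_eq_mul_div, div_eq_iff d]
    rw [show coupledMu μ₁ μ₂ n + ((m : ℝ) + 1) / 2 + 1 / 2 =
      ((n : ℝ) + (m + 1) + n) / 2 + μ₁ + μ₂ + 1 by unfold coupledMu; ring,
      show coupledMu μ₁ μ₂ n + 1 / 2 = n + μ₁ + μ₂ + 1 by unfold coupledMu; ring] at this
    linear_combination (-(((m : ℝ) + 1) / 2) *
      normProd (μ₁ + μ₂ + μ₃ + n + 1 / 2 + 1) m) * this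

lemma balanceWeight_eq {μ₁ μ₂ μ₃ : ℝ} (h₁ : 0 < μ₁) (h₂ : 0 < μ₂) (h₃ : 0 < μ₃) {N k : ℕ}
    (hk : k ≤ N) : balanceWeight μ₁ μ₂ μ₃ N k =
      bracketFactorial μ₁ N /
        (bracketFactorial (coupledMu μ₁ μ₂ 0) N * bracketFactorial (coupledMu μ₂ μ₃ 0) N) *
      bannaiItoWeight k (racahParams μ₁ μ₂ μ₃ N) := by
  rw [balanceWeight]
  congr 1
  induction k with
  | zero => rw [bannaiItoWeight_zero, Finset.prod_range_zero]
  | succ k ih =>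
    rw [Finset.prod_range_succ, ih (by omega), bannaiItoWeight_succ h₁ h₂ h₃ hk]

/-- A closed form of `w_k` in bracket factorials. -/
lemma bannaiItoWeight_closed_form {μ₁ μ₂ μ₃ : ℝ} (h₁ : 0 < μ₁) (h₂ : 0 < μ₂) (h₃ : 0 < μ₃)
    {N k : ℕ} (hk : k ≤ N) :
    bannaiItoWeight k (racahParams μ₁ μ₂ μ₃ N) * bracketFactorial μ₃ k *
      (bracketFactorial (coupledMu μ₂ μ₃ k) (N - k) *
        normProd (μ₁ + μ₂ + μ₃ + k + 1 / 2) (N - k)) *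
      normProd (μ₂ + μ₃) k * bracketFactorial μ₁ N =
      bracketFactorial (coupledMu μ₂ μ₃ 0) N * normProd (μ₁ + μ₂ + μ₃ + 1 / 2) N *
        bracketFactorial μ₂ k * bracketFactorial μ₁ (N - k) := by
  induction k with
  | zero =>
    simp only [bannaiItoWeight_zero, bracketFactorial_zero, Nat.sub_zero, Nat.cast_zero, add_zero]
    simp [normProd, poch_zero]
  | succ k ih =>
    have ih := ih (by omega)
    obtain ⟨m, rfl⟩ := Nat.exists_eq_add_of_le hk
    have hmid := gaugeRatio_mul_bracketFactorial_mul_normProd h₃ h₂ h₁ k m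
    have hz := normProd_succ_mul_stepWeight μ₃ μ₂ k
    have hw := bannaiItoWeight_succ h₁ h₂ h₃ (N := k + 1 + m) (k := k) (by omega)
    have hg := upRate_div_downRate h₁ h₂ h₃ (N := k + 1 + m) (k := k) (by omega)
    have b3 := (bracket_succ_pos (μ := μ₃) (by linarith) k).ne'
    have b1 := (bracket_succ_pos (μ := μ₁) (by linarith) m).ne'
    have hc : ∀ j, coupledMu μ₃ μ₂ j = coupledMu μ₂ μ₃ j := fun j => by unfold coupledMu; ring
    rw [show k + 1 + m - k = m + 1 by omega] at ih
    rw [show k + 1 + m - (k + 1) = m by omega]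
    rw [show k + (m + 1) = k + 1 + m by ring, hc, hc, show μ₃ + μ₂ + μ₁ = μ₁ + μ₂ + μ₃ by ring]
      at hmid
    rw [add_comm μ₃ μ₂] at hz
    rw [← hmid] at ih
    have hg' : upRate μ₁ μ₂ μ₃ (k + 1 + m) k / downRate μ₁ μ₂ μ₃ (k + 1 + m) (k + 1) *
        bracket μ₃ (k + 1) = stepWeight μ₃ μ₂ k * gaugeRatio μ₃ μ₂ μ₁ (k + 1 + m) k := by
      rw [hg, div_mul_eq_mul_div, div_mul_cancel₀ _ b3]
    rw [hw, bracketFactorial_succ μ₃, bracketFactorial_succ μ₂]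
    rw [bracketFactorial_succ μ₁ m] at ih
    refine mul_right_cancel₀ b1 ?_
    set X := bracketFactorial (coupledMu μ₂ μ₃ (k + 1)) m *
      normProd (μ₁ + μ₂ + μ₃ + (k + 1 : ℕ) + 1 / 2) m
    linear_combination
      (bannaiItoWeight k (racahParams μ₁ μ₂ μ₃ (k + 1 + m)) * bracketFactorial μ₃ k * X *
        normProd (μ₂ + μ₃) (k + 1) * bracketFactorial μ₁ (k + 1 + m) * bracket μ₁ (m + 1)) * hg' +
      (bannaiItoWeight k (racahParams μ₁ μ₂ μ₃ (k + 1 + m)) * bracketFactorial μ₃ k * X *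
        gaugeRatio μ₃ μ₂ μ₁ (k + 1 + m) k * bracketFactorial μ₁ (k + 1 + m) *
        bracket μ₁ (m + 1)) * hz + bracket μ₂ (k + 1) * ih

lemma stepDown_succ_mul_stepWeight {μ₁ μ₂ μ₃ : ℝ} (h₁ : 0 < μ₁) (h₂ : 0 < μ₂) (h₃ : 0 < μ₃)
    {N n : ℕ} (hn : n ≤ N) :
    stepDown μ₁ μ₂ μ₃ N (n + 1) * stepWeight μ₁ μ₂ n =
      bracket μ₁ (n + 1) * (stepUp μ₁ μ₂ μ₃ N n * gaugeRatio μ₁ μ₂ μ₃ N n) := by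
  rw [stepUp_mul_gaugeRatio h₁ h₂ h₃ hn, stepDown_succ]
  split_ifs <;> ring

lemma stepWeight_pos {μ₁ μ₂ : ℝ} (h₁ : 0 < μ₁) (h₂ : 0 < μ₂) (n : ℕ) :
    0 < stepWeight μ₁ μ₂ n := by
  unfold stepWeight; split_ifs <;> positivity

/-- A closed form of `h_n / η_n ^ 2` in bracket factorials and gauge ratios. -/
lemma bannaiItoNorm_closed_form {μ₁ μ₂ μ₃ : ℝ} (h₁ : 0 < μ₁) (h₂ : 0 < μ₂) (h₃ : 0 < μ₃)
    {N n : ℕ} (hn : n ≤ N) :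
    bracketFactorial μ₂ n * bracketFactorial μ₃ (N - n) *
      bannaiItoNorm n N (racahParams μ₁ μ₂ μ₃ N) *
      (normProd (μ₁ + μ₂ + μ₃ + 1 / 2) N * bracketFactorial μ₁ N) =
      bracketFactorial (coupledMu μ₂ μ₃ 0) N * (∏ t ∈ Finset.range n, gaugeRatio μ₁ μ₂ μ₃ N t) ^ 2 *
        bracketFactorial μ₁ n * (bracketFactorial (coupledMu μ₁ μ₂ n) (N - n) *
          normProd (μ₁ + μ₂ + μ₃ + n + 1 / 2) (N - n)) *
        normProd (μ₁ + μ₂) n * bannaiItoEta n (racahParams μ₁ μ₂ μ₃ N) ^ 2 := by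
  induction n with
  | zero =>
    have := bannaiItoNorm_zero (μ₂ := μ₂) h₁ h₃ N
    simp only [bannaiItoEta_zero, bracketFactorial_zero, Nat.sub_zero, Nat.cast_zero, add_zero,
      Finset.prod_range_zero]
    have hz : normProd (μ₁ + μ₂) 0 = 1 := by simp [normProd, poch_zero]
    rw [hz]
    linear_combination normProd (μ₁ + μ₂ + μ₃ + 1 / 2) N * this
  | succ n ih =>
    have ih := ih (by omega)
    obtain ⟨m, rfl⟩ := Nat.exists_eq_add_of_le hn
    have hmid := gaugeRatio_mul_bracketFactorial_mul_normProd h₁ h₂ h₃ n m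
    have hz := normProd_succ_mul_stepWeight μ₁ μ₂ n
    have hh := bannaiItoNorm_succ h₁ h₂ h₃ (N := n + 1 + m) (n := n) (by omega)
    have he := bannaiItoEta_succ h₁ h₂ μ₃ (n + 1 + m) n
    have hd := stepDown_succ_mul_stepWeight h₁ h₂ h₃ (N := n + 1 + m) (n := n) (by omega)
    have b3 := (bracket_succ_pos (μ := μ₃) (by linarith) m).ne'
    have hs := (stepWeight_pos h₁ h₂ n).ne'
    rw [show n + 1 + m - n = m + 1 by omega] at ih
    rw [show n + 1 + m - (n + 1) = m by omega]
    rw [show n + (m + 1) = n + 1 + m by ring] at hmid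
    rw [← hmid, bracketFactorial_succ μ₃ m] at ih
    rw [hh, he, bracketFactorial_succ μ₁, bracketFactorial_succ μ₂, Finset.prod_range_succ]
    refine mul_right_cancel₀ (mul_ne_zero b3 hs) ?_
    set X := bracketFactorial (coupledMu μ₁ μ₂ (n + 1)) m *
      normProd (μ₁ + μ₂ + μ₃ + (n + 1 : ℕ) + 1 / 2) m
    set p := racahParams μ₁ μ₂ μ₃ (n + 1 + m)
    set U := stepUp μ₁ μ₂ μ₃ (n + 1 + m) n
    set γ := gaugeRatio μ₁ μ₂ μ₃ (n + 1 + m) n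
    set P := ∏ t ∈ Finset.range n, gaugeRatio μ₁ μ₂ μ₃ (n + 1 + m) t
    linear_combination
      (bracketFactorial μ₂ n * bracket μ₂ (n + 1) * bracketFactorial μ₃ m *
        bannaiItoNorm n (n + 1 + m) p * (normProd (μ₁ + μ₂ + μ₃ + 1 / 2) (n + 1 + m) *
          bracketFactorial μ₁ (n + 1 + m)) * U * bracket μ₃ (m + 1)) * hd +
      (bracket μ₂ (n + 1) * U * bracket μ₁ (n + 1) * (U * γ)) * ih -
      (bracketFactorial (coupledMu μ₂ μ₃ 0) (n + 1 + m) * P ^ 2 * γ ^ 2 *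
        bracketFactorial μ₁ n * bracket μ₁ (n + 1) * X * bannaiItoEta n p ^ 2 * U ^ 2 *
        bracket μ₃ (m + 1)) * hz

/-! ### Signs and square roots -/

lemma gaugeRatio_pos {μ₁ μ₂ μ₃ : ℝ} (h₁ : 0 < μ₁) (h₂ : 0 < μ₂) (h₃ : 0 < μ₃) {N n : ℕ}
    (hn : n < N) : 0 < gaugeRatio μ₁ μ₂ μ₃ N n := by
  have hn' : (0 : ℝ) < N - n := by
    have : (n : ℝ) < N := by exact_mod_cast hn
    linarith
  unfold gaugeRatio
  split_ifs <;> positivity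

/-- The sign of `η_n`, written with the part of the phase exponent that does not depend on `k`. -/
lemma neg_one_pow_mul_bannaiItoEta_pos {μ₁ μ₂ μ₃ : ℝ} (h₁ : 0 < μ₁) (h₂ : 0 < μ₂) (h₃ : 0 < μ₃)
    {N n : ℕ} (hn : n ≤ N) :
    0 < (-1) ^ (N * ((n - 1) * n / 2) + (N + 1) * ((n + 1) * n / 2)) *
      bannaiItoEta n (racahParams μ₁ μ₂ μ₃ N) := by
  induction n with
  | zero => simp [bannaiItoEta_zero]
  | succ n ih =>
    have hn' : (0 : ℝ) < N - n := by
      have : (n : ℝ) < N := by exact_mod_cast hn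
      linarith
    have t1 : (n + 1 - 1) * (n + 1) / 2 = (n - 1) * n / 2 + n := by
      have := Nat.triangle_succ n
      rwa [mul_comm, mul_comm n (n - 1)] at this
    have t2 : (n + 1 + 1) * (n + 1) / 2 = (n + 1) * n / 2 + (n + 1) := by
      have := Nat.triangle_succ (n + 1)
      rwa [Nat.add_sub_cancel, Nat.add_sub_cancel] at this
    have hw := stepWeight_pos h₁ h₂ n
    rw [bannaiItoEta_succ h₁ h₂, t1, t2,
      show N * ((n - 1) * n / 2 + n) + (N + 1) * ((n + 1) * n / 2 + (n + 1)) =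
        (N * ((n - 1) * n / 2) + (N + 1) * ((n + 1) * n / 2)) + (2 * (N * n) + (N + n + 1)) by ring,
      pow_add, pow_add _ (2 * (N * n)), (even_two_mul _).neg_one_pow, one_mul]
    have key : 0 < (-1) ^ (N + n + 1) * stepUp μ₁ μ₂ μ₃ N n := by
      rw [stepUp_eq, pow_succ]
      split_ifs with h
      · rw [h.neg_one_pow]
        have : 0 < stepWeight μ₁ μ₂ n / (n + μ₁ + μ₂ + 1) * (((N : ℝ) + n) / 2 + μ₁ + μ₂ + 1) := by
          positivity
        linarith
      · rw [(Nat.not_even_iff_odd.1 h).neg_one_pow, neg_mul_neg, one_mul, one_mul]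
        positivity
    have := mul_pos (ih (by omega)) key
    linarith

lemma bannaiItoWeight_pos {μ₁ μ₂ μ₃ : ℝ} (h₁ : 0 < μ₁) (h₂ : 0 < μ₂) (h₃ : 0 < μ₃)
    {N k : ℕ} (hk : k ≤ N) : 0 < bannaiItoWeight k (racahParams μ₁ μ₂ μ₃ N) := by
  induction k with
  | zero => rw [bannaiItoWeight_zero]; exact one_pos
  | succ k ih =>
    have := gaugeRatio_pos h₃ h₂ h₁ hk
    have := stepWeight_pos h₃ h₂ k
    have := bracket_succ_pos (μ := μ₃) (by linarith) k
    rw [bannaiItoWeight_succ h₁ h₂ h₃ hk, upRate_div_downRate h₁ h₂ h₃ hk]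
    have := ih (by omega)
    positivity

/-- The modulus of the factor of `b_n(x_k)` in `coupledPoly_mul_eq_sum_biSum`. -/
def racahAmplitude (μ₁ μ₂ μ₃ : ℝ) (N n k : ℕ) : ℝ :=
  bracketFactorial μ₃ k / bracketFactorial μ₁ n *
    (couplingWeight μ₁ μ₂ μ₃ N k * racahFactor μ₁ μ₂ μ₃ N n)

lemma racahAmplitude_eq {μ₁ μ₂ μ₃ : ℝ} (h₁ : 0 < μ₁) (h₂ : 0 < μ₂) (h₃ : 0 < μ₃)
    {N k : ℕ} (n : ℕ) (hk : k ≤ N) :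
    racahAmplitude μ₁ μ₂ μ₃ N n k =
      bracketFactorial μ₃ k * bannaiItoWeight k (racahParams μ₁ μ₂ μ₃ N) *
        bracketFactorial (coupledMu μ₂ μ₃ k) (N - k) * bracketFactorial μ₁ N /
      (bracketFactorial μ₁ n * (∏ t ∈ Finset.range n, gaugeRatio μ₁ μ₂ μ₃ N t) *
        bracketFactorial (coupledMu μ₁ μ₂ n) (N - n) *
        bracketFactorial (coupledMu μ₂ μ₃ 0) N) := by
  have b := bracketFactorial_ne_zero (coupledMu_pos h₁ h₂ 0) N
  rw [racahAmplitude, couplingWeight, balanceWeight_eq h₁ h₂ h₃ hk, racahFactor, gaugeFactor]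
  simp only [div_eq_mul_inv, mul_inv, inv_inv]
  field_simp

lemma racahAmplitude_pos {μ₁ μ₂ μ₃ : ℝ} (h₁ : 0 < μ₁) (h₂ : 0 < μ₂) (h₃ : 0 < μ₃)
    {N n k : ℕ} (hn : n ≤ N) (hk : k ≤ N) : 0 < racahAmplitude μ₁ μ₂ μ₃ N n k := by
  have hbf : ∀ {μ : ℝ}, 0 < μ → ∀ j, 0 < bracketFactorial μ j := fun hμ j =>
    bracketFactorial_pos (by linarith) j
  have hG : 0 < ∏ t ∈ Finset.range n, gaugeRatio μ₁ μ₂ μ₃ N t := Finset.prod_pos fun t ht =>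
    gaugeRatio_pos h₁ h₂ h₃ ((Finset.mem_range.1 ht).trans_le hn)
  rw [racahAmplitude_eq h₁ h₂ h₃ n hk]
  have := hbf h₁ n
  have := hbf h₁ N
  have := hbf h₃ k
  have := hbf (coupledMu_pos h₂ h₃ k) (N - k)
  have := hbf (coupledMu_pos h₂ h₃ 0) N
  have := hbf (coupledMu_pos h₁ h₂ n) (N - n)
  have := bannaiItoWeight_pos h₁ h₂ h₃ hk
  positivity

lemma bannaiItoNorm_pos {μ₁ μ₂ μ₃ : ℝ} (h₁ : 0 < μ₁) (h₂ : 0 < μ₂) (h₃ : 0 < μ₃)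
    {N n : ℕ} (hn : n ≤ N) : 0 < bannaiItoNorm n N (racahParams μ₁ μ₂ μ₃ N) := by
  have hbf : ∀ {μ : ℝ}, 0 < μ → ∀ j, 0 < bracketFactorial μ j := fun hμ j =>
    bracketFactorial_pos (by linarith) j
  have hG : 0 < ∏ t ∈ Finset.range n, gaugeRatio μ₁ μ₂ μ₃ N t := Finset.prod_pos fun t ht =>
    gaugeRatio_pos h₁ h₂ h₃ ((Finset.mem_range.1 ht).trans_le hn)
  have he : 0 < bannaiItoEta n (racahParams μ₁ μ₂ μ₃ N) ^ 2 :=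
    sq_pos_of_ne_zero (right_ne_zero_of_mul (neg_one_pow_mul_bannaiItoEta_pos h₁ h₂ h₃ hn).ne')
  have key := bannaiItoNorm_closed_form h₁ h₂ h₃ hn
  have := hbf h₁ n
  have := hbf h₁ N
  have := hbf h₂ n
  have := hbf h₃ (N - n)
  have := hbf (coupledMu_pos h₂ h₃ 0) N
  have := hbf (coupledMu_pos h₁ h₂ n) (N - n)
  have := normProd_pos (ν := μ₁ + μ₂) (by positivity) n
  have := normProd_pos (ν := μ₁ + μ₂ + μ₃ + 1 / 2) (by positivity) N
  have := normProd_pos (ν := μ₁ + μ₂ + μ₃ + n + 1 / 2) (by positivity) (N - n)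
  rw [mul_right_comm] at key
  refine pos_of_mul_pos_right (a := bracketFactorial μ₂ n * bracketFactorial μ₃ (N - n) *
    (normProd (μ₁ + μ₂ + μ₃ + 1 / 2) N * bracketFactorial μ₁ N)) ?_ (by positivity)
  rw [key]
  positivity

lemma racahAmplitude_sq {μ₁ μ₂ μ₃ : ℝ} (h₁ : 0 < μ₁) (h₂ : 0 < μ₂) (h₃ : 0 < μ₃)
    {N n k : ℕ} (hn : n ≤ N) (hk : k ≤ N) :
    racahAmplitude μ₁ μ₂ μ₃ N n k ^ 2 *
      (coupledNorm μ₁ μ₂ n * coupledNorm (coupledMu μ₁ μ₂ n) μ₃ (N - n)) *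
      bannaiItoNorm n N (racahParams μ₁ μ₂ μ₃ N) =
      bannaiItoWeight k (racahParams μ₁ μ₂ μ₃ N) *
        bannaiItoEta n (racahParams μ₁ μ₂ μ₃ N) ^ 2 *
        (coupledNorm μ₂ μ₃ k * coupledNorm μ₁ (coupledMu μ₂ μ₃ k) (N - k)) := by
  have hbf : ∀ {μ : ℝ}, 0 < μ → ∀ j, bracketFactorial μ j ≠ 0 := fun hμ j =>
    bracketFactorial_ne_zero hμ j
  have hG : ∏ t ∈ Finset.range n, gaugeRatio μ₁ μ₂ μ₃ N t ≠ 0 :=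
    (Finset.prod_pos fun t ht =>
      gaugeRatio_pos h₁ h₂ h₃ ((Finset.mem_range.1 ht).trans_le hn)).ne'
  have hF := bannaiItoWeight_closed_form h₁ h₂ h₃ hk
  have hH := bannaiItoNorm_closed_form h₁ h₂ h₃ hn
  have b1 := hbf h₁ n
  have b2 := hbf (coupledMu_pos h₂ h₃ 0) N
  have b3 := hbf (coupledMu_pos h₁ h₂ n) (N - n)
  have z0 := (normProd_pos (ν := μ₁ + μ₂ + μ₃ + 1 / 2) (by positivity) N).ne'
  have z1 := (normProd_pos (ν := μ₁ + μ₂) (by positivity) n).ne'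
  have z2 := (normProd_pos (ν := μ₂ + μ₃) (by positivity) k).ne'
  have z3 := (normProd_pos (ν := μ₁ + μ₂ + μ₃ + n + 1 / 2) (by positivity) (N - n)).ne'
  have z4 := (normProd_pos (ν := μ₁ + μ₂ + μ₃ + k + 1 / 2) (by positivity) (N - k)).ne'
  have e1 : coupledMu μ₁ μ₂ n + μ₃ = μ₁ + μ₂ + μ₃ + n + 1 / 2 := by unfold coupledMu; ring
  have e2 : μ₁ + coupledMu μ₂ μ₃ k = μ₁ + μ₂ + μ₃ + k + 1 / 2 := by unfold coupledMu; ring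
  have p : ∀ j, j ≤ N → (2 : ℝ) ^ j * 2 ^ (N - j) = 2 ^ N := fun j hj => by
    rw [← pow_add, Nat.add_sub_cancel' hj]
  rw [racahAmplitude_eq h₁ h₂ h₃ n hk, coupledNorm, coupledNorm, coupledNorm, coupledNorm, e1, e2,
    div_mul_div_comm, div_mul_div_comm,
    mul_mul_mul_comm (2 ^ n : ℝ), mul_mul_mul_comm (2 ^ k : ℝ), p n hn, p k hk]
  clear p e1 e2 hbf
  generalize bannaiItoWeight k (racahParams μ₁ μ₂ μ₃ N) = w at *
  generalize bannaiItoEta n (racahParams μ₁ μ₂ μ₃ N) = η at *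
  generalize bannaiItoNorm n N (racahParams μ₁ μ₂ μ₃ N) = h at *
  generalize (∏ t ∈ Finset.range n, gaugeRatio μ₁ μ₂ μ₃ N t) = G at *
  generalize bracketFactorial (coupledMu μ₂ μ₃ 0) N = Q at *
  generalize bracketFactorial (coupledMu μ₂ μ₃ k) (N - k) = E at *
  generalize bracketFactorial (coupledMu μ₁ μ₂ n) (N - n) = B at *
  generalize normProd (μ₁ + μ₂ + μ₃ + 1 / 2) N = Z at *
  generalize normProd (μ₁ + μ₂) n = Z₁ at *
  generalize normProd (μ₂ + μ₃) k = Z₂ at *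
  generalize normProd (μ₁ + μ₂ + μ₃ + n + 1 / 2) (N - n) = Z₃ at *
  generalize normProd (μ₁ + μ₂ + μ₃ + k + 1 / 2) (N - k) = Z₄ at *
  generalize bracketFactorial μ₁ n = a at *
  generalize bracketFactorial μ₂ n = b at *
  generalize bracketFactorial μ₃ (N - n) = c at *
  generalize bracketFactorial μ₂ k = d at *
  generalize bracketFactorial μ₃ k = e at *
  generalize bracketFactorial μ₁ (N - k) = f at *
  generalize bracketFactorial μ₁ N = M at *
  have hpow : (2 : ℝ) ^ N ≠ 0 := by positivity
  generalize (2 : ℝ) ^ N = T at *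
  rw [div_pow, div_mul_div_comm, div_mul_eq_mul_div, mul_div_assoc', div_eq_div_iff
    (by simp [*]) (by simp [*])]
  refine mul_right_cancel₀ z0 ?_
  linear_combination (e ^ 2 * w ^ 2 * E ^ 2 * M * a * B * Z₂ * Z₄ * T) * hH +
    (w * η ^ 2 * e * E * a ^ 2 * G ^ 2 * B ^ 2 * Q * Z₁ * Z₃ * T) * hF

/-- The coefficients of the normalised identity agree with those of `coupledPoly_mul_eq_sum_biSum`.
-/
lemma sqrt_weight_div_norm_mul_eta {μ₁ μ₂ μ₃ : ℝ} (h₁ : 0 < μ₁) (h₂ : 0 < μ₂) (h₃ : 0 < μ₃)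
    {N n k : ℕ} (hn : n ≤ N) (hk : k ≤ N) :
    Real.sqrt (bannaiItoWeight k (racahParams μ₁ μ₂ μ₃ N) /
        bannaiItoNorm n N (racahParams μ₁ μ₂ μ₃ N)) *
      ((-1) ^ (N * ((n - 1) * n / 2) + (N + 1) * ((n + 1) * n / 2)) *
        bannaiItoEta n (racahParams μ₁ μ₂ μ₃ N)) *
      (Real.sqrt (coupledNorm μ₂ μ₃ k) * Real.sqrt (coupledNorm μ₁ (coupledMu μ₂ μ₃ k) (N - k))) =
      racahAmplitude μ₁ μ₂ μ₃ N n k *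
        (Real.sqrt (coupledNorm μ₁ μ₂ n) *
          Real.sqrt (coupledNorm (coupledMu μ₁ μ₂ n) μ₃ (N - n))) := by
  have hη := neg_one_pow_mul_bannaiItoEta_pos h₁ h₂ h₃ hn
  have hτ := racahAmplitude_pos h₁ h₂ h₃ hn hk
  have hw := bannaiItoWeight_pos h₁ h₂ h₃ hk
  have hh := bannaiItoNorm_pos h₁ h₂ h₃ hn
  have c1 := coupledNorm_pos h₂ h₃ k
  have c2 := coupledNorm_pos h₁ (coupledMu_pos h₂ h₃ k) (N - k)
  have c3 := coupledNorm_pos h₁ h₂ n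
  have c4 := coupledNorm_pos (coupledMu_pos h₁ h₂ n) h₃ (N - n)
  rw [← sq_eq_sq₀ (by positivity) (by positivity)]
  simp only [mul_pow]
  rw [Real.sq_sqrt (by positivity), Real.sq_sqrt c1.le, Real.sq_sqrt c2.le, Real.sq_sqrt c3.le,
    Real.sq_sqrt c4.le, ← pow_mul, mul_comm _ 2, (even_two_mul _).neg_one_pow, one_mul,
    div_mul_eq_mul_div, div_mul_eq_mul_div, div_eq_iff hh.ne']
  exact (racahAmplitude_sq h₁ h₂ h₃ hn hk).symm

/-! ### The convolution identity -/

lemma coupledPoly_smul (μ₁ μ₂ : ℝ) (n : ℕ) (η c x y : ℝ) :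
    coupledPoly μ₁ μ₂ n (η * c) (η * x) (η * y) = η ^ n * coupledPoly μ₁ μ₂ n c x y := by
  rw [coupledPoly, coupledPoly, pairPoly, pairPoly, Finset.mul_sum]
  refine Finset.sum_congr rfl fun p hp => ?_
  rw [← Finset.HasAntidiagonal.mem_antidiagonal.1 hp, signedPow_smul, signedPow_smul, pow_add]
  ring

lemma bannaiItoGrid_add (μ₁ μ₂ μ₃ : ℝ) (N k : ℕ) :
    bannaiItoGrid k (racahParams μ₁ μ₂ μ₃ N) + 1 / 4 = node (μ₂ + μ₃) k := by
  simp only [bannaiItoGrid, racahParams, node]; ring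

end

theorem proposition7
    (μ₁ μ₂ μ₃ : ℝ) (hμ₁ : 0 < μ₁) (hμ₂ : 0 < μ₂) (hμ₃ : 0 < μ₃)
    (ε₁ ε₂ ε₃ : ℝ) (hε₁ : ε₁ = 1 ∨ ε₁ = -1) (hε₂ : ε₂ = 1 ∨ ε₂ = -1) (hε₃ : ε₃ = 1 ∨ ε₃ = -1)
    (c l₁ l₂ l₃ : ℝ) (hc : |c| < |l₁|) (hl₁₂ : |l₁| < |l₂|) (hl₂₃ : |l₂| < |l₃|)
    (j₁₂ j₁₂_₃ j₁₂₃ : ℕ) (hj : j₁₂₃ = j₁₂_₃ + j₁₂) :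
    couplingK j₁₂ l₂ μ₂ μ₁ c ε₂ ε₁ *
        bigJacobi j₁₂ (ε₂ * l₁ / l₂) (2 * μ₂) (2 * μ₁) (-(c * ε₁ * ε₂ / l₂)) *
      (couplingK j₁₂_₃ l₃ μ₃ (coupledMu μ₁ μ₂ j₁₂) c ε₃ (coupledEps ε₁ ε₂ j₁₂) *
        bigJacobi j₁₂_₃ (ε₃ * l₂ / l₃) (2 * μ₃) (2 * coupledMu μ₁ μ₂ j₁₂)
          (-(c * coupledEps ε₁ ε₂ j₁₂ * ε₃ / l₃))) =
    Real.sign (l₂ * l₃) ^ j₁₂ *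
      ∑ j₂₃ ∈ Finset.range (j₁₂₃ + 1),
        (-1) ^ racahPhase j₁₂ j₂₃ j₁₂₃ * ε₃ ^ j₁₂ *
          Real.sqrt (bannaiItoWeight j₂₃ (racahParams μ₁ μ₂ μ₃ j₁₂₃) /
            bannaiItoNorm j₁₂ j₁₂₃ (racahParams μ₁ μ₂ μ₃ j₁₂₃)) *
          bannaiIto j₁₂ (bannaiItoGrid j₂₃ (racahParams μ₁ μ₂ μ₃ j₁₂₃))
            (racahParams μ₁ μ₂ μ₃ j₁₂₃) *
          (couplingK j₂₃ l₃ μ₃ μ₂ l₁ ε₃ ε₂ *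
            bigJacobi j₂₃ (ε₃ * l₂ / l₃) (2 * μ₃) (2 * μ₂) (-(l₁ * ε₂ * ε₃ / l₃))) *
          (couplingK (j₁₂₃ - j₂₃) l₃ (coupledMu μ₂ μ₃ j₂₃) μ₁ c (coupledEps ε₂ ε₃ j₂₃) ε₁ *
            bigJacobi (j₁₂₃ - j₂₃) (coupledEps ε₂ ε₃ j₂₃ * l₁ / l₃)
              (2 * coupledMu μ₂ μ₃ j₂₃) (2 * μ₁)
              (-(c * ε₁ * coupledEps ε₂ ε₃ j₂₃ / l₃))) := by
  have hsq : ∀ {ε : ℝ}, ε = 1 ∨ ε = -1 → ε ^ 2 = 1 := by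
    rintro ε (rfl | rfl) <;> norm_num
  have e₁ := hsq hε₁
  have e₂ := hsq hε₂
  have e₃ := hsq hε₃
  have hce : ∀ {a b : ℝ}, a ^ 2 = 1 → b ^ 2 = 1 → ∀ j, coupledEps a b j ^ 2 = 1 := by
    intro a b ha hb j
    rw [coupledEps, mul_pow, mul_pow, ha, hb, ← pow_mul, mul_comm j 2, (even_two_mul j).neg_one_pow]
    norm_num
  have hn : j₁₂ ≤ j₁₂₃ := by omega
  obtain rfl : j₁₂_₃ = j₁₂₃ - j₁₂ := by omega
  have hsub : ∀ j ≤ j₁₂₃, Real.sign l₃ ^ j * Real.sign l₃ ^ (j₁₂₃ - j) = Real.sign l₃ ^ j₁₂₃ :=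
    fun j hj => by rw [← pow_add, Nat.add_sub_cancel' hj]
  have hl₂ : l₂ ≠ 0 := abs_pos.1 ((abs_nonneg _).trans_lt hl₁₂)
  have hl₃ : l₃ ≠ 0 := abs_pos.1 ((abs_nonneg _).trans_lt hl₂₃)
  have hsgn : Real.sign (l₂ * l₃) = Real.sign l₂ * Real.sign l₃ := by
    rcases hl₂.lt_or_gt with h | h <;> rcases hl₃.lt_or_gt with h' | h'
    · rw [Real.sign_of_pos (mul_pos_of_neg_of_neg h h'), Real.sign_of_neg h, Real.sign_of_neg h']
      norm_num
    · rw [Real.sign_of_neg (mul_neg_of_neg_of_pos h h'), Real.sign_of_neg h, Real.sign_of_pos h']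
      norm_num
    · rw [Real.sign_of_neg (mul_neg_of_pos_of_neg h h'), Real.sign_of_pos h, Real.sign_of_neg h']
      norm_num
    · rw [Real.sign_of_pos (mul_pos h h'), Real.sign_of_pos h, Real.sign_of_pos h']
      norm_num
  have hs₃ : Real.sign l₃ ^ 2 = 1 := hsq (Real.sign_apply_eq_of_ne_zero _ hl₃).symm
  have hpow : ∀ {a : ℝ}, a ^ 2 = 1 → ∀ j, a ^ j * a ^ j = 1 := fun ha j => by
    rw [← pow_add, ← two_mul, pow_mul, ha, one_pow]
  rw [couplingK_mul_bigJacobi hμ₁ hμ₂ e₁ e₂ j₁₂ (hc.trans hl₁₂),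
    couplingK_mul_bigJacobi (coupledMu_pos hμ₁ hμ₂ j₁₂) hμ₃ (hce e₁ e₂ j₁₂) e₃ _
      ((hc.trans hl₁₂).trans hl₂₃)]
  -- with these arguments every polynomial of the claim is a rescaling by signs of one in `hcore`
  have hcore := coupledPoly_mul_eq_sum_biSum hμ₁ hμ₂ hμ₃ hn (ε₁ * ε₂ * ε₃ * c) (ε₂ * ε₃ * l₁)
    (ε₃ * l₂) l₃
  rw [show ε₁ * ε₂ * ε₃ * c = ε₃ * (c * ε₁ * ε₂) by ring,
    show ε₂ * ε₃ * l₁ = ε₃ * (ε₂ * l₁) by ring, coupledPoly_smul,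
    show (-1) ^ j₁₂ * (ε₃ * (c * ε₁ * ε₂)) = c * coupledEps ε₁ ε₂ j₁₂ * ε₃ by
      unfold coupledEps; ring] at hcore
  -- `hcore` carries a factor `ε₃ ^ j₁₂`, so its square is inserted on the left
  have hlhs : ∀ a b a' b' P Q : ℝ, a * b * P * (a' * b' * Q) =
      a * a' * (b * b') * ε₃ ^ j₁₂ * (ε₃ ^ j₁₂ * P * Q) := fun a b a' b' P Q => by
    linear_combination (-(a * b * P * (a' * b' * Q))) * hpow e₃ j₁₂
  rw [hlhs, hcore, Finset.mul_sum, Finset.mul_sum]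
  refine Finset.sum_congr rfl fun k hk => ?_
  have hk : k ≤ j₁₂₃ := Nat.lt_succ_iff.1 (Finset.mem_range.1 hk)
  rw [couplingK_mul_bigJacobi hμ₂ hμ₃ e₂ e₃ k (hl₁₂.trans hl₂₃),
    couplingK_mul_bigJacobi hμ₁ (coupledMu_pos hμ₂ hμ₃ k) e₁ (hce e₂ e₃ k) _
      ((hc.trans hl₁₂).trans hl₂₃),
    bannaiIto_racahParams _ _ _ hn, bannaiItoGrid_add]
  have hτ := sqrt_weight_div_norm_mul_eta hμ₁ hμ₂ hμ₃ hn hk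
  have hs := hsub k hk
  rw [← hsub j₁₂ hn] at hs
  have hφ : (-1 : ℝ) ^ racahPhase j₁₂ k j₁₂₃ = (-1) ^ (k * (j₁₂₃ + 1)) *
      (-1) ^ (j₁₂₃ * ((j₁₂ - 1) * j₁₂ / 2) + (j₁₂₃ + 1) * ((j₁₂ + 1) * j₁₂ / 2)) := by
    rw [← pow_add, racahPhase]; congr 1; ring
  have hss := hpow hs₃ j₁₂
  rw [hφ, hsgn, mul_pow, show ε₃ * (ε₂ * l₁) = l₁ * ε₂ * ε₃ by ring,
    show (-1) ^ k * (ε₃ * (c * ε₁ * ε₂)) = c * ε₁ * coupledEps ε₂ ε₃ k by unfold coupledEps; ring,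
    show (-1) ^ k * (l₁ * ε₂ * ε₃) = coupledEps ε₂ ε₃ k * l₁ by unfold coupledEps; ring]
  rw [racahAmplitude] at hτ
  generalize coupledPoly μ₂ μ₃ k _ _ _ = P
  generalize coupledPoly μ₁ _ _ _ _ _ = Q
  generalize biSum _ _ _ _ _ _ = b
  generalize Real.sign l₃ ^ j₁₂ = σ at *
  generalize Real.sign l₃ ^ (j₁₂₃ - j₁₂) = σ' at *
  generalize Real.sign l₃ ^ k = ς at *
  generalize Real.sign l₃ ^ (j₁₂₃ - k) = ς' at *
  generalize Real.sign l₂ ^ j₁₂ = ρ at *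
  generalize (-1 : ℝ) ^ (k * (j₁₂₃ + 1)) = θ at *
  set τ := bracketFactorial μ₃ k / bracketFactorial μ₁ j₁₂ *
    (couplingWeight μ₁ μ₂ μ₃ j₁₂₃ k * racahFactor μ₁ μ₂ μ₃ j₁₂₃ j₁₂) with hτdef
  set κ := Real.sqrt (coupledNorm μ₁ μ₂ j₁₂) *
    Real.sqrt (coupledNorm (coupledMu μ₁ μ₂ j₁₂) μ₃ (j₁₂₃ - j₁₂))
  linear_combination ρ * σ' * κ * ε₃ ^ j₁₂ * θ * b * (P * Q) * hτdef.symm -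
    (ρ * σ * ς * ς' * θ * ε₃ ^ j₁₂ * b * P * Q) * hτ -
    (ρ * σ * θ * ε₃ ^ j₁₂ * b * P * Q * (τ * κ)) * hs -
    (ρ * σ' * θ * ε₃ ^ j₁₂ * b * P * Q * (τ * κ)) * hss
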